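/- \textbf{Conventions.} A 2-category is a strict 2-category ($\mathcal{C}at$-enriched category), a 2-functor is strict, and 2-natural transformations are strict. $\mathcal{C}at$ is the 2-category of small categories. A 2-category is locally small if all its categories of arrows are small. For 2-categories $\mathcal{A},\mathcal{B}$, $\mathcal{H}om(\mathcal{A},\mathcal{B})$ is the 2-category of 2-functors $\mathcal{A}\to\mathcal{B}$, 2-natural transformations and modifications. $(-)^{op}$ reverses arrows but not 2-cells. A 2-functor $F:\mathcal{A}\to\mathcal{B}$ is a 2-equivalence if there are a 2-functor $G:\mathcal{B}\to\mathcal{A}$ and invertible 2-natural transformations $FG\cong \mathrm{id}_{\mathcal{B}}$ and $GF\cong \mathrm{id}_{\mathcal{A}}$. A 2-category $\mathcal{I}$ is 2-filtered if (F0) for all objects $i,j$ there are an object $k$ and arrows $i\to k$, $j\to k$; (F1) for all arrows $u,v:i\to j$ there are an arrow $w:j\to k$ and an invertible 2-cell $wu\cong wv$; (F2) for all 2-cells $\alpha,\beta:u\Rightarrow v$ between arrows $i\to j$ there is an arrow $w:j\to k$ with $w\alpha=w\beta$. Let $X:\mathcal{I}^{op}\to\mathcal{A}$ be a 2-functor.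 A pseudocone over $X$ with vertex $Z$ is a pseudonatural transformation from the constant 2-functor at $Z$ to $X$; with the modifications as morphisms these form a category $\mathsf{PC}(Z,X)$. A pseudocone $\pi$ with vertex $L$ is a pseudolimit of $X$ if for every object $Z$ of $\mathcal{A}$ the functor $\mathcal{A}(Z,L)\to\mathsf{PC}(Z,X)$ given by composition with $\pi$ is an isomorphism of categories. Pseudocolimits are defined dually. A 2-functor $H:\mathcal{A}\to\mathcal{B}$ preserves small 2-cofiltered pseudolimits if, for every small 2-filtered 2-category $\mathcal{I}$ and every 2-functor $X:\mathcal{I}^{op}\to\mathcal{A}$, it sends each pseudolimit of $X$ to a pseudolimit of $HX$. Let $\mathcal{C}$ be a locally small 2-category. A 2-pro-object of $\mathcal{C}$ is a 2-functor $\mathsf{X}=(\mathsf{X}_i)_{i\in\mathcal{I}}:\mathcal{I}^{op}\to\mathcal{C}$ with $\mathcal{I}$ a small 2-filtered 2-category. Let $\mathsf{L}\mathsf{X}$ be the pseudocolimit over $i\in\mathcal{I}$ of the representable 2-functors $\mathcal{C}(\mathsf{X}_i,-):\mathcal{C}\to\mathcal{C}at$ in $\mathcal{H}om(\mathcal{C},\mathcal{C}at)$.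 The 2-category $2\text{-}\mathcal{P}ro(\mathcal{C})$ has the 2-pro-objects as objects and $$2\text{-}\mathcal{P}ro(\mathcal{C})(\mathsf{X},\mathsf{Y})=\mathcal{H}om(\mathcal{C},\mathcal{C}at)(\mathsf{L}\mathsf{Y},\mathsf{L}\mathsf{X}),$$ with the compositions and identities of $\mathcal{H}om(\mathcal{C},\mathcal{C}at)^{op}$. Let $c:\mathcal{C}\to 2\text{-}\mathcal{P}ro(\mathcal{C})$ be the canonical 2-functor, which sends an object $C$ to the 2-pro-object indexed by the one-object 2-category $\{*\}$ with value $C$, and an arrow or 2-cell of $\mathcal{C}$ to the one that it induces, by pre-composition, between the 2-functors $\mathsf{L}(cC)\cong\mathcal{C}(C,-)$. Let $\mathcal{H}om(2\text{-}\mathcal{P}ro(\mathcal{C}),\mathcal{C}at)_+$ be the full sub-2-category of $\mathcal{H}om(2\text{-}\mathcal{P}ro(\mathcal{C}),\mathcal{C}at)$ on the 2-functors that preserve small 2-cofiltered pseudolimits. \textbf{Theorem.} For every locally small 2-category $\mathcal{C}$, pre-composition with $c$ is a 2-equivalence of 2-categories $$c^*:\mathcal{H}om(2\text{-}\mathcal{P}ro(\mathcal{C}),\mathcal{C}at)_+\longrightarrow\mathcal{H}om(\mathcal{C},\mathcal{C}at).$$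 -/

import Mathlib

open CategoryTheory Bicategory Opposite

attribute [local instance 10000] CategoryStruct.toQuiver

universe v u w₁ v₁ u₁ w₂ v₂ u₂ w₃ v₃ u₃

namespace TwoPro

/-! ### The 2-category of 2-functors, 2-natural transformations and modifications

A 2-category is a `Bicategory` which is `Strict`, and a 2-functor is a `StrictPseudofunctor`. -/

section Hom

variable {B : Type u₁} [Bicategory.{w₁, v₁} B] {D : Type u₂} [Bicategory.{w₂, v₂} D]

/-- A 2-natural transformation between 2-functors. -/
@[ext]
structure TwoNat (F G : StrictPseudofunctor B D) where
  app (a : B) : F.obj a ⟶ G.obj a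
  naturality {a b : B} (f : a ⟶ b) : F.map f ≫ app b = app a ≫ G.map f
  naturality₂ {a b : B} {f g : a ⟶ b} (η : f ⟶ g) :
    F.map₂ η ▷ app b ≫ eqToHom (naturality g) = eqToHom (naturality f) ≫ app a ◁ G.map₂ η

/-- A modification between 2-natural transformations. -/
@[ext]
structure Modif {F G : StrictPseudofunctor B D} (θ η : TwoNat F G) where
  app (a : B) : θ.app a ⟶ η.app a
  naturality {a b : B} (f : a ⟶ b) :
    F.map f ◁ app b ≫ eqToHom (η.naturality f) = eqToHom (θ.naturality f) ≫ app a ▷ G.map f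

lemma TwoNat.whiskerRight_eq {F G : StrictPseudofunctor B D} (θ : TwoNat F G)
    {a b : B} {f g : a ⟶ b} (α : f ⟶ g) :
    F.map₂ α ▷ θ.app b =
      eqToHom (θ.naturality f) ≫ θ.app a ◁ G.map₂ α ≫ eqToHom (θ.naturality g).symm := by
  rw [← Category.assoc, ← θ.naturality₂ α]; simp

lemma Modif.whiskerLeft_eq {F G : StrictPseudofunctor B D} {θ η : TwoNat F G} (ρ : Modif θ η)
    {a b : B} (f : a ⟶ b) :
    F.map f ◁ ρ.app b =
      eqToHom (θ.naturality f) ≫ ρ.app a ▷ G.map f ≫ eqToHom (η.naturality f).symm := by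
  rw [← Category.assoc, ← ρ.naturality f]; simp

variable [Strict D]

@[simps]
def TwoNat.id (F : StrictPseudofunctor B D) : TwoNat F F where
  app a := 𝟙 (F.obj a)
  naturality f := by rw [Strict.id_comp, Strict.comp_id]
  naturality₂ {a b f g} η := by
    simp [whiskerRight_id, id_whiskerLeft, Strict.rightUnitor_eqToIso, Strict.leftUnitor_eqToIso]

@[simps]
def TwoNat.comp {F G H : StrictPseudofunctor B D} (θ : TwoNat F G) (η : TwoNat G H) :
    TwoNat F H where
  app a := θ.app a ≫ η.app a
  naturality f := by
    rw [← Strict.assoc, θ.naturality, Strict.assoc, η.naturality, Strict.assoc]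
  naturality₂ {a b f g} α := by
    simp [θ.whiskerRight_eq α, η.whiskerRight_eq α, Strict.associator_eqToIso]

instance : CategoryStruct (StrictPseudofunctor B D) where
  Hom F G := TwoNat F G
  id F := TwoNat.id F
  comp θ η := TwoNat.comp θ η

@[simp]
lemma id_app (F : StrictPseudofunctor B D) (a : B) : TwoNat.app (𝟙 F) a = 𝟙 (F.obj a) := rfl

@[simp]
lemma comp_app {F G H : StrictPseudofunctor B D} (θ : F ⟶ G) (η : G ⟶ H) (a : B) :
    TwoNat.app (θ ≫ η) a = TwoNat.app θ a ≫ TwoNat.app η a := rfl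

instance homCategory (F G : StrictPseudofunctor B D) : Category (F ⟶ G) where
  Hom θ η := Modif θ η
  id θ := { app := fun a => 𝟙 (θ.app a), naturality := by intros; simp }
  comp ρ σ :=
    { app := fun a => ρ.app a ≫ σ.app a
      naturality := by intro a b f; simp [ρ.whiskerLeft_eq f, σ.whiskerLeft_eq f] }
  id_comp _ := by apply Modif.ext; funext a; simp
  comp_id _ := by apply Modif.ext; funext a; simp
  assoc _ _ _ := by apply Modif.ext; funext a; simp

@[simp]
lemma id_app₂ {F G : StrictPseudofunctor B D} (θ : F ⟶ G) (a : B) :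
    Modif.app (𝟙 θ) a = 𝟙 (TwoNat.app θ a) := rfl

@[simp]
lemma comp_app₂ {F G : StrictPseudofunctor B D} {θ η κ : F ⟶ G} (ρ : θ ⟶ η) (σ : η ⟶ κ) (a : B) :
    Modif.app (ρ ≫ σ) a = Modif.app ρ a ≫ Modif.app σ a := rfl

@[ext]
lemma hom₂_ext {F G : StrictPseudofunctor B D} {θ η : F ⟶ G} {ρ σ : θ ⟶ η}
    (h : ∀ a, Modif.app ρ a = Modif.app σ a) : ρ = σ := Modif.ext (funext h)

@[simp]
lemma eqToHom_app₂ {F G : StrictPseudofunctor B D} {θ η : F ⟶ G} (h : θ = η) (a : B) :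
    Modif.app (eqToHom h) a = eqToHom (by rw [h]) := by
  subst h; rfl

/-- An invertible modification from invertible components. -/
def isoMk₂ {F G : StrictPseudofunctor B D} {θ η : F ⟶ G}
    (e : ∀ a, TwoNat.app θ a ≅ TwoNat.app η a)
    (h : ∀ {a b : B} (f : a ⟶ b),
      F.map f ◁ (e b).hom ≫ eqToHom (TwoNat.naturality η f) =
        eqToHom (TwoNat.naturality θ f) ≫ (e a).hom ▷ G.map f) : θ ≅ η where
  hom := { app := fun a => (e a).hom, naturality := h }
  inv :=
    { app := fun a => (e a).inv
      naturality := by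
        intro a b f
        rw [← cancel_epi (F.map f ◁ (e b).hom), ← cancel_mono ((e a).hom ▷ G.map f)]
        have := h f
        simp [← this] }
  hom_inv_id := by ext a; simp
  inv_hom_id := by ext a; simp

lemma whiskerLeft_aux {x y z x' w w' : D} {p : x ⟶ y} {tb : y ⟶ z} {ta : x ⟶ x'} {q : x' ⟶ z}
    {sb rb : z ⟶ w} {sa ra : x' ⟶ w'} {r : w' ⟶ w} {ρb : sb ⟶ rb} {ρa : sa ⟶ ra}
    (ht : p ≫ tb = ta ≫ q) (hs : q ≫ sb = sa ≫ r) (hr : q ≫ rb = ra ≫ r)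
    (h : q ◁ ρb ≫ eqToHom hr = eqToHom hs ≫ ρa ▷ r)
    (e₁ : p ≫ tb ≫ sb = (ta ≫ sa) ≫ r) (e₂ : p ≫ tb ≫ rb = (ta ≫ ra) ≫ r) :
    p ◁ tb ◁ ρb ≫ eqToHom e₂ = eqToHom e₁ ≫ (ta ◁ ρa) ▷ r := by
  have h1 := congr_whiskerLeft ht ρb
  rw [comp_eqToHom_iff] at h
  rw [comp_whiskerLeft, comp_whiskerLeft, h] at h1
  simp only [Strict.associator_eqToIso, eqToIso.hom, eqToIso.inv] at h1
  rw [eqToHom_comp_iff, comp_eqToHom_iff] at h1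
  rw [h1]
  simp [Strict.associator_eqToIso]

lemma whiskerRight_aux {x y z x' w w' : D} {p : x ⟶ y} {sb rb : y ⟶ z} {sa ra : x ⟶ x'}
    {q : x' ⟶ z} {tb : z ⟶ w} {ta : x' ⟶ w'} {r : w' ⟶ w} {ρb : sb ⟶ rb} {ρa : sa ⟶ ra}
    (ht : q ≫ tb = ta ≫ r) (hs : p ≫ sb = sa ≫ q) (hr : p ≫ rb = ra ≫ q)
    (h : p ◁ ρb ≫ eqToHom hr = eqToHom hs ≫ ρa ▷ q)
    (e₁ : p ≫ sb ≫ tb = (sa ≫ ta) ≫ r) (e₂ : p ≫ rb ≫ tb = (ra ≫ ta) ≫ r) :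
    p ◁ ρb ▷ tb ≫ eqToHom e₂ = eqToHom e₁ ≫ ρa ▷ ta ▷ r := by
  have h1 := whiskerRight_congr ht ρa
  rw [comp_eqToHom_iff] at h
  have h2 := congrArg (· ▷ tb) h
  simp only [whisker_assoc, Bicategory.whiskerRight_comp, comp_whiskerRight, Category.assoc,
    Strict.associator_eqToIso, eqToIso.hom, eqToIso.inv, eqToHom_whiskerRight] at h1 h2
  rw [eqToHom_comp_iff, comp_eqToHom_iff] at h2
  rw [h2]
  have h3 : ρa ▷ q ▷ tb = eqToHom (by rw [Strict.assoc]) ≫ ρa ▷ (q ≫ tb) ≫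
    eqToHom (by rw [Strict.assoc]) := by simp [Strict.associator_eqToIso]
  have h4 : ρa ▷ ta ▷ r = eqToHom (by rw [Strict.assoc]) ≫ ρa ▷ (ta ≫ r) ≫
    eqToHom (by rw [Strict.assoc]) := by simp [Strict.associator_eqToIso]
  rw [h3, h4, whiskerRight_congr ht ρa]
  simp

/-- Whiskering of a 2-natural transformation and a modification. -/
def whiskerLeft₂ {F G H : StrictPseudofunctor B D} (θ : F ⟶ G) {η κ : G ⟶ H} (ρ : η ⟶ κ) :
    θ ≫ η ⟶ θ ≫ κ :=
  Modif.mk (fun a => TwoNat.app θ a ◁ Modif.app ρ a) fun f =>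
    whiskerLeft_aux (TwoNat.naturality θ f) _ _ (Modif.naturality ρ f) _ _

/-- Whiskering of a modification and a 2-natural transformation. -/
def whiskerRight₂ {F G H : StrictPseudofunctor B D} {θ η : F ⟶ G} (ρ : θ ⟶ η) (κ : G ⟶ H) :
    θ ≫ κ ⟶ η ≫ κ :=
  Modif.mk (fun a => Modif.app ρ a ▷ TwoNat.app κ a) fun f =>
    whiskerRight_aux (TwoNat.naturality κ f) _ _ (Modif.naturality ρ f) _ _

/-- The 2-category of 2-functors, 2-natural transformations and modifications. -/
instance : Bicategory (StrictPseudofunctor B D) where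
  homCategory := homCategory
  whiskerLeft θ _ _ ρ := whiskerLeft₂ θ ρ
  whiskerRight ρ κ := whiskerRight₂ ρ κ
  associator θ η κ := isoMk₂ (fun a => α_ (TwoNat.app θ a) (TwoNat.app η a) (TwoNat.app κ a)) (by
    intro a b f
    simp only [comp_app, Strict.associator_eqToIso, eqToIso.hom, whiskerLeft_eqToHom,
      eqToHom_whiskerRight]
    exact (eqToHom_trans _ _).trans (eqToHom_trans _ _).symm)
  leftUnitor θ := isoMk₂ (fun a => λ_ (TwoNat.app θ a)) (by
    intro a b f
    simp only [comp_app, id_app, Strict.leftUnitor_eqToIso, eqToIso.hom, whiskerLeft_eqToHom,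
      eqToHom_whiskerRight]
    exact (eqToHom_trans _ _).trans (eqToHom_trans _ _).symm)
  rightUnitor θ := isoMk₂ (fun a => ρ_ (TwoNat.app θ a)) (by
    intro a b f
    simp only [comp_app, id_app, Strict.rightUnitor_eqToIso, eqToIso.hom, whiskerLeft_eqToHom,
      eqToHom_whiskerRight]
    exact (eqToHom_trans _ _).trans (eqToHom_trans _ _).symm)
  whiskerLeft_id _ _ := hom₂_ext fun _ => whiskerLeft_id _ _
  whiskerLeft_comp _ _ _ _ _ _ := hom₂_ext fun _ => whiskerLeft_comp _ _ _
  id_whiskerLeft _ := hom₂_ext fun _ => id_whiskerLeft _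
  comp_whiskerLeft _ _ _ _ _ := hom₂_ext fun _ => comp_whiskerLeft _ _ _
  id_whiskerRight _ _ := hom₂_ext fun _ => id_whiskerRight _ _
  comp_whiskerRight _ _ _ := hom₂_ext fun _ => comp_whiskerRight _ _ _
  whiskerRight_id _ := hom₂_ext fun _ => whiskerRight_id _
  whiskerRight_comp _ _ _ := hom₂_ext fun _ => whiskerRight_comp _ _ _
  whisker_assoc _ _ _ _ _ := hom₂_ext fun _ => whisker_assoc _ _ _
  whisker_exchange _ _ := hom₂_ext fun _ => whisker_exchange _ _
  pentagon _ _ _ _ := hom₂_ext fun _ => pentagon _ _ _ _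
  triangle _ _ := hom₂_ext fun _ => triangle _ _

@[simp]
lemma whiskerLeft_app {F G H : StrictPseudofunctor B D} (θ : F ⟶ G) {η κ : G ⟶ H} (ρ : η ⟶ κ)
    (a : B) : Modif.app (θ ◁ ρ) a = TwoNat.app θ a ◁ Modif.app ρ a := rfl

@[simp]
lemma whiskerRight_app {F G H : StrictPseudofunctor B D} {θ η : F ⟶ G} (ρ : θ ⟶ η) (κ : G ⟶ H)
    (a : B) : Modif.app (ρ ▷ κ) a = Modif.app ρ a ▷ TwoNat.app κ a := rfl

instance : Strict (StrictPseudofunctor B D) where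
  id_comp _ := TwoNat.ext (funext fun _ => Strict.id_comp _)
  comp_id _ := TwoNat.ext (funext fun _ => Strict.comp_id _)
  assoc _ _ _ := TwoNat.ext (funext fun _ => Strict.assoc _ _ _)
  leftUnitor_eqToIso f := Iso.ext (hom₂_ext fun a => by
    rw [eqToIso.hom, eqToHom_app₂]
    exact congrArg Iso.hom (Strict.leftUnitor_eqToIso (TwoNat.app f a)))
  rightUnitor_eqToIso f := Iso.ext (hom₂_ext fun a => by
    rw [eqToIso.hom, eqToHom_app₂]
    exact congrArg Iso.hom (Strict.rightUnitor_eqToIso (TwoNat.app f a)))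
  associator_eqToIso f g h := Iso.ext (hom₂_ext fun a => by
    rw [eqToIso.hom, eqToHom_app₂]
    exact congrArg Iso.hom (Strict.associator_eqToIso (TwoNat.app f a) (TwoNat.app g a)
      (TwoNat.app h a)))

end Hom

lemma op2_eqToHom {B : Type u₁} [Bicategory.{w₁, v₁} B] {a b : B} {f g : a ⟶ b} (h : f = g) :
    Bicategory.Opposite.op2 (eqToHom h) = eqToHom (congrArg Quiver.Hom.op h) := by
  subst h; rfl

instance {B : Type u₁} [Bicategory.{w₁, v₁} B] [Strict B] : Strict Bᵒᵖ where
  id_comp f := congrArg Quiver.Hom.op (Strict.comp_id f.unop)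
  comp_id f := congrArg Quiver.Hom.op (Strict.id_comp f.unop)
  assoc f g h := congrArg Quiver.Hom.op (Strict.assoc h.unop g.unop f.unop).symm
  leftUnitor_eqToIso f := Iso.ext <| by
    have h : (λ_ f).hom = Bicategory.Opposite.op2 (ρ_ f.unop).hom := rfl
    rw [h, Strict.rightUnitor_eqToIso, eqToIso.hom, op2_eqToHom]; rfl
  rightUnitor_eqToIso f := Iso.ext <| by
    have h : (ρ_ f).hom = Bicategory.Opposite.op2 (λ_ f.unop).hom := rfl
    rw [h, Strict.leftUnitor_eqToIso, eqToIso.hom, op2_eqToHom]; rfl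
  associator_eqToIso f g h := Iso.ext <| by
    have h : (α_ f g h).hom = Bicategory.Opposite.op2 (α_ h.unop g.unop f.unop).inv := rfl
    rw [h, Strict.associator_eqToIso, eqToIso.inv, op2_eqToHom]; rfl

section Precomp

variable {B : Type u₁} [Bicategory.{w₁, v₁} B] {B' : Type u₃} [Bicategory.{w₃, v₃} B']

section

variable {D : Type u₂} [Bicategory.{w₂, v₂} D] [Strict D] (H : StrictPseudofunctor B' B)

/-- Pre-composition of a 2-natural transformation with a 2-functor. -/
def precomp₁ {F G : StrictPseudofunctor B D} (θ : F ⟶ G) : H.comp F ⟶ H.comp G :=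
  TwoNat.mk (F := H.comp F) (G := H.comp G) (fun a => TwoNat.app θ (H.obj a))
    (fun f => TwoNat.naturality θ (H.map f)) (fun η => TwoNat.naturality₂ θ (H.map₂ η))

/-- Pre-composition of a modification with a 2-functor. -/
def precomp₂ {F G : StrictPseudofunctor B D} {θ η : F ⟶ G} (ρ : θ ⟶ η) :
    precomp₁ H θ ⟶ precomp₁ H η :=
  Modif.mk (fun a => Modif.app ρ (H.obj a)) (fun f => Modif.naturality ρ (H.map f))

variable (D) in
/-- Pre-composition with a 2-functor, as a 2-functor between 2-categories of 2-functors. -/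
def precomp : StrictPseudofunctor (StrictPseudofunctor B D) (StrictPseudofunctor B' D) :=
  StrictPseudofunctor.mk''
    { obj := fun F => H.comp F
      map := precomp₁ H
      map₂ := precomp₂ H
      map₂_whisker_left := fun f _ _ η => hom₂_ext fun a => by
        rw [comp_app₂, comp_app₂, eqToHom_app₂, eqToHom_app₂]
        exact ((Category.id_comp _).trans (Category.comp_id _)).symm
      map₂_whisker_right := fun η f => hom₂_ext fun a => by
        rw [comp_app₂, comp_app₂, eqToHom_app₂, eqToHom_app₂]
        exact ((Category.id_comp _).trans (Category.comp_id _)).symm }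

end

/-- A 2-functor is a 2-equivalence if it has a quasi-inverse up to invertible 2-natural
transformations. -/
def IsTwoEquivalence [Strict B] [Strict B'] (F : StrictPseudofunctor B B') : Prop :=
  ∃ G : StrictPseudofunctor B' B,
    Nonempty (G.comp F ≅ StrictPseudofunctor.id B') ∧ Nonempty (F.comp G ≅ StrictPseudofunctor.id B)

end Precomp

section

variable {A : Type u₁} [Bicategory.{w₁, v₁} A] {A' : Type u₂} [Bicategory.{w₂, v₂} A']

lemma map₂_whiskerLeft_eq (H : StrictPseudofunctor A A') {a b c : A} (f : a ⟶ b) {g g' : b ⟶ c}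
    (η : g ⟶ g') : H.map₂ (f ◁ η) =
      eqToHom (H.map_comp f g) ≫ H.map f ◁ H.map₂ η ≫ eqToHom (H.map_comp f g').symm := by
  simp [H.mapComp_eq_eqToIso]

lemma map₂_whiskerRight_eq (H : StrictPseudofunctor A A') {a b c : A} {f f' : a ⟶ b}
    (η : f ⟶ f') (g : b ⟶ c) : H.map₂ (η ▷ g) =
      eqToHom (H.map_comp f g) ≫ H.map₂ η ▷ H.map g ≫ eqToHom (H.map_comp f' g).symm := by
  simp [H.mapComp_eq_eqToIso]

end

section Pseudolimits

/-- A 2-category is 2-filtered if any two objects have arrows into a common object, any two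
parallel arrows become isomorphic after composition with an arrow out of their codomain, and any
two parallel 2-cells become equal after composition with such an arrow. -/
class IsTwoFiltered (I : Type u₁) [Bicategory.{w₁, v₁} I] : Prop where
  exists_cospan (i j : I) : ∃ k : I, Nonempty (i ⟶ k) ∧ Nonempty (j ⟶ k)
  exists_iso {i j : I} (u v : i ⟶ j) : ∃ (k : I) (w : j ⟶ k), Nonempty (u ≫ w ≅ v ≫ w)
  exists_eq {i j : I} {u v : i ⟶ j} (α β : u ⟶ v) : ∃ (k : I) (w : j ⟶ k), α ▷ w = β ▷ w

variable {I : Type u₁} [Bicategory.{w₁, v₁} I] {A : Type u₂} [Bicategory.{w₂, v₂} A] [Strict A]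

/-- A pseudocone with vertex `Z` over a contravariant diagram `X`, that is, a pseudonatural
transformation from the constant 2-functor at `Z` to `X`. -/
structure Pseudocone (X : StrictPseudofunctor Iᵒᵖ A) (Z : A) where
  π (i : I) : Z ⟶ X.obj (op i)
  πIso {i j : I} (u : i ⟶ j) : π i ≅ π j ≫ X.map u.op
  πIso_id (i : I) : (πIso (𝟙 i)).hom =
    eqToHom (by rw [op_id, X.map_id, Strict.comp_id])
  πIso_comp {i j k : I} (u : i ⟶ j) (w : j ⟶ k) : (πIso (u ≫ w)).hom =
    (πIso u).hom ≫ (πIso w).hom ▷ X.map u.op ≫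
      eqToHom (by rw [op_comp, X.map_comp, Strict.assoc])
  πIso_naturality {i j : I} {u w : i ⟶ j} (α : u ⟶ w) :
    (πIso u).hom ≫ π j ◁ X.map₂ (Bicategory.Opposite.op2 α) = (πIso w).hom

namespace Pseudocone

variable {X : StrictPseudofunctor Iᵒᵖ A} {Z : A}

@[ext]
structure Hom (σ τ : Pseudocone X Z) where
  app (i : I) : σ.π i ⟶ τ.π i
  naturality {i j : I} (u : i ⟶ j) :
    app i ≫ (τ.πIso u).hom = (σ.πIso u).hom ≫ app j ▷ X.map u.op

instance : Category (Pseudocone X Z) where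
  Hom := Hom
  id σ := { app := fun i => 𝟙 (σ.π i), naturality := by intros; simp }
  comp ρ ρ' :=
    { app := fun i => ρ.app i ≫ ρ'.app i
      naturality := by
        intro i j u
        simp only [Category.assoc, ρ'.naturality, comp_whiskerRight]
        rw [← Category.assoc, ρ.naturality u, Category.assoc] }
  id_comp _ := Hom.ext (funext fun _ => Category.id_comp _)
  comp_id _ := Hom.ext (funext fun _ => Category.comp_id _)
  assoc _ _ _ := Hom.ext (funext fun _ => Category.assoc _ _ _)

variable {L : A} (σ : Pseudocone X L)

/-- Pre-composition of a pseudocone with the arrows into its vertex. -/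
def precompose (Z : A) : (Z ⟶ L) ⥤ Pseudocone X Z where
  obj f :=
    { π := fun i => f ≫ σ.π i
      πIso := fun u => whiskerLeftIso f (σ.πIso u) ≪≫ eqToIso (Strict.assoc _ _ _).symm
      πIso_id := by intro i; simp [σ.πIso_id]
      πIso_comp := by
        intro i j k u w; simp [σ.πIso_comp, Strict.associator_eqToIso]
      πIso_naturality := by
        intro i j u w α; simp [← σ.πIso_naturality α, Strict.associator_eqToIso] }
  map α :=
    { app := fun i => α ▷ σ.π i
      naturality := by
        intro i j u
        change α ▷ σ.π i ≫ _ ◁ (σ.πIso u).hom ≫ eqToHom (Strict.assoc _ _ _).symm =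
          (_ ◁ (σ.πIso u).hom ≫ eqToHom (Strict.assoc _ _ _).symm) ≫ (α ▷ σ.π j) ▷ X.map u.op
        rw [← whisker_exchange_assoc, Bicategory.whiskerRight_comp]
        simp [Strict.associator_eqToIso] }
  map_id _ := Hom.ext (funext fun _ => id_whiskerRight _ _)
  map_comp _ _ := Hom.ext (funext fun _ => comp_whiskerRight _ _ _)

/-- A pseudocone is a pseudolimit if pre-composition is an isomorphism of categories from the
category of arrows into its vertex to the category of pseudocones, for every domain. -/
def IsPseudolimit : Prop :=
  ∀ Z : A, ∃ G : Pseudocone X Z ⥤ (Z ⟶ L),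
    σ.precompose Z ⋙ G = 𝟭 (Z ⟶ L) ∧ G ⋙ σ.precompose Z = 𝟭 (Pseudocone X Z)

variable {A' : Type u₃} [Bicategory.{w₃, v₃} A'] [Strict A']

/-- The image of a pseudocone under a 2-functor. -/
def map (H : StrictPseudofunctor A A') : Pseudocone (X.comp H) (H.obj L) where
  π i := H.map (σ.π i)
  πIso u := H.map₂Iso (σ.πIso u) ≪≫ eqToIso (H.map_comp _ _)
  πIso_id i := by
    change H.map₂ (σ.πIso (𝟙 i)).hom ≫ eqToHom (H.map_comp _ _) = _
    rw [σ.πIso_id, PrelaxFunctor.map₂_eqToHom]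
    exact eqToHom_trans _ _
  πIso_comp {i j k} u w := by
    change H.map₂ (σ.πIso (u ≫ w)).hom ≫ eqToHom (H.map_comp _ _) =
      (H.map₂ (σ.πIso u).hom ≫ eqToHom (H.map_comp _ _)) ≫
        (H.map₂ (σ.πIso w).hom ≫ eqToHom (H.map_comp _ _)) ▷ H.map (X.map u.op) ≫ eqToHom (by
          rw [op_comp, X.map_comp, H.map_comp, Strict.assoc])
    rw [σ.πIso_comp, PrelaxFunctor.map₂_comp, PrelaxFunctor.map₂_comp, map₂_whiskerRight_eq,
      PrelaxFunctor.map₂_eqToHom, comp_whiskerRight, eqToHom_whiskerRight]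
    simp only [Category.assoc, eqToHom_trans]
  πIso_naturality {i j u w} α := by
    change (H.map₂ (σ.πIso u).hom ≫ eqToHom (H.map_comp _ _)) ≫
        H.map (σ.π j) ◁ H.map₂ (X.map₂ (Bicategory.Opposite.op2 α)) =
      H.map₂ (σ.πIso w).hom ≫ eqToHom (H.map_comp _ _)
    rw [← σ.πIso_naturality α, PrelaxFunctor.map₂_comp, map₂_whiskerLeft_eq]
    simp

end Pseudocone

variable {A' : Type u₃} [Bicategory.{w₃, v₃} A'] [Strict A']

/-- The 2-functors which preserve small 2-cofiltered pseudolimits. -/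
def PreservesCofilteredPseudolimits (H : StrictPseudofunctor A A') : Prop :=
  ∀ (I : Type v) [Bicategory.{v, v} I] [Strict I] [IsTwoFiltered I]
    (X : StrictPseudofunctor Iᵒᵖ A) (L : A) (σ : Pseudocone X L),
    σ.IsPseudolimit → (σ.map H).IsPseudolimit

end Pseudolimits

/-! ### Pseudocolimits of category-valued 2-functors -/

section PseudoColim

variable {I : Type v} [Bicategory.{v, v} I]

/-- The pseudocolimit in `Cat` of a 2-functor `F` on a small 2-category, as a category given by
generators and relations. Its objects are the objects of the categories `F i`. -/
structure PseudoColim (F : StrictPseudofunctor I Cat.{v, v}) : Type v where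
  idx : I
  el : F.obj idx

namespace PseudoColim

/-- Formal composites of the generating arrows, which are the arrows of the categories `F i`, the
components of the structural 2-cells of the universal pseudocone, and their inverses. -/
inductive PreHom (F : StrictPseudofunctor I Cat.{v, v}) : PseudoColim F → PseudoColim F → Type v
  | id (a : PseudoColim F) : PreHom F a a
  | comp {a b c : PseudoColim F} (f : PreHom F a b) (g : PreHom F b c) : PreHom F a c
  | incl (i : I) {x y : F.obj i} (f : x ⟶ y) : PreHom F ⟨i, x⟩ ⟨i, y⟩
  | push {i j : I} (u : i ⟶ j) (x : F.obj i) : PreHom F ⟨i, x⟩ ⟨j, (F.map u).toFunctor.obj x⟩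
  | pull {i j : I} (u : i ⟶ j) (x : F.obj i) : PreHom F ⟨j, (F.map u).toFunctor.obj x⟩ ⟨i, x⟩

open PreHom in
/-- The congruence generated by the axioms of a category, the functoriality of the inclusions of the
categories `F i`, the invertibility and the naturality of the structural 2-cells, and the three
axioms of a pseudocone. -/
inductive Rel (F : StrictPseudofunctor I Cat.{v, v}) :
    ∀ {a b : PseudoColim F}, PreHom F a b → PreHom F a b → Prop
  | refl {a b : PseudoColim F} (f : PreHom F a b) : Rel F f f
  | symm {a b : PseudoColim F} {f g : PreHom F a b} : Rel F f g → Rel F g f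
  | trans {a b : PseudoColim F} {f g h : PreHom F a b} : Rel F f g → Rel F g h → Rel F f h
  | comp_congr {a b c : PseudoColim F} {f f' : PreHom F a b} {g g' : PreHom F b c} :
      Rel F f f' → Rel F g g' → Rel F (comp f g) (comp f' g')
  | id_comp {a b : PseudoColim F} (f : PreHom F a b) : Rel F (comp (id a) f) f
  | comp_id {a b : PseudoColim F} (f : PreHom F a b) : Rel F (comp f (id b)) f
  | assoc {a b c d : PseudoColim F} (f : PreHom F a b) (g : PreHom F b c) (h : PreHom F c d) :
      Rel F (comp (comp f g) h) (comp f (comp g h))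
  | incl_id (i : I) (x : F.obj i) : Rel F (incl i (𝟙 x)) (id ⟨i, x⟩)
  | incl_comp (i : I) {x y z : F.obj i} (f : x ⟶ y) (g : y ⟶ z) :
      Rel F (incl i (f ≫ g)) (comp (incl i f) (incl i g))
  | push_pull {i j : I} (u : i ⟶ j) (x : F.obj i) :
      Rel F (comp (push u x) (pull u x)) (id ⟨i, x⟩)
  | pull_push {i j : I} (u : i ⟶ j) (x : F.obj i) :
      Rel F (comp (pull u x) (push u x)) (id ⟨j, (F.map u).toFunctor.obj x⟩)
  | push_naturality {i j : I} (u : i ⟶ j) {x y : F.obj i} (f : x ⟶ y) :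
      Rel F (comp (incl i f) (push u y)) (comp (push u x) (incl j ((F.map u).toFunctor.map f)))
  | push_id (i : I) (x : F.obj i) :
      Rel F (push (𝟙 i) x) (incl i ((F.mapId i).inv.toNatTrans.app x))
  | push_comp {i j k : I} (u : i ⟶ j) (w : j ⟶ k) (x : F.obj i) :
      Rel F (comp (push u x) (push w ((F.map u).toFunctor.obj x)))
        (comp (push (u ≫ w) x) (incl k ((F.mapComp u w).hom.toNatTrans.app x)))
  | push_map₂ {i j : I} {u w : i ⟶ j} (α : u ⟶ w) (x : F.obj i) :
      Rel F (comp (push u x) (incl j ((F.map₂ α).toNatTrans.app x))) (push w x)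

variable {F G H : StrictPseudofunctor I Cat.{v, v}}

instance : Category.{v} (PseudoColim F) where
  Hom a b := Quot (Rel F (a := a) (b := b))
  id a := Quot.mk _ (PreHom.id a)
  comp := Quot.map₂ PreHom.comp (fun f _ _ h => Rel.comp_congr (Rel.refl f) h)
    (fun _ _ g h => Rel.comp_congr h (Rel.refl g))
  id_comp := by rintro a b ⟨f⟩; exact Quot.sound (Rel.id_comp f)
  comp_id := by rintro a b ⟨f⟩; exact Quot.sound (Rel.comp_id f)
  assoc := by rintro a b c d ⟨f⟩ ⟨g⟩ ⟨h⟩; exact Quot.sound (Rel.assoc f g h)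

/-- The image in the pseudocolimit of an arrow of `F i`. -/
def incl (i : I) {x y : F.obj i} (f : x ⟶ y) : (⟨i, x⟩ : PseudoColim F) ⟶ ⟨i, y⟩ :=
  Quot.mk _ (PreHom.incl i f)

/-- The structural 2-cells of the universal pseudocone. -/
def push {i j : I} (u : i ⟶ j) (x : F.obj i) :
    (⟨i, x⟩ : PseudoColim F) ≅ ⟨j, (F.map u).toFunctor.obj x⟩ where
  hom := Quot.mk _ (PreHom.push u x)
  inv := Quot.mk _ (PreHom.pull u x)
  hom_inv_id := Quot.sound (Rel.push_pull u x)
  inv_hom_id := Quot.sound (Rel.pull_push u x)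

@[simp]
lemma incl_id (i : I) (x : F.obj i) : incl i (𝟙 x) = 𝟙 (⟨i, x⟩ : PseudoColim F) :=
  Quot.sound (Rel.incl_id i x)

lemma incl_comp (i : I) {x y z : F.obj i} (f : x ⟶ y) (g : y ⟶ z) :
    incl i (f ≫ g) = incl i f ≫ incl i g :=
  Quot.sound (Rel.incl_comp i f g)

lemma push_naturality {i j : I} (u : i ⟶ j) {x y : F.obj i} (f : x ⟶ y) :
    incl i f ≫ (push u y).hom = (push u x).hom ≫ incl j ((F.map u).toFunctor.map f) :=
  Quot.sound (Rel.push_naturality u f)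

lemma push_id (i : I) (x : F.obj i) :
    (push (𝟙 i) x).hom = incl i ((F.mapId i).inv.toNatTrans.app x) :=
  Quot.sound (Rel.push_id i x)

lemma push_comp {i j k : I} (u : i ⟶ j) (w : j ⟶ k) (x : F.obj i) :
    (push u x).hom ≫ (push w ((F.map u).toFunctor.obj x)).hom =
      (push (u ≫ w) x).hom ≫ incl k ((F.mapComp u w).hom.toNatTrans.app x) :=
  Quot.sound (Rel.push_comp u w x)

lemma push_map₂ {i j : I} {u w : i ⟶ j} (α : u ⟶ w) (x : F.obj i) :
    (push u x).hom ≫ incl j ((F.map₂ α).toNatTrans.app x) = (push w x).hom :=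
  Quot.sound (Rel.push_map₂ α x)

variable {E : Type u₁} [Category.{v₁} E]

/-- The data of a pseudocone over `F` with vertex a category. -/
structure Cocone (F : StrictPseudofunctor I Cat.{v, v}) (E : Type u₁) [Category.{v₁} E] where
  ι (i : I) : F.obj i ⥤ E
  ιIso {i j : I} (u : i ⟶ j) (x : F.obj i) :
    (ι i).obj x ≅ (ι j).obj ((F.map u).toFunctor.obj x)
  ιIso_naturality {i j : I} (u : i ⟶ j) {x y : F.obj i} (f : x ⟶ y) :
    (ι i).map f ≫ (ιIso u y).hom = (ιIso u x).hom ≫ (ι j).map ((F.map u).toFunctor.map f)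
  ιIso_id (i : I) (x : F.obj i) :
    (ιIso (𝟙 i) x).hom = (ι i).map ((F.mapId i).inv.toNatTrans.app x)
  ιIso_comp {i j k : I} (u : i ⟶ j) (w : j ⟶ k) (x : F.obj i) :
    (ιIso u x).hom ≫ (ιIso w ((F.map u).toFunctor.obj x)).hom =
      (ιIso (u ≫ w) x).hom ≫ (ι k).map ((F.mapComp u w).hom.toNatTrans.app x)
  ιIso_map₂ {i j : I} {u w : i ⟶ j} (α : u ⟶ w) (x : F.obj i) :
    (ιIso u x).hom ≫ (ι j).map ((F.map₂ α).toNatTrans.app x) = (ιIso w x).hom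

/-- The value of the functor induced by a pseudocone on a formal composite. -/
def eval (T : Cocone F E) : ∀ {a b : PseudoColim F}, PreHom F a b →
    ((T.ι a.idx).obj a.el ⟶ (T.ι b.idx).obj b.el)
  | _, _, PreHom.id _ => 𝟙 _
  | _, _, PreHom.comp f g => eval T f ≫ eval T g
  | _, _, PreHom.incl i f => (T.ι i).map f
  | _, _, PreHom.push u x => (T.ιIso u x).hom
  | _, _, PreHom.pull u x => (T.ιIso u x).inv

lemma eval_eq (T : Cocone F E) {a b : PseudoColim F} {f g : PreHom F a b} (h : Rel F f g) :
    eval T f = eval T g := by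
  induction h with
  | refl => rfl
  | symm _ ih => exact ih.symm
  | trans _ _ ih ih' => exact ih.trans ih'
  | comp_congr _ _ ih ih' => simp only [eval, ih, ih']
  | id_comp => simp only [eval, Category.id_comp]
  | comp_id => simp only [eval, Category.comp_id]
  | assoc => simp only [eval, Category.assoc]
  | incl_id => simp only [eval, CategoryTheory.Functor.map_id]
  | incl_comp => simp only [eval, CategoryTheory.Functor.map_comp]
  | push_pull => simp only [eval, Iso.hom_inv_id]
  | pull_push => simp only [eval, Iso.inv_hom_id]
  | push_naturality u f => exact T.ιIso_naturality u f
  | push_id i x => exact T.ιIso_id i x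
  | push_comp u w x => exact T.ιIso_comp u w x
  | push_map₂ α x => exact T.ιIso_map₂ α x

/-- The functor out of the pseudocolimit induced by a pseudocone. -/
def desc (T : Cocone F E) : PseudoColim F ⥤ E where
  obj a := (T.ι a.idx).obj a.el
  map := Quot.lift (eval T) (fun _ _ h => eval_eq T h)
  map_id _ := rfl
  map_comp := by rintro a b c ⟨f⟩ ⟨g⟩; rfl

@[simp]
lemma desc_incl (T : Cocone F E) (i : I) {x y : F.obj i} (f : x ⟶ y) :
    (desc T).map (incl i f) = (T.ι i).map f := rfl

@[simp]
lemma desc_push (T : Cocone F E) {i j : I} (u : i ⟶ j) (x : F.obj i) :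
    (desc T).map (push u x).hom = (T.ιIso u x).hom := rfl

/-- A natural transformation between functors on a pseudocolimit can be checked on generators. -/
def natTransMk {P Q : PseudoColim F ⥤ E} (τ : ∀ a, P.obj a ⟶ Q.obj a)
    (h₁ : ∀ (i : I) {x y : F.obj i} (f : x ⟶ y),
      P.map (incl i f) ≫ τ ⟨i, y⟩ = τ ⟨i, x⟩ ≫ Q.map (incl i f))
    (h₂ : ∀ {i j : I} (u : i ⟶ j) (x : F.obj i),
      P.map (push u x).hom ≫ τ ⟨j, (F.map u).toFunctor.obj x⟩ =
        τ ⟨i, x⟩ ≫ Q.map (push u x).hom) : P ⟶ Q where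
  app := τ
  naturality := by
    have key : ∀ {a b : PseudoColim F} (f : PreHom F a b),
        P.map (Quot.mk _ f : a ⟶ b) ≫ τ b = τ a ≫ Q.map (Quot.mk _ f : a ⟶ b) := by
      intro a b f
      induction f with
      | id a => exact (by simp : P.map (𝟙 a) ≫ τ a = τ a ≫ Q.map (𝟙 a))
      | @comp a b c f g ih ih' =>
        change P.map ((Quot.mk _ f : a ⟶ b) ≫ (Quot.mk _ g : b ⟶ c)) ≫ _ =
          _ ≫ Q.map ((Quot.mk _ f : a ⟶ b) ≫ (Quot.mk _ g : b ⟶ c))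
        rw [P.map_comp, Q.map_comp, Category.assoc, ih', ← Category.assoc, ih, Category.assoc]
      | incl i f => exact h₁ i f
      | push u x => exact h₂ u x
      | pull u x =>
        change P.map (push u x).inv ≫ _ = _ ≫ Q.map (push u x).inv
        rw [← cancel_epi (P.map (push u x).hom), ← P.map_comp_assoc, Iso.hom_inv_id, ← Category.assoc, h₂]
        simp [← Q.map_comp]
    rintro a b ⟨f⟩
    exact key f

/-- Functors on a pseudocolimit are equal if they agree on objects and on generators. -/
lemma functor_ext {P Q : PseudoColim F ⥤ E} (h : ∀ a, P.obj a = Q.obj a)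
    (h₁ : ∀ (i : I) {x y : F.obj i} (f : x ⟶ y), P.map (incl i f) ≫ eqToHom (h ⟨i, y⟩) =
      eqToHom (h ⟨i, x⟩) ≫ Q.map (incl i f))
    (h₂ : ∀ {i j : I} (u : i ⟶ j) (x : F.obj i), P.map (push u x).hom ≫ eqToHom (h ⟨j, _⟩) =
      eqToHom (h ⟨i, x⟩) ≫ Q.map (push u x).hom) : P = Q :=
  CategoryTheory.Functor.ext h fun a b f => by
    have := (natTransMk (P := P) (Q := Q) (fun a => eqToHom (h a)) h₁ h₂).naturality f
    change P.map f ≫ eqToHom (h b) = eqToHom (h a) ≫ Q.map f at this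
    rw [(comp_eqToHom_iff (h b) _ _).1 this, Category.assoc]

/-- Two equal functors into a category of the diagram agree in the pseudocolimit. -/
lemma incl_map_eqToHom {K : Type v} [Category.{v} K] {i : I} {P Q : K ⥤ F.obj i} (h : P = Q)
    {x y : K} (f : x ⟶ y) :
    incl i (P.map f) ≫ eqToHom (by rw [h] : (⟨i, P.obj y⟩ : PseudoColim F) = ⟨i, Q.obj y⟩) =
      eqToHom (by rw [h]) ≫ incl i (Q.map f) := by
  subst h; simp

lemma incl_eqToHom {i : I} {x y : F.obj i} (h : x = y) :
    incl i (eqToHom h) = eqToHom (by rw [h] : (⟨i, x⟩ : PseudoColim F) = ⟨i, y⟩) := by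
  subst h; simp

lemma push_congr {i j : I} (u : i ⟶ j) {x y : F.obj i} (h : x = y) :
    (push u x).hom ≫ eqToHom (by rw [h]) =
      eqToHom (by rw [h] : (⟨i, x⟩ : PseudoColim F) = ⟨i, y⟩) ≫ (push u y).hom := by
  subst h; simp

lemma push_id' (i : I) (x : F.obj i) :
    (push (𝟙 i) x).hom = eqToHom (by rw [F.map_id]; rfl) := by
  rw [push_id, F.mapId_eq_eqToIso, eqToIso.inv, Cat.eqToHom_app, incl_eqToHom]

lemma push_comp' {i j k : I} (u : i ⟶ j) (w : j ⟶ k) (x : F.obj i) :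
    (push u x).hom ≫ (push w ((F.map u).toFunctor.obj x)).hom =
      (push (u ≫ w) x).hom ≫ eqToHom (by rw [F.map_comp]; rfl) := by
  rw [push_comp, F.mapComp_eq_eqToIso, eqToIso.hom, Cat.eqToHom_app, incl_eqToHom]

lemma naturality_obj (θ : F ⟶ G) {i j : I} (u : i ⟶ j) (x : F.obj i) :
    (G.map u).toFunctor.obj ((TwoNat.app θ i).toFunctor.obj x) =
      (TwoNat.app θ j).toFunctor.obj ((F.map u).toFunctor.obj x) :=
  congrArg (fun P => P.toFunctor.obj x) (TwoNat.naturality θ u).symm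

/-- The inclusion of a category of the diagram in the pseudocolimit. -/
def inclFunctor (F : StrictPseudofunctor I Cat.{v, v}) (i : I) : F.obj i ⥤ PseudoColim F where
  obj x := ⟨i, x⟩
  map f := incl i f
  map_id := incl_id i
  map_comp := incl_comp i

/-- The pseudocone which induces the action of the pseudocolimit on a 2-natural transformation. -/
def mapCocone (θ : F ⟶ G) : Cocone F (PseudoColim G) where
  ι i := (TwoNat.app θ i).toFunctor ⋙ inclFunctor G i
  ιIso {i j} u x := push u ((TwoNat.app θ i).toFunctor.obj x) ≪≫
    eqToIso (congrArg (PseudoColim.mk j) (naturality_obj θ u x))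
  ιIso_naturality {i j} u x y f := by
    have h := incl_map_eqToHom
      (congrArg Cat.Hom.toFunctor (TwoNat.naturality θ u).symm) f
    simp only [Cat.Hom.comp_toFunctor, Functor.comp_map] at h
    simp only [inclFunctor, Functor.comp_map, Iso.trans_hom, eqToIso.hom, Category.assoc]
    rw [← Category.assoc, push_naturality, Category.assoc]
    exact congrArg _ h
  ιIso_id i x := by
    simp only [inclFunctor, Functor.comp_map, Iso.trans_hom, eqToIso.hom, push_id',
      F.mapId_eq_eqToIso, eqToIso.inv, Cat.eqToHom_app, eqToHom_map, incl_eqToHom]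
    exact eqToHom_trans _ _
  ιIso_comp {i j k} u w x := by
    simp only [inclFunctor, Functor.comp_map, Iso.trans_hom, eqToIso.hom,
      F.mapComp_eq_eqToIso, Cat.eqToHom_app, eqToHom_map, incl_eqToHom, Category.assoc]
    have h := push_congr w (naturality_obj θ u x)
    rw [← Category.assoc (eqToHom _), ← h, Category.assoc, ← Category.assoc, push_comp']
    simp only [Category.assoc]
    congr 1
    exact (((eqToHom _ ≫= eqToHom_trans _ _)).trans (eqToHom_trans _ _)).trans
      (eqToHom_trans _ _).symm
  ιIso_map₂ {i j u w} α x := by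
    have h := congrArg (fun P => incl j (P.toNatTrans.app x)) (TwoNat.naturality₂ θ α)
    simp only [Cat.Hom₂.comp_app, Cat.eqToHom_app, incl_comp, incl_eqToHom] at h
    have e : (⟨j, (G.map u).toFunctor.obj ((TwoNat.app θ i).toFunctor.obj x)⟩ : PseudoColim G) =
        ⟨j, (TwoNat.app θ j).toFunctor.obj ((F.map u).toFunctor.obj x)⟩ :=
      congrArg (PseudoColim.mk j) (naturality_obj θ u x)
    have e' : (⟨j, (G.map w).toFunctor.obj ((TwoNat.app θ i).toFunctor.obj x)⟩ : PseudoColim G) =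
        ⟨j, (TwoNat.app θ j).toFunctor.obj ((F.map w).toFunctor.obj x)⟩ :=
      congrArg (PseudoColim.mk j) (naturality_obj θ w x)
    change incl j ((TwoNat.app θ j).toFunctor.map ((F.map₂ α).toNatTrans.app x)) ≫
      eqToHom e'.symm = eqToHom e.symm ≫ incl j ((G.map₂ α).toNatTrans.app _) at h
    rw [comp_eqToHom_iff] at h
    change ((push u _).hom ≫ eqToHom e) ≫ incl j ((TwoNat.app θ j).toFunctor.map
      ((F.map₂ α).toNatTrans.app x)) = (push w _).hom ≫ eqToHom e'
    rw [h, ← push_map₂ α]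
    simp only [Category.assoc]
    rw [← Category.assoc (eqToHom e), eqToHom_trans, eqToHom_refl, Category.id_comp]

/-- The action of the pseudocolimit on a 2-natural transformation. -/
def colimMap (θ : F ⟶ G) : PseudoColim F ⥤ PseudoColim G := desc (mapCocone θ)

/-- The action of the pseudocolimit on a modification. -/
def colimMap₂ {θ η : F ⟶ G} (ρ : θ ⟶ η) : colimMap θ ⟶ colimMap η :=
  natTransMk (fun a => incl a.idx ((Modif.app ρ a.idx).toNatTrans.app a.el))
    (fun i {x y} f => by
      change incl i _ ≫ incl i _ = incl i _ ≫ incl i _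
      rw [← incl_comp, ← incl_comp, (Modif.app ρ i).toNatTrans.naturality f])
    (fun {i j} u x => by
      have e := congrArg (PseudoColim.mk (F := G) j) (naturality_obj θ u x)
      have e' := congrArg (PseudoColim.mk (F := G) j) (naturality_obj η u x)
      have h := congrArg (fun P => incl j (P.toNatTrans.app x)) (Modif.naturality ρ u)
      simp only [Cat.Hom₂.comp_app, Cat.eqToHom_app, incl_comp, incl_eqToHom] at h
      change incl j ((Modif.app ρ j).toNatTrans.app ((F.map u).toFunctor.obj x)) ≫
        eqToHom e'.symm = eqToHom e.symm ≫ incl j ((G.map u).toFunctor.map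
          ((Modif.app ρ i).toNatTrans.app x)) at h
      rw [comp_eqToHom_iff] at h
      change ((push u _).hom ≫ eqToHom e) ≫
          incl j ((Modif.app ρ j).toNatTrans.app ((F.map u).toFunctor.obj x)) =
        incl i ((Modif.app ρ i).toNatTrans.app x) ≫ (push u _).hom ≫ eqToHom e'
      rw [h, ← Category.assoc (incl i _), push_naturality]
      simp only [Category.assoc]
      rw [← Category.assoc (eqToHom e), eqToHom_trans, eqToHom_refl, Category.id_comp])

/-- The pseudocolimit, as a 2-functor. -/
def colim (I : Type v) [Bicategory.{v, v} I] :
    StrictPseudofunctor (StrictPseudofunctor I Cat.{v, v}) Cat.{v, v} :=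
  StrictPseudofunctor.mk''
    { obj := fun F => Cat.of (PseudoColim F)
      map := fun θ => (colimMap θ).toCatHom
      map₂ := fun ρ => (colimMap₂ ρ).toCatHom₂
      map₂_id := fun θ => Cat.Hom₂.ext (NatTrans.ext (funext fun a => incl_id a.idx _))
      map₂_comp := fun ρ σ => Cat.Hom₂.ext (NatTrans.ext (funext fun a => incl_comp a.idx _ _))
      map_id := fun F => Cat.Hom.ext (functor_ext (fun a => rfl)
        (fun i x y f => (Category.comp_id _).trans (Category.id_comp _).symm)
        (fun {i j} u x => by
          have e := congrArg (PseudoColim.mk (F := F) j) (naturality_obj (𝟙 F) u x)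
          change ((push u x).hom ≫ eqToHom e) ≫ 𝟙 _ = 𝟙 _ ≫ (push u x).hom
          simp))
      map_comp := fun {F G H} θ η => Cat.Hom.ext (functor_ext (fun a => rfl)
        (fun i x y f => (Category.comp_id _).trans (Category.id_comp _).symm)
        (fun {i j} u x => by
          have e := congrArg (PseudoColim.mk (F := H) j) (naturality_obj (θ ≫ η) u x)
          have e₁ := congrArg (PseudoColim.mk (F := G) j) (naturality_obj θ u x)
          have e₂ := congrArg (PseudoColim.mk (F := H) j)
            (naturality_obj η u ((TwoNat.app θ i).toFunctor.obj x))
          change ((push u _).hom ≫ eqToHom e) ≫ 𝟙 _ =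
            𝟙 _ ≫ (colimMap η).map ((push u _).hom ≫ eqToHom e₁)
          rw [Functor.map_comp, eqToHom_map, Category.comp_id, Category.id_comp]
          change _ = ((push u _).hom ≫ eqToHom e₂) ≫ _
          exact (congrArg _ (eqToHom_trans _ _).symm).trans (Category.assoc _ _ _).symm))
      map₂_whisker_left := fun θ _ _ ρ => Cat.Hom₂.ext (NatTrans.ext (funext fun a => by
        rw [Cat.Hom₂.comp_app, Cat.Hom₂.comp_app, Cat.eqToHom_app, Cat.eqToHom_app]
        exact ((Category.id_comp _).trans (Category.comp_id _)).symm))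
      map₂_whisker_right := fun ρ θ => Cat.Hom₂.ext (NatTrans.ext (funext fun a => by
        rw [Cat.Hom₂.comp_app, Cat.Hom₂.comp_app, Cat.eqToHom_app, Cat.eqToHom_app]
        exact ((Category.id_comp _).trans (Category.comp_id _)).symm)) }

end PseudoColim

end PseudoColim

/-! ### 2-pro-objects -/

section Representable

variable {C : Type u} [Bicategory.{v, v} C] [Strict C]

lemma whisker_strict_id {a e : C} {f g : a ⟶ e} (α : f ⟶ g) :
    𝟙 a ◁ α = eqToHom (Strict.id_comp f) ≫ α ≫ eqToHom (Strict.id_comp g).symm := by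
  simp [Strict.leftUnitor_eqToIso]

lemma whisker_strict_id' {a e : C} {f g : a ⟶ e} (α : f ⟶ g) :
    α ▷ 𝟙 e = eqToHom (Strict.comp_id f) ≫ α ≫ eqToHom (Strict.comp_id g).symm := by
  simp [Strict.rightUnitor_eqToIso]

lemma whisker_strict_comp {a b c e : C} (f : a ⟶ b) (g : b ⟶ c) {h k : c ⟶ e} (α : h ⟶ k) :
    (f ≫ g) ◁ α =
      eqToHom (Strict.assoc f g h) ≫ f ◁ g ◁ α ≫ eqToHom (Strict.assoc f g k).symm := by
  simp [Strict.associator_eqToIso]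

lemma whisker_strict_comp' {a b c e : C} {h k : a ⟶ b} (α : h ⟶ k) (f : b ⟶ c) (g : c ⟶ e) :
    α ▷ (f ≫ g) =
      eqToHom (Strict.assoc h f g).symm ≫ α ▷ f ▷ g ≫ eqToHom (Strict.assoc k f g) := by
  simp [Strict.associator_eqToIso]

lemma whisker_strict_assoc {a b c e : C} (f : a ⟶ b) {h k : b ⟶ c} (α : h ⟶ k) (g : c ⟶ e) :
    (f ◁ α) ▷ g =
      eqToHom (Strict.assoc f h g) ≫ f ◁ α ▷ g ≫ eqToHom (Strict.assoc f k g).symm := by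
  simp [Strict.associator_eqToIso]

lemma strict_aux₁ {a b c e : C} {p q : a ⟶ b} (α : p ⟶ q) (f : b ⟶ c) (g : c ⟶ e) :
    α ▷ f ▷ g ≫ eqToHom (Strict.assoc q f g) = eqToHom (Strict.assoc p f g) ≫ α ▷ (f ≫ g) := by
  simp [whisker_strict_comp' α f g]

lemma strict_aux₂ {a b c e : C} (f : a ⟶ b) (g : b ⟶ c) {p q : c ⟶ e} (α : p ⟶ q) :
    (f ≫ g) ◁ α ≫ eqToHom (Strict.assoc f g q) = eqToHom (Strict.assoc f g p) ≫ f ◁ g ◁ α := by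
  simp [whisker_strict_comp f g α]

lemma strict_aux₃ {a b c e : C} (f : a ⟶ b) (g : b ⟶ c) {p q : c ⟶ e} (α : p ⟶ q) :
    f ◁ g ◁ α =
      eqToHom (Strict.assoc f g p).symm ≫ (f ≫ g) ◁ α ≫ eqToHom (Strict.assoc f g q) := by
  simp [whisker_strict_comp f g α]

lemma strict_aux₄ {a b c e : C} (f : a ⟶ b) {p q : b ⟶ c} (α : p ⟶ q) (g : c ⟶ e) :
    f ◁ α ▷ g =
      eqToHom (Strict.assoc f p g).symm ≫ (f ◁ α) ▷ g ≫ eqToHom (Strict.assoc f q g) := by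
  simp [whisker_strict_assoc f α g]

lemma strict_aux₇ {a b c e : C} (f : a ⟶ b) (g : b ⟶ c) {p q : c ⟶ e} (α : p ⟶ q) :
    f ◁ g ◁ α ≫ eqToHom (Strict.assoc f g q).symm =
      eqToHom (Strict.assoc f g p).symm ≫ (f ≫ g) ◁ α := by
  simp [whisker_strict_comp f g α]

lemma strict_aux₈ {a b c e : C} {p q : a ⟶ b} (α : p ⟶ q) (f : b ⟶ c) (g : c ⟶ e) :
    α ▷ (f ≫ g) ≫ eqToHom (Strict.assoc q f g).symm =
      eqToHom (Strict.assoc p f g).symm ≫ α ▷ f ▷ g := by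
  simp [whisker_strict_comp' α f g]

lemma strict_aux₅ {a b c e : C} {p q : a ⟶ b} (α : p ⟶ q) (f : b ⟶ c) (g : c ⟶ e) :
    α ▷ f ▷ g =
      eqToHom (Strict.assoc p f g) ≫ α ▷ (f ≫ g) ≫ eqToHom (Strict.assoc q f g).symm := by
  simp [whisker_strict_comp' α f g]

lemma precomp_id (a e : C) : Bicategory.precomp e (𝟙 a) = 𝟭 (a ⟶ e) :=
  CategoryTheory.Functor.ext (fun f => Strict.id_comp f) (fun _ _ α => whisker_strict_id α)

lemma precomp_comp {a b c : C} (f : a ⟶ b) (g : b ⟶ c) (e : C) :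
    Bicategory.precomp e (f ≫ g) = Bicategory.precomp e g ⋙ Bicategory.precomp e f :=
  CategoryTheory.Functor.ext (fun h => Strict.assoc f g h)
    (fun _ _ α => whisker_strict_comp f g α)

lemma postcomp_id (a e : C) : Bicategory.postcomp a (𝟙 e) = 𝟭 (a ⟶ e) :=
  CategoryTheory.Functor.ext (fun f => Strict.comp_id f) (fun _ _ α => whisker_strict_id' α)

lemma postcomp_comp (a : C) {b c d : C} (f : b ⟶ c) (g : c ⟶ d) :
    Bicategory.postcomp a (f ≫ g) = Bicategory.postcomp a f ⋙ Bicategory.postcomp a g :=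
  CategoryTheory.Functor.ext (fun h => (Strict.assoc h f g).symm)
    (fun _ _ α => whisker_strict_comp' α f g)

lemma precomp_postcomp {a b c d : C} (f : a ⟶ b) (g : c ⟶ d) :
    Bicategory.precomp c f ⋙ Bicategory.postcomp a g =
      Bicategory.postcomp b g ⋙ Bicategory.precomp d f :=
  CategoryTheory.Functor.ext (fun h => Strict.assoc f h g)
    (fun _ _ α => whisker_strict_assoc f α g)

lemma map₂_whiskerRight_whiskerRight {A : Type u₁} [Bicategory.{w₁, v₁} A]
    (H : StrictPseudofunctor A C) {a b c : A} {p q : a ⟶ b} (η : p ⟶ q) (r : b ⟶ c) {e : C}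
    (f : H.obj c ⟶ e) (h : H.map (p ≫ r) ≫ f = H.map p ≫ H.map r ≫ f)
    (h' : H.map q ≫ H.map r ≫ f = H.map (q ≫ r) ≫ f) :
    H.map₂ (η ▷ r) ▷ f = eqToHom h ≫ H.map₂ η ▷ (H.map r ≫ f) ≫ eqToHom h' := by
  rw [map₂_whiskerRight_eq]
  simp [Strict.associator_eqToIso]

lemma map₂_whiskerLeft_whiskerRight {A : Type u₁} [Bicategory.{w₁, v₁} A]
    (H : StrictPseudofunctor A C) {a b c : A} (r : a ⟶ b) {p q : b ⟶ c} (η : p ⟶ q) {e : C}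
    (f : H.obj c ⟶ e) (h : H.map (r ≫ p) ≫ f = H.map r ≫ H.map p ≫ f)
    (h' : H.map r ≫ H.map q ≫ f = H.map (r ≫ q) ≫ f) :
    H.map₂ (r ◁ η) ▷ f = eqToHom h ≫ H.map r ◁ H.map₂ η ▷ f ≫ eqToHom h' := by
  rw [map₂_whiskerLeft_eq]
  simp [Strict.associator_eqToIso]

lemma TwoNat.naturality₂_whiskerRight {A : Type u₁} [Bicategory.{w₁, v₁} A]
    {X Y : StrictPseudofunctor A C} (φ : TwoNat X Y) {a b : A} {p q : a ⟶ b} (η : p ⟶ q) {e : C}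
    (f : Y.obj b ⟶ e) (h : φ.app a ≫ Y.map q ≫ f = X.map q ≫ φ.app b ≫ f)
    (h' : φ.app a ≫ Y.map p ≫ f = X.map p ≫ φ.app b ≫ f) :
    φ.app a ◁ Y.map₂ η ▷ f ≫ eqToHom h = eqToHom h' ≫ X.map₂ η ▷ (φ.app b ≫ f) := by
  rw [whisker_strict_comp', φ.whiskerRight_eq]
  simp [Strict.associator_eqToIso]

lemma Modif.naturality_whiskerRight {A : Type u₁} [Bicategory.{w₁, v₁} A]
    {X Y : StrictPseudofunctor A C} {φ ψ : TwoNat X Y} (ρ : Modif φ ψ) {a b : A} (p : a ⟶ b) {e : C}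
    (f : Y.obj b ⟶ e) (h : ψ.app a ≫ Y.map p ≫ f = X.map p ≫ ψ.app b ≫ f)
    (h' : φ.app a ≫ Y.map p ≫ f = X.map p ≫ φ.app b ≫ f) :
    ρ.app a ▷ (Y.map p ≫ f) ≫ eqToHom h = eqToHom h' ≫ X.map p ◁ ρ.app b ▷ f := by
  have := whisker_strict_assoc (X.map p) (ρ.app b) f
  rw [ρ.whiskerLeft_eq] at this
  rw [whisker_strict_comp']
  simp only [comp_whiskerRight, eqToHom_whiskerRight] at this
  rw [eqToHom_comp_iff, comp_eqToHom_iff] at this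
  rw [this]; simp

variable {I : Type v} [Bicategory.{v, v} I] [Strict I] (X : StrictPseudofunctor Iᵒᵖ C)

/-- The diagram of categories `C(X i, e)`. -/
def homDiagram (e : C) : StrictPseudofunctor I Cat.{v, v} :=
  StrictPseudofunctor.mk''
    { obj := fun i => Cat.of (X.obj (op i) ⟶ e)
      map := fun u => (Bicategory.precomp e (X.map u.op)).toCatHom
      map₂ := fun η =>
        ((precomposing _ _ e).map (X.map₂ (Bicategory.Opposite.op2 η))).toCatHom₂
      map₂_id := fun u => Cat.Hom₂.ext (NatTrans.ext (funext fun f => by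
        change X.map₂ (𝟙 u.op) ▷ f = 𝟙 (X.map u.op ≫ f)
        rw [X.map₂_id]
        exact id_whiskerRight _ _))
      map₂_comp := fun {i j u w r} η θ => Cat.Hom₂.ext (NatTrans.ext (funext fun f => by
        change X.map₂ (Bicategory.Opposite.op2 η ≫ Bicategory.Opposite.op2 θ) ▷ f =
          X.map₂ (Bicategory.Opposite.op2 η) ▷ f ≫ X.map₂ (Bicategory.Opposite.op2 θ) ▷ f
        rw [X.map₂_comp]
        exact comp_whiskerRight _ _ _))
      map_id := fun i => Cat.Hom.ext (by
        change Bicategory.precomp e (X.map (𝟙 (op i))) = 𝟭 _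
        rw [X.map_id, precomp_id])
      map_comp := fun u w => Cat.Hom.ext (by
        change Bicategory.precomp e (X.map (w.op ≫ u.op)) = _ ⋙ _
        rw [X.map_comp, precomp_comp]; rfl)
      map₂_whisker_left := fun u w w' η => Cat.Hom₂.ext (NatTrans.ext (funext fun f => by
        rw [Cat.Hom₂.comp_app, Cat.Hom₂.comp_app, Cat.eqToHom_app, Cat.eqToHom_app]
        exact map₂_whiskerRight_whiskerRight X (Bicategory.Opposite.op2 η) u.op f _ _))
      map₂_whisker_right := fun {i j k u w} η r => Cat.Hom₂.ext (NatTrans.ext (funext fun f => by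
        rw [Cat.Hom₂.comp_app, Cat.Hom₂.comp_app, Cat.eqToHom_app, Cat.eqToHom_app]
        exact map₂_whiskerLeft_whiskerRight X r.op (Bicategory.Opposite.op2 η) f _ _)) }

/-- Post-composition with an arrow, as a 2-natural transformation between diagrams of categories. -/
def homDiagramMap {e e' : C} (g : e ⟶ e') : homDiagram X e ⟶ homDiagram X e' :=
  TwoNat.mk (F := homDiagram X e) (G := homDiagram X e')
    (fun i => (Bicategory.postcomp (X.obj (op i)) g).toCatHom)
    (fun u => Cat.Hom.ext (precomp_postcomp (X.map u.op) g))
    (fun {i j u w} η => Cat.Hom₂.ext (NatTrans.ext (funext fun f => by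
      rw [Cat.Hom₂.comp_app, Cat.Hom₂.comp_app, Cat.eqToHom_app, Cat.eqToHom_app]
      exact strict_aux₁ (X.map₂ (Bicategory.Opposite.op2 η)) f g)))

/-- Post-composition with a 2-cell, as a modification between diagrams of categories. -/
def homDiagramMap₂ {e e' : C} {g g' : e ⟶ e'} (α : g ⟶ g') :
    homDiagramMap X g ⟶ homDiagramMap X g' :=
  Modif.mk (fun i => ((postcomposing (X.obj (op i)) e e').map α).toCatHom₂)
    (fun {i j} u => Cat.Hom₂.ext (NatTrans.ext (funext fun f => by
      rw [Cat.Hom₂.comp_app, Cat.Hom₂.comp_app, Cat.eqToHom_app, Cat.eqToHom_app]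
      exact strict_aux₂ (X.map u.op) f α)))

/-- The diagram `i ↦ C(X i, -)` of representable 2-functors, as a 2-functor in the variable. -/
def repDiagram : StrictPseudofunctor C (StrictPseudofunctor I Cat.{v, v}) :=
  StrictPseudofunctor.mk''
    { obj := homDiagram X
      map := homDiagramMap X
      map₂ := homDiagramMap₂ X
      map₂_id := fun g => hom₂_ext fun i => Cat.Hom₂.ext (NatTrans.ext (funext fun f =>
        whiskerLeft_id f g))
      map₂_comp := fun α β => hom₂_ext fun i => Cat.Hom₂.ext (NatTrans.ext (funext fun f =>
        whiskerLeft_comp f α β))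
      map_id := fun e => TwoNat.ext (funext fun i => Cat.Hom.ext (postcomp_id _ e))
      map_comp := fun g h => TwoNat.ext (funext fun i => Cat.Hom.ext (postcomp_comp _ g h))
      map₂_whisker_left := fun g _ _ α => hom₂_ext fun i => Cat.Hom₂.ext (NatTrans.ext
        (funext fun f => by
          rw [comp_app₂, comp_app₂, eqToHom_app₂, eqToHom_app₂,
            Cat.Hom₂.comp_app, Cat.Hom₂.comp_app, Cat.eqToHom_app, Cat.eqToHom_app]
          exact strict_aux₃ f g α))
      map₂_whisker_right := fun α g => hom₂_ext fun i => Cat.Hom₂.ext (NatTrans.ext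
        (funext fun f => by
          rw [comp_app₂, comp_app₂, eqToHom_app₂, eqToHom_app₂,
            Cat.Hom₂.comp_app, Cat.Hom₂.comp_app, Cat.eqToHom_app, Cat.eqToHom_app]
          exact strict_aux₄ f α g)) }

/-- The pseudocolimit of the representable 2-functors `C(X i, -)`. -/
def L : StrictPseudofunctor C Cat.{v, v} := (repDiagram X).comp (PseudoColim.colim I)

variable {X} {Y : StrictPseudofunctor Iᵒᵖ C}

/-- Pre-composition with the components of a 2-natural transformation. -/
def homDiagramPrecomp (φ : X ⟶ Y) (e : C) : homDiagram Y e ⟶ homDiagram X e :=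
  TwoNat.mk (F := homDiagram Y e) (G := homDiagram X e)
    (fun i => (Bicategory.precomp e (TwoNat.app φ (op i))).toCatHom)
    (fun u => Cat.Hom.ext ((precomp_comp _ _ e).symm.trans
      ((congrArg (Bicategory.precomp e) (TwoNat.naturality φ u.op).symm).trans
        (precomp_comp _ _ e))))
    (fun {i j u w} η => Cat.Hom₂.ext (NatTrans.ext (funext fun f => by
      rw [Cat.Hom₂.comp_app, Cat.Hom₂.comp_app, Cat.eqToHom_app, Cat.eqToHom_app]
      exact φ.naturality₂_whiskerRight (Bicategory.Opposite.op2 η) f _ _)))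

/-- Pre-composition with the components of a modification. -/
def homDiagramPrecomp₂ {φ ψ : X ⟶ Y} (ρ : φ ⟶ ψ) (e : C) :
    homDiagramPrecomp φ e ⟶ homDiagramPrecomp ψ e :=
  Modif.mk (fun i => ((precomposing _ _ e).map (Modif.app ρ (op i))).toCatHom₂)
    (fun {i j} u => Cat.Hom₂.ext (NatTrans.ext (funext fun f => by
      rw [Cat.Hom₂.comp_app, Cat.Hom₂.comp_app, Cat.eqToHom_app, Cat.eqToHom_app]
      exact ρ.naturality_whiskerRight u.op f _ _)))

/-- The 2-natural transformation between diagrams of representable 2-functors induced by a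
2-natural transformation between diagrams. -/
def repMap (φ : X ⟶ Y) : repDiagram Y ⟶ repDiagram X :=
  TwoNat.mk (F := repDiagram Y) (G := repDiagram X) (homDiagramPrecomp φ)
    (fun g => TwoNat.ext (funext fun i => Cat.Hom.ext
      (precomp_postcomp (TwoNat.app φ (op i)) g).symm))
    (fun {e e' g g'} α => hom₂_ext fun i => Cat.Hom₂.ext (NatTrans.ext (funext fun f => by
      rw [comp_app₂, comp_app₂, eqToHom_app₂, eqToHom_app₂,
        Cat.Hom₂.comp_app, Cat.Hom₂.comp_app, Cat.eqToHom_app, Cat.eqToHom_app]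
      exact strict_aux₇ (TwoNat.app φ (op i)) f α)))

/-- The modification between diagrams of representable 2-functors induced by a modification between
diagrams. -/
def repMap₂ {φ ψ : X ⟶ Y} (ρ : φ ⟶ ψ) : repMap φ ⟶ repMap ψ :=
  Modif.mk (homDiagramPrecomp₂ ρ)
    (fun {e e'} g => hom₂_ext fun i => Cat.Hom₂.ext (NatTrans.ext (funext fun f => by
      rw [comp_app₂, comp_app₂, eqToHom_app₂, eqToHom_app₂,
        Cat.Hom₂.comp_app, Cat.Hom₂.comp_app, Cat.eqToHom_app, Cat.eqToHom_app]
      exact strict_aux₈ (Modif.app ρ (op i)) f g)))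

end Representable

section Postcomp

variable {B : Type u₁} [Bicategory.{w₁, v₁} B] {D : Type u₂} [Bicategory.{w₂, v₂} D] [Strict D]
  {D' : Type u₃} [Bicategory.{w₃, v₃} D'] [Strict D'] (H : StrictPseudofunctor D D')

/-- Post-composition of a 2-natural transformation with a 2-functor. -/
def postcomp₁ {F G : StrictPseudofunctor B D} (θ : F ⟶ G) : F.comp H ⟶ G.comp H :=
  TwoNat.mk (F := F.comp H) (G := G.comp H) (fun a => H.map (TwoNat.app θ a))
    (fun f => (H.map_comp _ _).symm.trans
      ((congrArg H.map (TwoNat.naturality θ f)).trans (H.map_comp _ _)))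
    (fun {a b f g} η => by
      have h := congrArg H.map₂ (TwoNat.naturality₂ θ η)
      rw [PrelaxFunctor.map₂_comp, PrelaxFunctor.map₂_comp, map₂_whiskerRight_eq,
        map₂_whiskerLeft_eq, PrelaxFunctor.map₂_eqToHom, PrelaxFunctor.map₂_eqToHom] at h
      have key : H.map₂ (F.map₂ η) ▷ H.map (TwoNat.app θ b) ≫
            eqToHom (by rw [← H.map_comp, ← H.map_comp, TwoNat.naturality θ g]) =
          eqToHom (by rw [← H.map_comp, ← H.map_comp, TwoNat.naturality θ f]) ≫
            H.map (TwoNat.app θ a) ◁ H.map₂ (G.map₂ η) := by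
        rw [← cancel_epi (eqToHom (H.map_comp (F.map f) (TwoNat.app θ b))),
          ← cancel_mono (eqToHom (H.map_comp (TwoNat.app θ a) (G.map g)).symm)]
        simpa using h
      exact key)

/-- Post-composition of a modification with a 2-functor. -/
def postcomp₂ {F G : StrictPseudofunctor B D} {θ η : F ⟶ G} (ρ : θ ⟶ η) :
    postcomp₁ H θ ⟶ postcomp₁ H η :=
  Modif.mk (fun a => H.map₂ (Modif.app ρ a))
    (fun {a b} f => by
      have h := congrArg H.map₂ (Modif.naturality ρ f)
      rw [PrelaxFunctor.map₂_comp, PrelaxFunctor.map₂_comp, map₂_whiskerRight_eq,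
        map₂_whiskerLeft_eq, PrelaxFunctor.map₂_eqToHom, PrelaxFunctor.map₂_eqToHom] at h
      have key : H.map (F.map f) ◁ H.map₂ (Modif.app ρ b) ≫
            eqToHom (by rw [← H.map_comp, ← H.map_comp, TwoNat.naturality η f]) =
          eqToHom (by rw [← H.map_comp, ← H.map_comp, TwoNat.naturality θ f]) ≫
            H.map₂ (Modif.app ρ a) ▷ H.map (G.map f) := by
        rw [← cancel_epi (eqToHom (H.map_comp (F.map f) (TwoNat.app θ b))),
          ← cancel_mono (eqToHom (H.map_comp (TwoNat.app η a) (G.map f)).symm)]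
        simpa using h
      exact key)

variable (B) in
/-- Post-composition with a 2-functor, as a 2-functor between 2-categories of 2-functors. -/
def postcomp : StrictPseudofunctor (StrictPseudofunctor B D) (StrictPseudofunctor B D') :=
  StrictPseudofunctor.mk''
    { obj := fun F => F.comp H
      map := postcomp₁ H
      map₂ := postcomp₂ H
      map₂_id := fun θ => hom₂_ext fun a => H.map₂_id (TwoNat.app θ a)
      map₂_comp := fun ρ σ => hom₂_ext fun a => H.map₂_comp (Modif.app ρ a) (Modif.app σ a)
      map_id := fun F => TwoNat.ext (funext fun a => H.map_id (F.obj a))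
      map_comp := fun θ η => TwoNat.ext (funext fun a =>
        H.map_comp (TwoNat.app θ a) (TwoNat.app η a))
      map₂_whisker_left := fun θ _ _ ρ => hom₂_ext fun a => by
        rw [comp_app₂, comp_app₂, eqToHom_app₂, eqToHom_app₂]
        exact map₂_whiskerLeft_eq H (TwoNat.app θ a) (Modif.app ρ a)
      map₂_whisker_right := fun ρ θ => hom₂_ext fun a => by
        rw [comp_app₂, comp_app₂, eqToHom_app₂, eqToHom_app₂]
        exact map₂_whiskerRight_eq H (Modif.app ρ a) (TwoNat.app θ a) }

end Postcomp

section ProObjects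

/-- A 2-pro-object of `C`: a contravariant 2-functor to `C` from a small 2-filtered 2-category. -/
structure TwoProObj (C : Type u) [Bicategory.{v, v} C] where
  I : Type v
  [bicategory : Bicategory.{v, v} I]
  [strict : Strict I]
  [isTwoFiltered : IsTwoFiltered I]
  diagram : StrictPseudofunctor Iᵒᵖ C

attribute [instance] TwoProObj.bicategory TwoProObj.strict TwoProObj.isTwoFiltered

variable (C : Type u) [Bicategory.{v, v} C] [Strict C]

variable {C} in
/-- The pseudocolimit of the 2-functors `C(X i, -)`, for a 2-pro-object `X`. -/
def TwoProObj.colimRep (X : TwoProObj.{v, u} C) : StrictPseudofunctor C Cat.{v, v} := L X.diagram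

/-- The 2-category of 2-pro-objects of `C`. An arrow `X ⟶ Y` is a 2-natural transformation from the
pseudocolimit of the `C(Y j, -)` to the pseudocolimit of the `C(X i, -)`, and a 2-cell is a
modification. -/
abbrev Pro : Type (max u (v + 1)) :=
  InducedBicategory (StrictPseudofunctor C Cat.{v, v})ᵒᵖ
    (fun X : TwoProObj.{v, u} C => op X.colimRep)

/-- The one-object 2-category. -/
abbrev Pt : Type v := LocallyDiscrete (Discrete PUnit.{v + 1})

instance : IsTwoFiltered Pt.{v} where
  exists_cospan i _ := ⟨i, ⟨𝟙 i⟩, ⟨𝟙 i⟩⟩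
  exists_iso {_ j} u v := ⟨j, 𝟙 j, ⟨eqToIso
    (congrArg (· ≫ 𝟙 j) (Discrete.ext (Subsingleton.elim u.as v.as)))⟩⟩
  exists_eq {_ j _ _} _ _ := ⟨j, 𝟙 j, Subsingleton.elim _ _⟩

variable {C} in
/-- The constant diagram at an object, indexed by the one-object 2-category. -/
def const (X : C) : StrictPseudofunctor Pt.{v}ᵒᵖ C :=
  StrictPseudofunctor.mk''
    { obj := fun _ => X
      map := fun _ => 𝟙 X
      map₂ := fun _ => 𝟙 (𝟙 X)
      map_comp := fun _ _ => (Strict.id_comp _).symm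
      map₂_whisker_left := fun _ _ _ _ => by simp
      map₂_whisker_right := fun _ _ => by simp }

variable {C} in
/-- The 2-natural transformation between constant diagrams given by an arrow. -/
def constMap {X Y : C} (f : X ⟶ Y) : const X ⟶ const Y :=
  TwoNat.mk (F := const X) (G := const Y) (fun _ => f)
    (fun _ => (Strict.id_comp f).trans (Strict.comp_id f).symm)
    (fun _ => by
      change 𝟙 (𝟙 X) ▷ f ≫ eqToHom ((Strict.id_comp f).trans (Strict.comp_id f).symm) =
        eqToHom ((Strict.id_comp f).trans (Strict.comp_id f).symm) ≫ f ◁ 𝟙 (𝟙 Y)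
      simp)

variable {C} in
/-- The modification between constant diagrams given by a 2-cell. -/
def constMap₂ {X Y : C} {f g : X ⟶ Y} (α : f ⟶ g) : constMap f ⟶ constMap g :=
  Modif.mk (fun _ => α) (fun _ => by
    change 𝟙 X ◁ α ≫ eqToHom ((Strict.id_comp g).trans (Strict.comp_id g).symm) =
      eqToHom ((Strict.id_comp f).trans (Strict.comp_id f).symm) ≫ α ▷ 𝟙 Y
    rw [whisker_strict_id, whisker_strict_id']
    simp)

/-- The 2-functor which sends `X` to the constant diagram of representable 2-functors `C(X, -)`. -/
def constRep :
    StrictPseudofunctor Cᵒᵖ (StrictPseudofunctor C (StrictPseudofunctor Pt.{v} Cat.{v, v})) :=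
  StrictPseudofunctor.mk''
    { obj := fun X => repDiagram (const X.unop)
      map := fun f => repMap (constMap f.unop)
      map₂ := fun α => repMap₂ (constMap₂ α.unop2)
      map₂_id := fun f => hom₂_ext fun e => hom₂_ext fun i => Cat.Hom₂.ext (NatTrans.ext
        (funext fun g => id_whiskerRight f.unop g))
      map₂_comp := fun α β => hom₂_ext fun e => hom₂_ext fun i => Cat.Hom₂.ext (NatTrans.ext
        (funext fun g => comp_whiskerRight α.unop2 β.unop2 g))
      map_id := fun X => TwoNat.ext (funext fun e => TwoNat.ext (funext fun i =>
        Cat.Hom.ext (precomp_id X.unop e)))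
      map_comp := fun f g => TwoNat.ext (funext fun e => TwoNat.ext (funext fun i =>
        Cat.Hom.ext (precomp_comp g.unop f.unop e)))
      map₂_whisker_left := fun f _ _ α => hom₂_ext fun e => hom₂_ext fun i => Cat.Hom₂.ext
        (NatTrans.ext (funext fun g => by
          simp only [comp_app₂, eqToHom_app₂, Cat.Hom₂.comp_app, Cat.eqToHom_app]
          exact strict_aux₅ α.unop2 f.unop g))
      map₂_whisker_right := fun α f => hom₂_ext fun e => hom₂_ext fun i => Cat.Hom₂.ext
        (NatTrans.ext (funext fun g => by
          simp only [comp_app₂, eqToHom_app₂, Cat.Hom₂.comp_app, Cat.eqToHom_app]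
          exact whisker_strict_assoc f.unop α.unop2 g)) }

variable {C}

section InducedOp

lemma op_induced_conj {B : Type u₂} [Bicategory.{w₂, v₂} B] {P : Type u₃} {F : P → B}
    {x y : InducedBicategory Bᵒᵖ (fun p => op (F p))} {f g h k : F y ⟶ F x} (e : f = g) (m : g ⟶ h)
    (e' : h = k)
    (E : (InducedBicategory.mkHom f.op : x ⟶ y) = (InducedBicategory.mkHom g.op : x ⟶ y))
    (E' : (InducedBicategory.mkHom h.op : x ⟶ y) = (InducedBicategory.mkHom k.op : x ⟶ y)) :
    Bicategory.Opposite.op2 (eqToHom e ≫ m ≫ eqToHom e') =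
      (eqToHom E ≫ InducedBicategory.mkHom₂ (Bicategory.Opposite.op2 m) ≫ eqToHom E').hom := by
  subst e e'
  simp only [eqToHom_refl, Category.id_comp, Category.comp_id]

variable {A : Type u₁} [Bicategory.{w₁, v₁} A] [Strict A] {B : Type u₂} [Bicategory.{w₂, v₂} B]
  [Strict B] {P : Type u₃} (F : P → B) (obj : A → P)
  (map : ∀ {X Y : A}, (X ⟶ Y) → (F (obj Y) ⟶ F (obj X)))
  (map₂ : ∀ {X Y : A} {f g : X ⟶ Y}, (f ⟶ g) → (map f ⟶ map g))

/-- The 2-functor with values in a 2-category induced by a contravariant assignment `F`. -/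
def inducedOp (map₂_id : ∀ {X Y : A} (f : X ⟶ Y), map₂ (𝟙 f) = 𝟙 (map f))
    (map₂_comp : ∀ {X Y : A} {f g h : X ⟶ Y} (α : f ⟶ g) (β : g ⟶ h),
      map₂ (α ≫ β) = map₂ α ≫ map₂ β)
    (map_id : ∀ X : A, map (𝟙 X) = 𝟙 (F (obj X)))
    (map_comp : ∀ {X Y Z : A} (f : X ⟶ Y) (g : Y ⟶ Z), map (f ≫ g) = map g ≫ map f)
    (map₂_whiskerLeft : ∀ {X Y Z : A} (f : X ⟶ Y) {g g' : Y ⟶ Z} (α : g ⟶ g'),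
      map₂ (f ◁ α) = eqToHom (map_comp f g) ≫ map₂ α ▷ map f ≫ eqToHom (map_comp f g').symm)
    (map₂_whiskerRight : ∀ {X Y Z : A} {f f' : X ⟶ Y} (α : f ⟶ f') (g : Y ⟶ Z),
      map₂ (α ▷ g) = eqToHom (map_comp f g) ≫ map g ◁ map₂ α ≫ eqToHom (map_comp f' g).symm) :
    StrictPseudofunctor A (InducedBicategory Bᵒᵖ (fun p => op (F p))) :=
  StrictPseudofunctor.mk''
    { obj := obj
      map := fun f => InducedBicategory.mkHom (map f).op
      map₂ := fun α => InducedBicategory.mkHom₂ (Bicategory.Opposite.op2 (map₂ α))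
      map₂_id := fun f => InducedBicategory.hom₂_ext
        (congrArg Bicategory.Opposite.op2 (map₂_id f))
      map₂_comp := fun α β => InducedBicategory.hom₂_ext
        (congrArg Bicategory.Opposite.op2 (map₂_comp α β))
      map_id := fun X => InducedBicategory.hom_ext (congrArg Quiver.Hom.op (map_id X))
      map_comp := fun f g => InducedBicategory.hom_ext (congrArg Quiver.Hom.op (map_comp f g))
      map₂_whisker_left := fun f _ _ α => InducedBicategory.hom₂_ext
        ((congrArg Bicategory.Opposite.op2 (map₂_whiskerLeft f α)).trans
          (op_induced_conj _ _ _ _ _))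
      map₂_whisker_right := fun α f => InducedBicategory.hom₂_ext
        ((congrArg Bicategory.Opposite.op2 (map₂_whiskerRight α f)).trans
          (op_induced_conj _ _ _ _ _)) }

/-- The 2-functor with values in a 2-category induced by the objects of a contravariant
2-functor. -/
def liftOp (K : StrictPseudofunctor Aᵒᵖ B) :
    StrictPseudofunctor A (InducedBicategory Bᵒᵖ (fun X : A => op (K.obj (op X)))) :=
  inducedOp (fun X : A => K.obj (op X)) (fun X => X) (fun f => K.map f.op)
    (fun α => K.map₂ (Bicategory.Opposite.op2 α))
    (fun f => K.map₂_id f.op)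
    (fun α β => K.map₂_comp (Bicategory.Opposite.op2 α) (Bicategory.Opposite.op2 β))
    (fun X => K.map_id (op X))
    (fun f g => K.map_comp g.op f.op)
    (fun f _ _ α => map₂_whiskerRight_eq K (Bicategory.Opposite.op2 α) f.op)
    (fun α g => map₂_whiskerLeft_eq K g.op (Bicategory.Opposite.op2 α))

/-- The 2-functor between induced 2-categories given by a reindexing of the objects. -/
def reindex {Q : Type u₁} (φ : Q → P) :
    StrictPseudofunctor (InducedBicategory B (fun q => F (φ q))) (InducedBicategory B F) :=
  StrictPseudofunctor.mk''
    { obj := fun q => φ q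
      map := fun f => InducedBicategory.mkHom f.hom
      map₂ := fun α => InducedBicategory.mkHom₂ α.hom
      map₂_whisker_left := fun f _ _ α => InducedBicategory.hom₂_ext
        ((Category.id_comp _).trans (Category.comp_id _)).symm
      map₂_whisker_right := fun α f => InducedBicategory.hom₂_ext
        ((Category.id_comp _).trans (Category.comp_id _)).symm }

end InducedOp

/-- The 2-pro-object with index the one-object 2-category given by an object. -/
def cObj (X : C) : TwoProObj.{v, u} C := { I := Pt.{v}, diagram := const X }

variable (C) in
/-- The canonical 2-functor, which sends an object to the 2-pro-object with index the one-object
2-category, and an arrow or a 2-cell to the one that it induces between the pseudocolimits of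
the representable 2-functors. -/
def c : StrictPseudofunctor C (Pro C) :=
  (liftOp ((constRep C).comp (postcomp C (PseudoColim.colim Pt)))).comp
    (reindex (fun X : TwoProObj.{v, u} C => op X.colimRep) cObj)

variable (C)

/-- The full sub-2-category of the 2-functors from the 2-pro-objects of `C` to `Cat` which preserve
small 2-cofiltered pseudolimits. -/
abbrev HomPlus :=
  InducedBicategory (StrictPseudofunctor (Pro C) Cat.{v, v})
    (Subtype.val (p := PreservesCofilteredPseudolimits.{v}))

/-- Pre-composition with `c`. -/
def cStar : StrictPseudofunctor (HomPlus C) (StrictPseudofunctor C Cat.{v, v}) :=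
  InducedBicategory.forget.comp (precomp Cat.{v, v} (c C))

end ProObjects

end TwoPro

-- A 2-functor that is an isomorphism on every category of arrows, and hits every object up to
-- isomorphism, is a 2-equivalence (`isTwoEquivalence_of_catIso`). So two things are needed:
-- restriction along `c` is bijective on 2-natural transformations and on modifications between
-- 2-functors that preserve 2-cofiltered pseudolimits, and every `F` on `C` is up to isomorphism the
-- restriction of such a 2-functor.
--
-- The tool for both is a concrete model of pseudolimits in `Cat`. For `G : Iᵒᵖ → Cat` let `Sec G`
-- be the category of families of objects with coherent isomorphisms; a pseudocone is a pseudolimit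
-- exactly when its vertex maps isomorphically onto `Sec G` (`isPseudolimit_iff_catIso_secOf`). The
-- universal property of the pseudocolimit `L X` together with Yoneda gives `Hom(L X, F) ≅ Sec (F ∘
-- X)` (`catIso_toSec`), by evaluation at a universal section. For constant `X` this is the Yoneda
-- isomorphism `F A ≅ Hom(L (cA), F)`. For `F = L Z` it says that `Pro(Z, X)` is the category of
-- pseudocones with vertex `Z` over `c ∘ X`, so each 2-pro-object is the pseudolimit of its own
-- diagram (`isPseudolimit_canonicalCone`).
--
-- Local isomorphism: if `K` preserves 2-cofiltered pseudolimits, then `K X ≅ Sec (K ∘ c ∘ X) ≅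
-- Hom(L X, K ∘ c)` (`catIso_ev`), 2-naturally in `X` and in `K`. Hence transformations and
-- modifications into `K` are determined by their restrictions, and each one between restrictions
-- extends (`catIso_mapFunctor_precomp`).
--
-- Extension: put `ran F X = Sec (F ∘ X)`, with the action of arrows transported from `Hom(L X, F)`.
-- It restricts to `F` by Yoneda. The hard point is that it preserves 2-cofiltered pseudolimits.
-- Given a 2-filtered diagram `D` of 2-pro-objects, the pairs (`k`, an index of `D k`) form a
-- 2-filtered 2-category `Ix D`, whose arrows carry representatives of the arrows of `D`. Sections
-- of `ran F ∘ D` are the same as sections of `F` over `Ix D` (`Ix.catIso_flatten`), that is, `ran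
-- F` of the 2-pro-object `flatPro D`. For a pseudolimit cone with vertex `V`, the resulting functor
-- `ran F V → ran F (flatPro D)` is the image under `ran F` of one arrow `comparison`, the same for
-- all `F` (`secOf_comp_flatten`). For `F = L Z` the 2-functor `ran F` is `Pro(Z, -)`, so this
-- functor is invertible because the cone is a pseudolimit. By Yoneda `comparison` is invertible,
-- and so is its image under every `ran F`.
--
-- 2-filteredness of the indices enters through the calculus of germs: arrows of a 2-filtered
-- pseudocolimit of categories are represented at some stage, and equality or invertibility of
-- arrows of one stage in the pseudocolimit is already visible at a later stage.
--
-- The laws of strict structures compare 2-cells whose boundaries are only propositionally equal, so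
-- most computations are done with heterogeneous equality.

local notation "ob(" f ")" => CategoryTheory.Functor.obj (Cat.Hom.toFunctor f)
local notation "mp(" f ")" => CategoryTheory.Functor.map (Cat.Hom.toFunctor f)
local notation "ap(" α ")" => NatTrans.app (Cat.Hom₂.toNatTrans α)

namespace TwoPro

/-! ### Heterogeneous equalities in categories and strict 2-categories -/

section HEqCat

variable {D : Type u₁} [Category.{v₁} D] {E : Type u₂} [Category.{v₂} E]

lemma comp_heq {x y z x' y' z' : D} (hx : x = x') (hy : y = y') (hz : z = z') {f : x ⟶ y}
    {g : y ⟶ z} {f' : x' ⟶ y'} {g' : y' ⟶ z'} (hf : f ≍ f') (hg : g ≍ g') :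
    f ≫ g ≍ f' ≫ g' := by
  subst hx hy hz hf hg; rfl

lemma id_heq {x x' : D} (h : x = x') : 𝟙 x ≍ 𝟙 x' := by subst h; rfl

lemma eqToHom_heq {x y z : D} (h : x = y) (hz : x = z) : eqToHom h ≍ 𝟙 z := by
  subst h hz; rfl

lemma map_heq (P : D ⥤ E) {x y x' y' : D} (hx : x = x') (hy : y = y') {f : x ⟶ y} {f' : x' ⟶ y'}
    (hf : f ≍ f') : P.map f ≍ P.map f' := by
  subst hx hy hf; rfl

lemma map_heq_of_eq {P Q : D ⥤ E} (h : P = Q) {x y : D} (f : x ⟶ y) : P.map f ≍ Q.map f := by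
  subst h; rfl

lemma app_heq {P Q : D ⥤ E} (τ : P ⟶ Q) {x x' : D} (hx : x = x') : τ.app x ≍ τ.app x' := by
  subst hx; rfl

lemma natTrans_heq {P Q P' Q' : D ⥤ E} (hP : P = P') (hQ : Q = Q') {τ : P ⟶ Q} {τ' : P' ⟶ Q'}
    (h : ∀ x, τ.app x ≍ τ'.app x) : τ ≍ τ' := by
  subst hP hQ
  exact heq_of_eq (NatTrans.ext (funext fun x => eq_of_heq (h x)))

lemma comp_id_heq {x y y' z : D} (hy : y = y') (hz : z = y') (f : x ⟶ y) {g : y ⟶ z}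
    (hg : g ≍ 𝟙 y') : f ≫ g ≍ f := by
  subst hy hz; cases hg; simp

lemma id_comp_heq {x y y' z : D} (hy : y = y') (hz : z = y') {f : z ⟶ y} (g : y ⟶ x)
    (hf : f ≍ 𝟙 y') : f ≫ g ≍ g := by
  subst hy hz; cases hf; simp

lemma trans_eqToIso_heq {x y z : D} (e : x ≅ y) (h : y = z) : (e ≪≫ eqToIso h).hom ≍ e.hom := by
  subst h; simp

lemma mapIso_trans_eqToIso_heq (P : D ⥤ E) {x y : D} {z : E} (e : x ≅ y) (h : P.obj y = z) :
    (P.mapIso e ≪≫ eqToIso h).hom ≍ P.map e.hom := trans_eqToIso_heq _ h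

lemma functor_map_comp_heq (P : D ⥤ E) {x y z : D} (f : x ⟶ y) (g : y ⟶ z) :
    P.map (f ≫ g) ≍ P.map f ≫ P.map g := by simp

lemma functor_map_id_heq (P : D ⥤ E) (x : D) : P.map (𝟙 x) ≍ 𝟙 (P.obj x) := by simp

lemma functor_map_eqToHom_heq (P : D ⥤ E) {x y : D} (h : x = y) :
    P.map (eqToHom h) ≍ 𝟙 (P.obj x) := by subst h; simp

/-- The bridge between the two idioms: the structures are stated with `eqToHom`, while the
computations run on `≍`, where transports need no bookkeeping. -/
lemma heq_iff_eqToHom {x y x' y' : D} (hx : x = x') (hy : y = y') {f : x ⟶ y} {f' : x' ⟶ y'} :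
    f ≍ f' ↔ f ≫ eqToHom hy = eqToHom hx ≫ f' := by
  subst hx hy; simp

end HEqCat

section HEqStrict

variable {B : Type u₁} [Bicategory.{w₁, v₁} B]

lemma whiskerLeft_heq {a b c : B} {f f' : a ⟶ b} {g g' h h' : b ⟶ c} (hf : f = f') (hg : g = g')
    (hh : h = h') {α : g ⟶ h} {α' : g' ⟶ h'} (hα : α ≍ α') : f ◁ α ≍ f' ◁ α' := by
  subst hf hg hh hα; rfl

lemma whiskerRight_heq {a b c : B} {f f' g g' : a ⟶ b} {h h' : b ⟶ c} (hf : f = f') (hg : g = g')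
    (hh : h = h') {α : f ⟶ g} {α' : f' ⟶ g'} (hα : α ≍ α') : α ▷ h ≍ α' ▷ h' := by
  subst hf hg hh hα; rfl

section

variable [Strict B]

lemma id_whiskerLeft_heq {a b : B} {f g : a ⟶ b} (α : f ⟶ g) : 𝟙 a ◁ α ≍ α := by
  simp [Strict.leftUnitor_eqToIso]

lemma whiskerRight_id_heq {a b : B} {f g : a ⟶ b} (α : f ⟶ g) : α ▷ 𝟙 b ≍ α := by
  simp [Strict.rightUnitor_eqToIso]

lemma comp_whiskerLeft_heq {a b c d : B} (f : a ⟶ b) (g : b ⟶ c) {h k : c ⟶ d} (α : h ⟶ k) :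
    (f ≫ g) ◁ α ≍ f ◁ g ◁ α := by
  simp [Strict.associator_eqToIso]

lemma whiskerRight_comp_heq {a b c d : B} {h k : a ⟶ b} (α : h ⟶ k) (f : b ⟶ c) (g : c ⟶ d) :
    α ▷ (f ≫ g) ≍ α ▷ f ▷ g := by
  simp [Strict.associator_eqToIso]

lemma whisker_assoc_heq {a b c d : B} (f : a ⟶ b) {h k : b ⟶ c} (α : h ⟶ k) (g : c ⟶ d) :
    (f ◁ α) ▷ g ≍ f ◁ α ▷ g := by
  simp [Strict.associator_eqToIso]

end

variable {B' : Type u₂} [Bicategory.{w₂, v₂} B'] (H : StrictPseudofunctor B B')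

lemma map₂_whiskerLeft_heq {a b c : B} (f : a ⟶ b) {g g' : b ⟶ c} (α : g ⟶ g') :
    H.map₂ (f ◁ α) ≍ H.map f ◁ H.map₂ α := by
  rw [map₂_whiskerLeft_eq]; simp

lemma map₂_whiskerRight_heq {a b c : B} {f f' : a ⟶ b} (α : f ⟶ f') (g : b ⟶ c) :
    H.map₂ (α ▷ g) ≍ H.map₂ α ▷ H.map g := by
  rw [map₂_whiskerRight_eq]; simp

/-- A 2-functor between strict 2-categories, with its laws as heterogeneous equalities. -/
def twoFunctorMk [Strict B] [Strict B'] (S : PrelaxFunctor B B')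
    (map_id : ∀ X : B, S.map (𝟙 X) = 𝟙 (S.obj X))
    (map_comp : ∀ {a b c : B} (f : a ⟶ b) (g : b ⟶ c), S.map (f ≫ g) = S.map f ≫ S.map g)
    (hl : ∀ {a b c : B} (f : a ⟶ b) {g g' : b ⟶ c} (α : g ⟶ g'),
      S.map₂ (f ◁ α) ≍ S.map f ◁ S.map₂ α)
    (hr : ∀ {a b c : B} {f f' : a ⟶ b} (α : f ⟶ f') (g : b ⟶ c),
      S.map₂ (α ▷ g) ≍ S.map₂ α ▷ S.map g) : StrictPseudofunctor B B' :=
  StrictPseudofunctor.mk''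
    { toPrelaxFunctor := S
      map_id := map_id
      map_comp := map_comp
      map₂_whisker_left := fun f _ _ α => by
        rw [← Category.assoc, ← comp_eqToHom_iff (map_comp f _), ← heq_iff_eqToHom]; exact hl f α
      map₂_whisker_right := fun α g => by
        rw [← Category.assoc, ← comp_eqToHom_iff (map_comp _ g), ← heq_iff_eqToHom]; exact hr α g }

lemma TwoNat.naturality₂_heq {F G : StrictPseudofunctor B B'} (θ : TwoNat F G) {a b : B}
    {f g : a ⟶ b} (η : f ⟶ g) : F.map₂ η ▷ θ.app b ≍ θ.app a ◁ G.map₂ η :=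
  (heq_iff_eqToHom _ _).2 (θ.naturality₂ η)

lemma Modif.naturality_heq {F G : StrictPseudofunctor B B'} {θ η : TwoNat F G} (ρ : Modif θ η)
    {a b : B} (f : a ⟶ b) : F.map f ◁ ρ.app b ≍ ρ.app a ▷ G.map f :=
  (heq_iff_eqToHom _ _).2 (ρ.naturality f)

/-- A 2-natural transformation, with its laws as heterogeneous equalities. -/
def twoNatMk {F G : StrictPseudofunctor B B'} (app : ∀ a, F.obj a ⟶ G.obj a)
    (h : ∀ {a b : B} (f : a ⟶ b), F.map f ≫ app b = app a ≫ G.map f)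
    (h₂ : ∀ {a b : B} {f g : a ⟶ b} (η : f ⟶ g), F.map₂ η ▷ app b ≍ app a ◁ G.map₂ η) :
    TwoNat F G where
  app := app
  naturality := h
  naturality₂ η := (heq_iff_eqToHom _ _).1 (h₂ η)

/-- A modification, with its laws as heterogeneous equalities. -/
def modifMk {F G : StrictPseudofunctor B B'} {θ η : TwoNat F G} (app : ∀ a, θ.app a ⟶ η.app a)
    (h : ∀ {a b : B} (f : a ⟶ b), F.map f ◁ app b ≍ app a ▷ G.map f) : Modif θ η where
  app := app
  naturality f := (heq_iff_eqToHom _ _).1 (h f)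

end HEqStrict

/-! ### Isomorphisms of categories -/

section CatIso

variable {D : Type u₁} [Category.{v₁} D] {E : Type u₂} [Category.{v₂} E]
  {E' : Type u₃} [Category.{v₃} E']

/-- A functor is an isomorphism of categories if it has a strict inverse. -/
def CatIso (P : D ⥤ E) : Prop := ∃ Q : E ⥤ D, P ⋙ Q = 𝟭 D ∧ Q ⋙ P = 𝟭 E

namespace CatIso

lemma comp {P : D ⥤ E} {Q : E ⥤ E'} (hP : CatIso P) (hQ : CatIso Q) : CatIso (P ⋙ Q) := by
  obtain ⟨P', h₁, h₂⟩ := hP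
  obtain ⟨Q', h₃, h₄⟩ := hQ
  refine ⟨Q' ⋙ P', ?_, ?_⟩
  · rw [Functor.assoc, ← Functor.assoc Q, h₃, Functor.id_comp, h₁]
  · rw [Functor.assoc, ← Functor.assoc P', h₂, Functor.id_comp, h₄]

lemma of_comp_right {P : D ⥤ E} {Q : E ⥤ E'} (hPQ : CatIso (P ⋙ Q)) (hQ : CatIso Q) :
    CatIso P := by
  obtain ⟨R, h₁, h₂⟩ := hPQ
  obtain ⟨Q', h₃, h₄⟩ := hQ
  refine ⟨Q ⋙ R, by rw [← Functor.assoc, h₁], ?_⟩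
  have : (Q ⋙ R ⋙ P) ⋙ Q ⋙ Q' = Q ⋙ Q' := by
    calc (Q ⋙ R ⋙ P) ⋙ Q ⋙ Q' = Q ⋙ (R ⋙ P ⋙ Q) ⋙ Q' := rfl
      _ = Q ⋙ Q' := by rw [h₂, Functor.id_comp]
  rw [h₃, Functor.comp_id] at this
  exact this

lemma of_comp_left {P : D ⥤ E} {Q : E ⥤ E'} (hPQ : CatIso (P ⋙ Q)) (hP : CatIso P) :
    CatIso Q := by
  obtain ⟨R, h₁, h₂⟩ := hPQ
  obtain ⟨P', h₃, h₄⟩ := hP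
  refine ⟨R ⋙ P, ?_, by rw [Functor.assoc, h₂]⟩
  calc Q ⋙ R ⋙ P = (P' ⋙ P) ⋙ Q ⋙ R ⋙ P := by rw [h₄, Functor.id_comp]
    _ = P' ⋙ (P ⋙ Q ⋙ R) ⋙ P := rfl
    _ = 𝟭 E := by rw [← Functor.assoc P, h₁, Functor.id_comp, h₄]

lemma obj_bijective {P : D ⥤ E} (hP : CatIso P) : Function.Bijective P.obj := by
  obtain ⟨Q, h₁, h₂⟩ := hP
  exact ⟨Function.LeftInverse.injective (g := Q.obj) (fun x => Functor.congr_obj h₁ x),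
    Function.RightInverse.surjective (g := Q.obj) (fun x => Functor.congr_obj h₂ x)⟩

lemma map_bijective {P : D ⥤ E} (hP : CatIso P) (x y : D) : Function.Bijective (P.map : (x ⟶ y) → _) := by
  obtain ⟨Q, h₁, h₂⟩ := hP
  have hf : Function.Injective (P.map : (x ⟶ y) → _) := fun f g h => by
    have hf := map_heq_of_eq h₁ f
    have hg := map_heq_of_eq h₁ g
    simp only [Functor.comp_map, Functor.id_map] at hf hg
    rw [h] at hf
    exact eq_of_heq (hf.symm.trans hg)
  refine ⟨hf, fun g => ?_⟩
  have hx := Functor.congr_obj h₁ x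
  have hy := Functor.congr_obj h₁ y
  refine ⟨eqToHom hx.symm ≫ Q.map g ≫ eqToHom hy, eq_of_heq ?_⟩
  have := map_heq_of_eq h₂ g
  simp only [Functor.comp_map, Functor.id_map] at this
  exact (map_heq P hx.symm hy.symm (by simp)).trans this

end CatIso

/-- The inverse is chosen on each set of arrows separately; it is functorial because the equations
can be tested after the injective `P.map`. -/
lemma catIso_of_bijective {P : D ⥤ E} (h : Function.Bijective P.obj)
    (h₂ : ∀ x y : D, Function.Bijective (P.map : (x ⟶ y) → _)) : CatIso P := by
  obtain ⟨o, ho₁, ho₂⟩ := Function.bijective_iff_has_inverse.1 h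
  choose m hm using fun (x y : D) => (h₂ x y).2
  refine ⟨{ obj := o
            map := fun {x y} f => m (o x) (o y) (eqToHom (ho₂ x) ≫ f ≫ eqToHom (ho₂ y).symm)
            map_id := fun x => (h₂ _ _).1 (by rw [hm]; simp)
            map_comp := fun f g => (h₂ _ _).1 (by rw [hm, Functor.map_comp, hm, hm]; simp) },
    ?_, ?_⟩
  · refine CategoryTheory.Functor.ext ho₁ (fun x y f => (h₂ _ _).1 ?_)
    change P.map (m _ _ _) = _
    rw [hm]; simp [eqToHom_map]
  · refine CategoryTheory.Functor.ext ho₂ (fun x y f => ?_)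
    change P.map (m _ _ _) = _
    rw [hm]; rfl

lemma CatIso.cancel_right {P Q : D ⥤ E} {R : E ⥤ E'} (hR : CatIso R) (h : P ⋙ R = Q ⋙ R) :
    P = Q := by
  obtain ⟨R', h₁, -⟩ := hR
  rw [← Functor.comp_id P, ← Functor.comp_id Q, ← h₁, ← Functor.assoc, h, Functor.assoc]

end CatIso

/-! ### A criterion for 2-equivalences -/

section IsoOfApp

variable {B : Type u₁} [Bicategory.{w₁, v₁} B] {D : Type u₂} [Bicategory.{w₂, v₂} D] [Strict D]

/-- The 2-naturality of a componentwise inverse: write `β` as `p' ◁ p ◁ β`, replace `p ◁ β` by `α ▷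
q`, and cancel `q` against `q'`. -/
lemma inv_whisker_heq {x y x' y' : D} {f f' : x ⟶ y} {g g' : x' ⟶ y'} {α : f ⟶ f'} {β : g ⟶ g'}
    {p : x ⟶ x'} {q : y ⟶ y'} {p' : x' ⟶ x} {q' : y' ⟶ y} (hp : p' ≫ p = 𝟙 x')
    (hq : q ≫ q' = 𝟙 y) (hf : f ≫ q = p ≫ g) (hf' : f' ≫ q = p ≫ g') (h : α ▷ q ≍ p ◁ β) :
    β ▷ q' ≍ p' ◁ α := by
  have e (k : x' ⟶ y') : p' ≫ p ≫ k = k := by rw [← Strict.assoc, hp, Strict.id_comp]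
  have e' (k : x ⟶ y) : k ≫ q ≫ q' = k := by rw [hq, Strict.comp_id]
  have h₁ : p' ◁ p ◁ β ≍ β :=
    (comp_whiskerLeft_heq p' p β).symm.trans
      ((whiskerLeft_heq hp rfl rfl HEq.rfl).trans (id_whiskerLeft_heq β))
  have h₂ : α ▷ q ▷ q' ≍ α := by
    refine (whiskerRight_comp_heq α q q').symm.trans ?_
    rw [hq]
    exact whiskerRight_id_heq α
  refine (whiskerRight_heq (e _).symm (e _).symm rfl h₁.symm).trans ?_
  refine (whiskerRight_heq (by rw [hf]) (by rw [hf']) rfl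
    (whiskerLeft_heq rfl hf.symm hf'.symm h.symm)).trans ?_
  exact (whisker_assoc_heq _ _ _).trans
    (whiskerLeft_heq rfl (by rw [Strict.assoc, e']) (by rw [Strict.assoc, e']) h₂)

/-- A 2-natural transformation with invertible components is invertible. -/
def twoNatIso {F G : StrictPseudofunctor B D} (θ : F ⟶ G) (inv : ∀ a, G.obj a ⟶ F.obj a)
    (h₁ : ∀ a, TwoNat.app θ a ≫ inv a = 𝟙 _) (h₂ : ∀ a, inv a ≫ TwoNat.app θ a = 𝟙 _) :
    F ≅ G where
  hom := θ
  inv := twoNatMk inv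
    (fun {a b} f => by
      have := TwoNat.naturality θ f
      calc G.map f ≫ inv b = (inv a ≫ TwoNat.app θ a) ≫ G.map f ≫ inv b := by
            rw [h₂, Strict.id_comp]
        _ = inv a ≫ (TwoNat.app θ a ≫ G.map f) ≫ inv b := by simp only [Strict.assoc]
        _ = inv a ≫ F.map f := by
            rw [← this, Strict.assoc, h₁, Strict.comp_id])
    (fun {a b f g} η => inv_whisker_heq (h₂ a) (h₁ b) (TwoNat.naturality θ f)
      (TwoNat.naturality θ g) (TwoNat.naturality₂_heq θ η))
  hom_inv_id := TwoNat.ext (funext h₁)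
  inv_hom_id := TwoNat.ext (funext h₂)

end IsoOfApp

section Criterion

variable {A : Type u₁} [Bicategory.{w₁, v₁} A] {B : Type u₂} [Bicategory.{w₂, v₂} B]

variable {Φ : StrictPseudofunctor A B}

lemma faithful_heq (h : ∀ a b, CatIso (Φ.mapFunctor a b)) {a b : A} {f f' g g' : a ⟶ b}
    (hf : f = f') (hg : g = g') {α : f ⟶ g} {α' : f' ⟶ g'} (hα : Φ.map₂ α ≍ Φ.map₂ α') :
    α ≍ α' := by
  subst hf hg
  exact heq_of_eq (((h a b).map_bijective f g).1 (eq_of_heq hα))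

variable [Strict B]

/-- Cancelling `q ≫ q'` in the middle splits the conjugate of a whiskering into a whiskering of
conjugates. This and the next lemma give the compatibility of the quasi-inverse with whiskering. -/
lemma conj_whiskerLeft_heq {x y z x' y' z' : B} (p : x' ⟶ x) (f : x ⟶ y) {q : y ⟶ y'}
    {q' : y' ⟶ y} (hq : q ≫ q' = 𝟙 y) {g g' : y ⟶ z} (α : g ⟶ g') (r : z ⟶ z') :
    p ◁ (f ◁ α) ▷ r ≍ (p ≫ f ≫ q) ◁ q' ◁ (α ▷ r) := by
  have e : (p ≫ f ≫ q) ≫ q' = p ≫ f := by rw [Strict.assoc, Strict.assoc, hq, Strict.comp_id]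
  refine (whiskerLeft_heq rfl (Strict.assoc _ _ _) (Strict.assoc _ _ _)
    (whisker_assoc_heq _ _ _)).trans ?_
  refine (comp_whiskerLeft_heq _ _ _).symm.trans ?_
  rw [← e]
  exact comp_whiskerLeft_heq _ _ _

lemma conj_whiskerRight_heq {x y z x' y' z' : B} (p : x' ⟶ x) {f f' : x ⟶ y} (α : f ⟶ f')
    {q : y ⟶ y'} {q' : y' ⟶ y} (hq : q ≫ q' = 𝟙 y) (g : y ⟶ z) (r : z ⟶ z') :
    p ◁ (α ▷ g) ▷ r ≍ (p ◁ (α ▷ q)) ▷ (q' ≫ g ≫ r) := by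
  have e : q ≫ q' ≫ g ≫ r = g ≫ r := by rw [← Strict.assoc, hq, Strict.id_comp]
  symm
  refine (whisker_assoc_heq _ _ _).trans ?_
  refine (whiskerLeft_heq rfl (Strict.assoc _ _ _) (Strict.assoc _ _ _)
    (whiskerRight_comp_heq _ _ _).symm).trans ?_
  rw [e]
  exact whiskerLeft_heq rfl (Strict.assoc _ _ _).symm (Strict.assoc _ _ _).symm
    (whiskerRight_comp_heq _ _ _)

variable [Strict A]

/-- A 2-functor which is locally an isomorphism of categories, and surjective on objects up to
isomorphism, is a 2-equivalence. -/
theorem isTwoEquivalence_of_catIso (h : ∀ a b, CatIso (Φ.mapFunctor a b))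
    (hs : ∀ b, ∃ a, Nonempty (Φ.obj a ≅ b)) : IsTwoEquivalence Φ := by
  choose g e' using hs
  let e (b : B) : Φ.obj (g b) ≅ b := (e' b).some
  have e₁ (b : B) : (e b).hom ≫ (e b).inv = 𝟙 _ := (e b).hom_inv_id
  have e₂ (b : B) : (e b).inv ≫ (e b).hom = 𝟙 _ := (e b).inv_hom_id
  choose Ψ hΨ₁ hΨ₂ using h
  have hinj {a b : A} {f f' : a ⟶ b} (hf : Φ.map f = Φ.map f') : f = f' :=
    (CatIso.obj_bijective ⟨Ψ a b, hΨ₁ a b, hΨ₂ a b⟩).1 hf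
  have hΨ {a b : A} (f : Φ.obj a ⟶ Φ.obj b) : Φ.map ((Ψ a b).obj f) = f :=
    Functor.congr_obj (hΨ₂ a b) f
  have hΨ' {a b : A} {f f' : Φ.obj a ⟶ Φ.obj b} (α : f ⟶ f') : Φ.map₂ ((Ψ a b).map α) ≍ α :=
    map_heq_of_eq (hΨ₂ a b) α
  have hfaith {a b : A} {f f' g g' : a ⟶ b}
    (hf : f = f') (hg : g = g') {α : f ⟶ g} {α' : f' ⟶ g'} (hα : Φ.map₂ α ≍ Φ.map₂ α') :
    α ≍ α' := faithful_heq (fun a b => ⟨Ψ a b, hΨ₁ a b, hΨ₂ a b⟩) hf hg hα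
  -- The quasi-inverse sends an arrow to the unique arrow lying over its conjugate by `e`.
  -- Uniqueness makes it strict: every law may be checked after applying `Φ`.
  let S : PrelaxFunctor B A :=
    { obj := g
      map := fun {a b} f => (Ψ _ _).obj ((e a).hom ≫ f ≫ (e b).inv)
      map₂ := fun {a b _ _} α => (Ψ _ _).map ((e a).hom ◁ (α ▷ (e b).inv))
      map₂_id := by intros; simp
      map₂_comp := by intros; simp }
  have S_map {a b : B} (f : a ⟶ b) : Φ.map (S.map f) = (e a).hom ≫ f ≫ (e b).inv := hΨ _
  have S_map₂ {a b : B} {f f' : a ⟶ b} (α : f ⟶ f') :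
    Φ.map₂ (S.map₂ α) ≍ (e a).hom ◁ (α ▷ (e b).inv) := hΨ' _
  have S_comp {a b c : B} (f : a ⟶ b) (g : b ⟶ c) : S.map (f ≫ g) = S.map f ≫ S.map g := hinj (by
    have h : (e b).inv ≫ (e b).hom ≫ g ≫ (e c).inv = g ≫ (e c).inv := by
      rw [← Strict.assoc, e₂, Strict.id_comp]
    rw [Φ.map_comp, S_map, S_map, S_map]
    simp only [Strict.assoc, h])
  let G : StrictPseudofunctor B A := twoFunctorMk S
    (fun b => hinj (by rw [S_map, Strict.id_comp, e₁]; exact (Φ.map_id _).symm))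
    S_comp
    (fun {a b c} f g g' α => hfaith (S_comp _ _) (S_comp _ _) <|
      (S_map₂ _).trans <| (conj_whiskerLeft_heq _ _ (e₂ b) _ _).trans <|
      ((map₂_whiskerLeft_heq Φ _ _).trans
        (whiskerLeft_heq (S_map _) (S_map _) (S_map _) (S_map₂ _))).symm)
    (fun {a b c f f'} α g => hfaith (S_comp _ _) (S_comp _ _) <|
      (S_map₂ _).trans <| (conj_whiskerRight_heq _ _ (e₂ b) _ _).trans <|
      ((map₂_whiskerRight_heq Φ _ _).trans ((whiskerRight_heq (S_map _) (S_map _) rfl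
        (S_map₂ _)).trans (by rw [S_map]))).symm)
  let ctr : G.comp Φ ⟶ StrictPseudofunctor.id B := twoNatMk (F := G.comp Φ)
    (G := StrictPseudofunctor.id B) (fun b => (e b).hom)
    (fun {a b} f => by
      change Φ.map (S.map f) ≫ (e b).hom = (e a).hom ≫ f
      rw [S_map]; simp only [Strict.assoc, e₂, Strict.comp_id])
    (fun {a b f f'} α => by
      change Φ.map₂ (S.map₂ α) ▷ (e b).hom ≍ (e a).hom ◁ α
      refine (whiskerRight_heq (S_map _) (S_map _) rfl (S_map₂ α)).trans ?_
      refine (whisker_assoc_heq _ _ _).trans ?_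
      refine whiskerLeft_heq rfl (by rw [Strict.assoc, e₂, Strict.comp_id])
        (by rw [Strict.assoc, e₂, Strict.comp_id]) ?_
      refine (whiskerRight_comp_heq _ _ _).symm.trans ?_
      rw [e₂]
      exact whiskerRight_id_heq α)
  -- The second comparison consists of the lifts of the arrows `e (Φ.obj a)` along `Φ`.
  let w (a : A) : S.obj (Φ.obj a) ⟶ a := (Ψ _ _).obj (e (Φ.obj a)).hom
  let w' (a : A) : a ⟶ S.obj (Φ.obj a) := (Ψ _ _).obj (e (Φ.obj a)).inv
  have hw (a : A) : Φ.map (w a) = (e (Φ.obj a)).hom := hΨ _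
  have hw' (a : A) : Φ.map (w' a) = (e (Φ.obj a)).inv := hΨ _
  have S_w {a b : A} (f : a ⟶ b) : S.map (Φ.map f) ≫ w b = w a ≫ f := hinj (by
    rw [Φ.map_comp, Φ.map_comp, S_map, hw, hw]; simp only [Strict.assoc, e₂, Strict.comp_id])
  let utr : Φ.comp G ⟶ StrictPseudofunctor.id A := twoNatMk (F := Φ.comp G)
    (G := StrictPseudofunctor.id A) w S_w
    (fun {a b f f'} α => by
      change S.map₂ (Φ.map₂ α) ▷ w b ≍ w a ◁ α
      refine hfaith (S_w f) (S_w f') ?_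
      refine (map₂_whiskerRight_heq Φ _ _).trans
        (HEq.trans ?_ (map₂_whiskerLeft_heq Φ _ _).symm)
      rw [hw a]
      refine (whiskerRight_heq (S_map _) (S_map _) rfl (S_map₂ _)).trans ?_
      rw [hw b]
      refine (whisker_assoc_heq _ _ _).trans ?_
      refine whiskerLeft_heq rfl (by rw [Strict.assoc, e₂, Strict.comp_id])
        (by rw [Strict.assoc, e₂, Strict.comp_id]) ?_
      refine (whiskerRight_comp_heq _ _ _).symm.trans ?_
      rw [e₂]
      exact whiskerRight_id_heq _)
  have w_w' (a : A) : w a ≫ w' a = 𝟙 _ := hinj (by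
    rw [Φ.map_comp, hw, hw', e₁]; exact (Φ.map_id _).symm)
  have w'_w (a : A) : w' a ≫ w a = 𝟙 _ := hinj (by
    rw [Φ.map_comp, hw, hw', e₂]; exact (Φ.map_id _).symm)
  exact ⟨G, ⟨twoNatIso ctr (fun b => (e b).inv) e₁ e₂⟩, ⟨twoNatIso utr w' w_w' w'_w⟩⟩

end Criterion

/-! ### Category-valued 2-functors -/

section CatValued

variable {B : Type u₁} [Bicategory.{w₁, v₁} B] (F G : StrictPseudofunctor B Cat.{v₂, u₂})

lemma obj_id (a : B) (x : F.obj a) : ob(F.map (𝟙 a)) x = x := by rw [F.map_id]; rfl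

lemma obj_comp {a b c : B} (f : a ⟶ b) (g : b ⟶ c) (x : F.obj a) :
    ob(F.map (f ≫ g)) x = ob(F.map g) (ob(F.map f) x) := by rw [F.map_comp]; rfl

lemma map_id_heq (a : B) {x y : F.obj a} (p : x ⟶ y) : mp(F.map (𝟙 a)) p ≍ p :=
  map_heq_of_eq (congrArg Cat.Hom.toFunctor (F.map_id a)) p

lemma map_comp_heq {a b c : B} (f : a ⟶ b) (g : b ⟶ c) {x y : F.obj a} (p : x ⟶ y) :
    mp(F.map (f ≫ g)) p ≍ mp(F.map g) (mp(F.map f) p) :=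
  map_heq_of_eq (congrArg Cat.Hom.toFunctor (F.map_comp f g)) p

lemma cat_app_heq {X Y : Cat.{v₂, u₂}} {f f' g g' : X ⟶ Y} (hf : f = f') (hg : g = g') {α : f ⟶ g}
    {α' : f' ⟶ g'} (h : α ≍ α') (x : X) : ap(α) x ≍ ap(α') x := by
  subst hf hg h; rfl

lemma cat_hom₂_heq {X Y : Cat.{v₂, u₂}} {f f' g g' : X ⟶ Y} (hf : f = f') (hg : g = g')
    {α : f ⟶ g} {α' : f' ⟶ g'} (h : ∀ x, ap(α) x ≍ ap(α') x) : α ≍ α' := by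
  subst hf hg
  exact heq_of_eq (Cat.Hom₂.ext (NatTrans.ext (funext fun x => eq_of_heq (h x))))

lemma map₂_id_app {a b : B} (f : a ⟶ b) (x : F.obj a) : ap(F.map₂ (𝟙 f)) x = 𝟙 _ := by
  rw [F.map₂_id]; rfl

lemma map₂_comp_app {a b : B} {f g h : a ⟶ b} (α : f ⟶ g) (β : g ⟶ h) (x : F.obj a) :
    ap(F.map₂ (α ≫ β)) x = ap(F.map₂ α) x ≫ ap(F.map₂ β) x := by
  rw [F.map₂_comp]; rfl

lemma map₂_app_heq {a b : B} {f f' g g' : a ⟶ b} (hf : f = f') (hg : g = g') {α : f ⟶ g}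
    {α' : f' ⟶ g'} (h : α ≍ α') {x x' : F.obj a} (hx : x = x') :
    ap(F.map₂ α) x ≍ ap(F.map₂ α') x' := by
  subst hf hg h hx; rfl

lemma map₂_whiskerLeft_app_heq {a b c : B} (f : a ⟶ b) {g g' : b ⟶ c} (α : g ⟶ g')
    (x : F.obj a) : ap(F.map₂ (f ◁ α)) x ≍ ap(F.map₂ α) (ob(F.map f) x) :=
  cat_app_heq (F.map_comp _ _) (F.map_comp _ _) (map₂_whiskerLeft_heq F f α) x

lemma map₂_whiskerRight_app_heq {a b c : B} {f f' : a ⟶ b} (α : f ⟶ f') (g : b ⟶ c)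
    (x : F.obj a) : ap(F.map₂ (α ▷ g)) x ≍ mp(F.map g) (ap(F.map₂ α) x) :=
  cat_app_heq (F.map_comp _ _) (F.map_comp _ _) (map₂_whiskerRight_heq F α g) x

variable {F G}

lemma nat_obj (θ : F ⟶ G) {a b : B} (f : a ⟶ b) (x : F.obj a) :
    ob(TwoNat.app θ b) (ob(F.map f) x) = ob(G.map f) (ob(TwoNat.app θ a) x) :=
  congrArg (fun P => ob(P) x) (TwoNat.naturality θ f)

lemma nat_map_heq (θ : F ⟶ G) {a b : B} (f : a ⟶ b) {x y : F.obj a} (p : x ⟶ y) :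
    mp(TwoNat.app θ b) (mp(F.map f) p) ≍ mp(G.map f) (mp(TwoNat.app θ a) p) :=
  map_heq_of_eq (congrArg Cat.Hom.toFunctor (TwoNat.naturality θ f)) p

lemma nat_map₂_heq (θ : F ⟶ G) {a b : B} {f g : a ⟶ b} (α : f ⟶ g) (x : F.obj a) :
    mp(TwoNat.app θ b) (ap(F.map₂ α) x) ≍ ap(G.map₂ α) (ob(TwoNat.app θ a) x) :=
  cat_app_heq (TwoNat.naturality θ f) (TwoNat.naturality θ g) (TwoNat.naturality₂_heq θ α) x

lemma modif_heq {θ η : F ⟶ G} (ρ : θ ⟶ η) {a b : B} (f : a ⟶ b) (x : F.obj a) :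
    ap(Modif.app ρ b) (ob(F.map f) x) ≍ mp(G.map f) (ap(Modif.app ρ a) x) :=
  cat_app_heq (TwoNat.naturality θ f) (TwoNat.naturality η f) (Modif.naturality_heq ρ f) x

lemma modif_naturality {θ η : F ⟶ G} (ρ : θ ⟶ η) (a : B) {x y : F.obj a} (p : x ⟶ y) :
    mp(TwoNat.app θ a) p ≫ ap(Modif.app ρ a) y = ap(Modif.app ρ a) x ≫ mp(TwoNat.app η a) p :=
  NatTrans.naturality _ _

lemma modif_ext {θ η : F ⟶ G} {ρ ρ' : θ ⟶ η}
    (h : ∀ a x, ap(Modif.app ρ a) x = ap(Modif.app ρ' a) x) : ρ = ρ' :=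
  hom₂_ext fun a => Cat.Hom₂.ext (NatTrans.ext (funext (h a)))

lemma modif_heq_ext {θ η θ' η' : F ⟶ G} (hθ : θ = θ') (hη : η = η') {ρ : θ ⟶ η} {ρ' : θ' ⟶ η'}
    (h : ∀ a x, ap(Modif.app ρ a) x ≍ ap(Modif.app ρ' a) x) : ρ ≍ ρ' := by
  subst hθ hη
  exact heq_of_eq (modif_ext fun a x => eq_of_heq (h a x))

lemma modif_app_heq {θ η θ' η' : F ⟶ G} (hθ : θ = θ') (hη : η = η') {ρ : θ ⟶ η} {ρ' : θ' ⟶ η'}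
    (h : ρ ≍ ρ') (a : B) {x x' : F.obj a} (hx : x = x') :
    ap(Modif.app ρ a) x ≍ ap(Modif.app ρ' a) x' := by
  subst hθ hη h hx; rfl

variable (F G) in
/-- A 2-natural transformation between category-valued 2-functors, from functors. -/
def natMk (app : ∀ a, F.obj a ⥤ G.obj a)
    (h : ∀ {a b : B} (f : a ⟶ b), (F.map f).toFunctor ⋙ app b = app a ⋙ (G.map f).toFunctor)
    (h₂ : ∀ {a b : B} {f g : a ⟶ b} (α : f ⟶ g) (x : F.obj a),
      (app b).map (ap(F.map₂ α) x) ≍ ap(G.map₂ α) ((app a).obj x)) : F ⟶ G :=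
  twoNatMk (fun a => (app a).toCatHom) (fun f => Cat.Hom.ext (h f))
    (fun α => cat_hom₂_heq (Cat.Hom.ext (h _)) (Cat.Hom.ext (h _)) (h₂ α))

/-- A modification between category-valued 2-functors, from natural transformations. -/
def modMk {θ η : F ⟶ G} (app : ∀ a, (TwoNat.app θ a).toFunctor ⟶ (TwoNat.app η a).toFunctor)
    (h : ∀ {a b : B} (f : a ⟶ b) (x : F.obj a),
      (app b).app (ob(F.map f) x) ≍ mp(G.map f) ((app a).app x)) : θ ⟶ η :=
  modifMk (fun a => Cat.Hom₂.ofNatTrans (app a))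
    (fun f => cat_hom₂_heq (TwoNat.naturality θ f) (TwoNat.naturality η f) (h f))

end CatValued

/-! ### Sections of category-valued 2-functors -/

section Sections

variable {I : Type v} [Bicategory.{v, v} I]

/-- A pseudo-section of a contravariant category-valued 2-functor, that is, an object of its
pseudolimit. -/
structure Sec (G : StrictPseudofunctor Iᵒᵖ Cat.{v, v}) : Type v where
  pt (i : I) : G.obj (op i)
  iso {i j : I} (u : i ⟶ j) : pt i ≅ ob(G.map u.op) (pt j)
  iso_id (i : I) : (iso (𝟙 i)).hom ≍ 𝟙 (pt i)
  iso_comp {i j k : I} (u : i ⟶ j) (w : j ⟶ k) :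
    (iso (u ≫ w)).hom ≍ (iso u).hom ≫ mp(G.map u.op) (iso w).hom
  iso_map₂ {i j : I} {u w : i ⟶ j} (α : u ⟶ w) :
    (iso u).hom ≫ ap(G.map₂ (Bicategory.Opposite.op2 α)) (pt j) = (iso w).hom

namespace Sec

variable {G : StrictPseudofunctor Iᵒᵖ Cat.{v, v}}

lemma ext' {s t : Sec G} (h : ∀ i, s.pt i = t.pt i)
    (h' : ∀ {i j : I} (u : i ⟶ j), (s.iso u).hom ≍ (t.iso u).hom) : s = t := by
  obtain ⟨p, e, _, _, _⟩ := s
  obtain ⟨q, e', _, _, _⟩ := t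
  obtain rfl : p = q := funext h
  have : @e = @e' := by
    funext i j u
    exact Iso.ext (eq_of_heq (h' u))
  subst this
  rfl

@[ext]
structure Hom (s t : Sec G) where
  app (i : I) : s.pt i ⟶ t.pt i
  naturality {i j : I} (u : i ⟶ j) :
    app i ≫ (t.iso u).hom = (s.iso u).hom ≫ mp(G.map u.op) (app j)

instance : Category (Sec G) where
  Hom := Hom
  id s := { app := fun i => 𝟙 _, naturality := by intros; simp }
  comp f g :=
    { app := fun i => f.app i ≫ g.app i
      naturality := by
        intro i j u
        rw [Category.assoc, g.naturality, ← Category.assoc, f.naturality, Category.assoc,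
          Functor.map_comp] }
  id_comp _ := Hom.ext (funext fun _ => Category.id_comp _)
  comp_id _ := Hom.ext (funext fun _ => Category.comp_id _)
  assoc _ _ _ := Hom.ext (funext fun _ => Category.assoc _ _ _)

lemma hom_ext {s t : Sec G} {f g : s ⟶ t} (h : ∀ i, Hom.app f i = Hom.app g i) : f = g :=
  Hom.ext (funext h)

lemma hom_heq {s t s' t' : Sec G} (hs : s = s') (ht : t = t') {f : s ⟶ t} {g : s' ⟶ t'}
    (h : ∀ i, Hom.app f i ≍ Hom.app g i) : f ≍ g := by
  subst hs ht
  exact heq_of_eq (hom_ext fun i => eq_of_heq (h i))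

lemma hom_app_heq {s t s' t' : Sec G} (hs : s = s') (ht : t = t') {f : s ⟶ t} {g : s' ⟶ t'}
    (h : f ≍ g) (i : I) : Hom.app f i ≍ Hom.app g i := by
  subst hs ht h; rfl

lemma iso_heq (s : Sec G) {i j : I} {u w : i ⟶ j} (h : u = w) :
    (s.iso u).hom ≍ (s.iso w).hom := by subst h; rfl

/-- The value of a section at an index, as a functor. -/
def eval (G : StrictPseudofunctor Iᵒᵖ Cat.{v, v}) (i : I) : Sec G ⥤ G.obj (op i) where
  obj s := s.pt i
  map f := Hom.app f i

/-- An isomorphism of sections from isomorphisms of their values. -/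
def isoMk {s t : Sec G} (e : ∀ i, s.pt i ≅ t.pt i)
    (h : ∀ {i j : I} (u : i ⟶ j),
      (e i).hom ≫ (t.iso u).hom = (s.iso u).hom ≫ mp(G.map u.op) (e j).hom) : s ≅ t where
  hom := ⟨fun i => (e i).hom, h⟩
  inv := ⟨fun i => (e i).inv, fun {i j} u => by
    rw [Iso.inv_comp_eq, ← Category.assoc, h, Category.assoc, ← Functor.map_comp]
    simp⟩
  hom_inv_id := hom_ext fun i => (e i).hom_inv_id
  inv_hom_id := hom_ext fun i => (e i).inv_hom_id

end Sec

open Sec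

variable {G : StrictPseudofunctor Iᵒᵖ Cat.{v, v}}

/-- The sections given by the objects of the vertex of a pseudocone. -/
def secOf {T : Cat.{v, v}} (σ : Pseudocone G T) : T ⥤ Sec G where
  obj t :=
    { pt := fun i => ob(σ.π i) t
      iso := fun u => (Cat.Hom.toNatIso (σ.πIso u)).app t
      iso_id := fun i => by
        change ap((σ.πIso (𝟙 i)).hom) t ≍ _
        rw [σ.πIso_id, Cat.eqToHom_app]
        exact eqToHom_heq _ rfl
      iso_comp := fun u w => by
        change ap((σ.πIso (u ≫ w)).hom) t ≍ ap((σ.πIso u).hom) t ≫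
          mp(G.map u.op) (ap((σ.πIso w).hom) t)
        rw [σ.πIso_comp, Cat.Hom₂.comp_app, Cat.Hom₂.comp_app, Cat.eqToHom_app,
          ← Category.assoc]
        exact comp_eqToHom_heq _ _
      iso_map₂ := fun {i j u w} α =>
        congrArg (fun P => ap(P) t) (σ.πIso_naturality α) }
  map f :=
    { app := fun i => mp(σ.π i) f
      naturality := fun u => (NatTrans.naturality (Cat.Hom₂.toNatTrans (σ.πIso u).hom) f) }
  map_id _ := hom_ext fun _ => CategoryTheory.Functor.map_id _ _
  map_comp _ _ := hom_ext fun _ => CategoryTheory.Functor.map_comp _ _ _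

/-- The pseudocones with vertex `Z` over a category-valued 2-functor, as functors. -/
def pseudoconeToFunctor (Z : Cat.{v, v}) : Pseudocone G Z ⥤ (Z ⥤ Sec G) where
  obj τ := secOf τ
  map {τ τ'} ρ :=
    { app := fun z => ⟨fun i => ap(Pseudocone.Hom.app ρ i) z, fun u =>
        congrArg (fun P => ap(P) z) (Pseudocone.Hom.naturality ρ u)⟩
      naturality := fun z z' f => hom_ext fun i =>
        NatTrans.naturality (Cat.Hom₂.toNatTrans (Pseudocone.Hom.app ρ i)) f }

/-- The pseudocone given by a functor to the category of sections. -/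
def pseudoconeOfFunctor {Z : Cat.{v, v}} (P : Z ⥤ Sec G) : Pseudocone G Z where
  π i := Cat.Hom.ofFunctor (P ⋙ Sec.eval G i)
  πIso {i j} u := Cat.Hom.isoMk (NatIso.ofComponents (F := P ⋙ Sec.eval G i)
    (G := (P ⋙ Sec.eval G j) ⋙ (G.map u.op).toFunctor) (fun z => (P.obj z).iso u)
    (fun f => Sec.Hom.naturality (P.map f) u))
  πIso_id i := Cat.Hom₂.ext (NatTrans.ext (funext fun z => by
    rw [Cat.eqToHom_app]
    refine eq_of_heq (((P.obj z).iso_id i).trans ?_)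
    exact (eqToHom_heq _ rfl).symm))
  πIso_comp u w := Cat.Hom₂.ext (NatTrans.ext (funext fun z => by
    rw [Cat.Hom₂.comp_app, Cat.Hom₂.comp_app, Cat.eqToHom_app, ← Category.assoc]
    refine eq_of_heq (((P.obj z).iso_comp u w).trans ?_)
    exact (comp_eqToHom_heq _ _).symm))
  πIso_naturality α := Cat.Hom₂.ext (NatTrans.ext (funext fun z => (P.obj z).iso_map₂ α))

/-- The same data read in two orders, a family of functors with 2-cells or a functor into families
with isomorphisms; both round trips are definitional. -/
lemma catIso_pseudoconeToFunctor (Z : Cat.{v, v}) :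
    CatIso (pseudoconeToFunctor (G := G) Z) :=
  ⟨{ obj := pseudoconeOfFunctor
     map := fun ρ =>
      { app := fun i => Cat.Hom₂.ofNatTrans (Functor.whiskerRight ρ (Sec.eval G i))
        naturality := fun u => Cat.Hom₂.ext (NatTrans.ext (funext fun z =>
          Sec.Hom.naturality (ρ.app z) u)) }
     map_id := fun _ => rfl
     map_comp := fun _ _ => rfl }, rfl, rfl⟩

lemma catIso_whiskeringRight {D : Type u₁} [Category.{v₁} D] {E : Type u₂} [Category.{v₂} E]
    {P : D ⥤ E} (hP : CatIso P) (Z : Type u₃) [Category.{v₃} Z] :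
    CatIso ((Functor.whiskeringRight Z D E).obj P) := by
  obtain ⟨Q, h₁, h₂⟩ := hP
  refine ⟨(Functor.whiskeringRight Z E D).obj Q, ?_, ?_⟩
  · change (Functor.whiskeringRight Z D D).obj (P ⋙ Q) = 𝟭 _
    rw [h₁]; rfl
  · change (Functor.whiskeringRight Z E E).obj (Q ⋙ P) = 𝟭 _
    rw [h₂]; rfl

/-- Constant functors carry the objects and arrows of `D` into `Z ⥤ D`, and evaluation at `z` brings
the results back, so a single nonempty `Z` suffices as a test. -/
lemma catIso_of_whiskeringRight {D : Type u₁} [Category.{v₁} D] {E : Type u₂} [Category.{v₂} E]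
    {P : D ⥤ E} {Z : Type u₃} [Category.{v₃} Z] (z : Z)
    (h : CatIso ((Functor.whiskeringRight Z D E).obj P)) : CatIso P := by
  refine catIso_of_bijective ⟨fun x y hxy => ?_, fun y => ?_⟩ fun x y => ⟨fun f g hfg => ?_,
    fun g => ?_⟩
  · have : (Functor.const Z).obj x = (Functor.const Z).obj y := h.obj_bijective.1 (by
      refine CategoryTheory.Functor.ext (fun _ => hxy) ?_
      intros; change P.map (𝟙 _) = _ ≫ P.map (𝟙 _) ≫ _
      simp)
    exact Functor.congr_obj this z
  · obtain ⟨Q, hQ⟩ := h.obj_bijective.2 ((Functor.const Z).obj y)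
    exact ⟨Q.obj z, Functor.congr_obj hQ z⟩
  · have : (Functor.const Z).map f = (Functor.const Z).map g := (h.map_bijective _ _).1 (by
      ext _
      exact hfg)
    exact congrArg (fun τ => τ.app z) this
  · obtain ⟨τ, hτ⟩ := (h.map_bijective ((Functor.const Z).obj x) ((Functor.const Z).obj y)).2
      { app := fun _ => g
        naturality := fun _ _ _ => by
          change P.map (𝟙 _) ≫ g = g ≫ P.map (𝟙 _)
          simp }
    exact ⟨τ.app z, congrArg (fun τ => τ.app z) hτ⟩

/-- A pseudocone over a category-valued 2-functor is a pseudolimit if and only if its vertex is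
isomorphic to the category of sections. -/
theorem isPseudolimit_iff_catIso_secOf {T : Cat.{v, v}} (σ : Pseudocone G T) :
    σ.IsPseudolimit ↔ CatIso (secOf σ) := by
  have hT (Z : Cat.{v, v}) : CatIso
      ({ obj := fun P => Cat.Hom.toFunctor P
         map := fun α => Cat.Hom₂.toNatTrans α } : (Z ⟶ T) ⥤ (Z ⥤ T)) :=
    ⟨{ obj := fun P => Cat.Hom.ofFunctor P, map := fun α => Cat.Hom₂.ofNatTrans α }, rfl, rfl⟩
  -- Up to isomorphisms of categories on both sides, pre-composition of `σ` with functors into its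
  -- vertex is post-composition of these functors with `secOf σ`.
  have key (Z : Cat.{v, v}) : CatIso (σ.precompose Z) ↔
      CatIso ((Functor.whiskeringRight Z T (Sec G)).obj (secOf σ)) := by
    have e : σ.precompose Z ⋙ pseudoconeToFunctor Z =
      ({ obj := fun P => Cat.Hom.toFunctor P
         map := fun α => Cat.Hom₂.toNatTrans α } : (Z ⟶ T) ⥤ (Z ⥤ T)) ⋙
      (Functor.whiskeringRight Z T (Sec G)).obj (secOf σ) := by
      have e₁ (P : Z ⟶ T) (z : Z) : (secOf ((σ.precompose Z).obj P)).obj z =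
          (secOf σ).obj (ob(P) z) := Sec.ext' (fun _ => rfl) (fun {i j} u => by
        change ap((σ.πIso u).hom) (ob(P) z) ≫
          ap(eqToHom (Strict.assoc P (σ.π j) (G.map u.op)).symm) z ≍ _
        rw [Cat.eqToHom_app]
        exact comp_eqToHom_heq _ _)
      have e₂ (P : Z ⟶ T) : secOf ((σ.precompose Z).obj P) = P.toFunctor ⋙ secOf σ :=
        CategoryTheory.Functor.hext (e₁ P)
          (fun _ _ _ => Sec.hom_heq (e₁ P _) (e₁ P _) (fun _ => HEq.rfl))
      exact CategoryTheory.Functor.hext e₂ (fun P Q _ => natTrans_heq (e₂ P) (e₂ Q)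
        (fun z => Sec.hom_heq (e₁ P z) (e₁ Q z) (fun _ => HEq.rfl)))
    refine ⟨fun h => ?_, fun h => ?_⟩
    · exact CatIso.of_comp_left (e ▸ h.comp (catIso_pseudoconeToFunctor Z)) (hT Z)
    · exact CatIso.of_comp_right (e ▸ (hT Z).comp h) (catIso_pseudoconeToFunctor Z)
  refine ⟨fun h => ?_, fun h Z => (key Z).2 (catIso_whiskeringRight h Z)⟩
  exact catIso_of_whiskeringRight (Z := Discrete PUnit.{v + 1}) ⟨PUnit.unit⟩
    ((key (Cat.of _)).1 (h _))

end Sections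

/-! ### Heterogeneous equalities in a pseudocolimit of categories -/

namespace PseudoColim

variable {I : Type v} [Bicategory.{v, v} I] {F G : StrictPseudofunctor I Cat.{v, v}}
  {E : Type u₁} [Category.{v₁} E]

lemma mk_congr {i : I} {x y : F.obj i} (h : x = y) : (⟨i, x⟩ : PseudoColim F) = ⟨i, y⟩ := by
  rw [h]

lemma incl_heq {i : I} {x y x' y' : F.obj i} (hx : x = x') (hy : y = y') {f : x ⟶ y}
    {f' : x' ⟶ y'} (h : f ≍ f') : incl i f ≍ incl i f' := by
  subst hx hy h; rfl

lemma push_heq {i j : I} {u u' : i ⟶ j} (hu : u = u') {x x' : F.obj i} (h : x = x') :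
    (push u x).hom ≍ (push u' x').hom := by
  subst hu h; rfl

lemma push_id_heq (i : I) (x : F.obj i) : (push (𝟙 i) x).hom ≍ 𝟙 (⟨i, x⟩ : PseudoColim F) := by
  rw [push_id']
  exact eqToHom_heq _ rfl

lemma push_comp_heq {i j k : I} (u : i ⟶ j) (w : j ⟶ k) (x : F.obj i) :
    (push u x).hom ≫ (push w ((F.map u).toFunctor.obj x)).hom ≍ (push (u ≫ w) x).hom := by
  rw [push_comp']
  exact comp_eqToHom_heq _ _

lemma functor_hext {P Q : PseudoColim F ⥤ E} (h : ∀ a, P.obj a = Q.obj a)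
    (h₁ : ∀ (i : I) {x y : F.obj i} (f : x ⟶ y), P.map (incl i f) ≍ Q.map (incl i f))
    (h₂ : ∀ {i j : I} (u : i ⟶ j) (x : F.obj i), P.map (push u x).hom ≍ Q.map (push u x).hom) :
    P = Q :=
  functor_ext h (fun i _ _ f => (heq_iff_eqToHom (h _) (h _)).1 (h₁ i f))
    (fun u x => (heq_iff_eqToHom (h _) (h _)).1 (h₂ u x))

lemma colimMap_push_heq (θ : F ⟶ G) {i j : I} (u : i ⟶ j) (x : F.obj i) :
    (colimMap θ).map (push u x).hom ≍ (push u (ob(TwoNat.app θ i) x)).hom :=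
  trans_eqToIso_heq _ (mk_congr (naturality_obj θ u x))

end PseudoColim

/-! ### 2-natural transformations out of `L X` as sections over `X` -/

section Universal

open PseudoColim

variable {C : Type u} [Bicategory.{v, v} C]

/-- The functor which applies a category-valued 2-functor to arrows with a fixed domain, and
evaluates the result at an object. -/
def evalAt {B : Type u₁} [Bicategory.{w₁, v₁} B] (F : StrictPseudofunctor B Cat.{v₂, u₂}) {A : B}
    (x : F.obj A) (E : B) : (A ⟶ E) ⥤ F.obj E where
  obj f := ob(F.map f) x
  map α := ap(F.map₂ α) x
  map_id f := map₂_id_app F f x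
  map_comp α β := map₂_comp_app F α β x

variable [Strict C] {I : Type v} [Bicategory.{v, v} I] [Strict I]
  (X : StrictPseudofunctor Iᵒᵖ C) {F G : StrictPseudofunctor C Cat.{v, v}}

lemma L_map_push_heq {E E' : C} (g : E ⟶ E') {i j : I} (u : i ⟶ j) (f : X.obj (op i) ⟶ E) :
    mp((L X).map g) (push (F := homDiagram X E) u f).hom ≍
      (push (F := homDiagram X E') u (f ≫ g)).hom :=
  colimMap_push_heq _ _ _

/-- The universal section of the pseudocolimit of representable 2-functors. -/
def univSec : Sec (X.comp (L X)) where
  pt i := (⟨i, 𝟙 (X.obj (op i))⟩ : PseudoColim (homDiagram X _))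
  -- The structural 2-cell ends at `X.map u.op ≫ 𝟙 _`, whereas a section asks for `𝟙 _ ≫ X.map
  -- u.op`.
  iso {i j} u := push (F := homDiagram X _) u (𝟙 (X.obj (op i))) ≪≫ eqToIso (mk_congr
    ((Strict.comp_id _).trans (Strict.id_comp _).symm))
  iso_id i := (trans_eqToIso_heq _ _).trans (push_id_heq _ _)
  iso_comp {i j k} u w := by
    refine (trans_eqToIso_heq _ _).trans ?_
    refine (push_comp_heq _ _ _).symm.trans ?_
    refine comp_heq rfl (mk_congr ((Strict.comp_id _).trans (Strict.id_comp _).symm))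
      (mk_congr ?_) (trans_eqToIso_heq _ _).symm ?_
    · change X.map w.op ≫ X.map u.op ≫ 𝟙 _ = (𝟙 _ ≫ X.map w.op) ≫ X.map u.op
      rw [Strict.comp_id, Strict.id_comp]
    · refine HEq.trans ?_ (map_heq ((L X).map (X.map u.op)).toFunctor rfl (mk_congr
        ((Strict.comp_id _).trans (Strict.id_comp _).symm)) (trans_eqToIso_heq _ _).symm)
      refine HEq.trans ?_ (L_map_push_heq X _ _ _).symm
      exact push_heq rfl ((Strict.comp_id _).trans (Strict.id_comp _).symm)
  iso_map₂ {i j u w} α := by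
    refine eq_of_heq (HEq.trans ?_ (trans_eqToIso_heq _ _).symm)
    refine HEq.trans ?_ (heq_of_eq (push_map₂ (F := homDiagram X _) α (𝟙 (X.obj (op i)))))
    refine comp_heq rfl (mk_congr ((Strict.id_comp _).trans (Strict.comp_id _).symm))
      (mk_congr ((Strict.id_comp _).trans (Strict.comp_id _).symm)) (trans_eqToIso_heq _ _) ?_
    exact incl_heq (F := homDiagram X _) ((Strict.id_comp _).trans (Strict.comp_id _).symm)
      ((Strict.id_comp _).trans (Strict.comp_id _).symm)
      ((id_whiskerLeft_heq _).trans (whiskerRight_id_heq _).symm)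

variable {X}

lemma univSec_iso_heq {i j : I} (u : i ⟶ j) : ((univSec X).iso u).hom ≍
    (push (F := homDiagram X _) u (𝟙 (X.obj (op i)))).hom :=
  trans_eqToIso_heq _ (mk_congr ((Strict.comp_id _).trans (Strict.id_comp _).symm))

/-- The image of a section under a 2-natural transformation. -/
def Sec.mapObj {J : Type v} [Bicategory.{v, v} J] {H K : StrictPseudofunctor Jᵒᵖ Cat.{v, v}}
    (η : H ⟶ K) (s : Sec H) : Sec K where
  pt i := ob(TwoNat.app η (op i)) (s.pt i)
  iso {i j} u := (TwoNat.app η (op i)).toFunctor.mapIso (s.iso u) ≪≫ eqToIso (nat_obj η u.op _)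
  iso_id i := by
    refine (mapIso_trans_eqToIso_heq _ _ _).trans ?_
    exact (map_heq _ rfl (obj_id H _ _) (s.iso_id i)).trans (functor_map_id_heq _ _)
  iso_comp {i j k} u w := by
    refine (mapIso_trans_eqToIso_heq _ _ _).trans ?_
    refine (map_heq _ rfl (obj_comp H _ _ _) (s.iso_comp u w)).trans ?_
    refine (functor_map_comp_heq _ _ _).trans ?_
    refine comp_heq rfl (nat_obj η u.op _) ((nat_obj η u.op _).trans
      (congrArg _ (nat_obj η w.op _))) (mapIso_trans_eqToIso_heq _ _ _).symm ?_
    refine (nat_map_heq η u.op _).trans ?_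
    exact map_heq _ rfl (nat_obj η w.op _) (mapIso_trans_eqToIso_heq _ _ _).symm
  iso_map₂ {i j u w} α := by
    refine eq_of_heq (HEq.trans ?_ (mapIso_trans_eqToIso_heq _ _ _).symm)
    refine HEq.trans ?_ (heq_of_eq (congrArg _ (s.iso_map₂ α)))
    refine HEq.trans ?_ (functor_map_comp_heq _ _ _).symm
    exact comp_heq rfl (nat_obj η _ _).symm (nat_obj η _ _).symm
      (mapIso_trans_eqToIso_heq _ _ _) (nat_map₂_heq η _ _).symm

lemma Sec.mapObj_iso_heq {J : Type v} [Bicategory.{v, v} J]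
    {H K : StrictPseudofunctor Jᵒᵖ Cat.{v, v}}
    (η : H ⟶ K) (s : Sec H) {i j : J} (u : i ⟶ j) : ((Sec.mapObj η s).iso u).hom ≍
      mp(TwoNat.app η (op i)) (s.iso u).hom := trans_eqToIso_heq _ (nat_obj η u.op _)

/-- The section of `F` over `X` given by a 2-natural transformation. -/
def toSec : (L X ⟶ F) ⥤ Sec (X.comp F) where
  obj θ := Sec.mapObj (precomp₁ X θ) (univSec X)
  map {θ η} ρ :=
    { app := fun i => ap(Modif.app ρ (X.obj (op i))) ((univSec X).pt i)
      naturality := fun {i j} u => by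
        refine eq_of_heq ?_
        refine HEq.trans (comp_heq rfl rfl (nat_obj η _ _).symm HEq.rfl
          (Sec.mapObj_iso_heq _ _ _)) ?_
        refine HEq.trans ?_ (comp_heq rfl (nat_obj θ _ _) (nat_obj η _ _)
          (Sec.mapObj_iso_heq (precomp₁ X θ) (univSec X) u).symm (modif_heq ρ _ _))
        exact heq_of_eq (modif_naturality ρ _ _).symm }
  map_id _ := Sec.hom_ext fun _ => rfl
  map_comp _ _ := Sec.hom_ext fun _ => rfl

lemma toSec_iso_heq (θ : L X ⟶ F) {i j : I} (u : i ⟶ j) : ((toSec.obj θ).iso u).hom ≍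
    mp(TwoNat.app θ (X.obj (op i))) (push (F := homDiagram X _) u (𝟙 (X.obj (op i)))).hom :=
  (Sec.mapObj_iso_heq _ _ _).trans (map_heq _ rfl
    (mk_congr ((Strict.id_comp _).trans (Strict.comp_id _).symm)) (univSec_iso_heq u))

/-- The pseudocone which induces the 2-natural transformation given by a section. -/
def secCocone (s : Sec (X.comp F)) (E : C) : Cocone (homDiagram X E) (F.obj E) where
  ι i := evalAt F (s.pt i) E
  ιIso {i j} u f := (F.map f).toFunctor.mapIso (s.iso u) ≪≫
    eqToIso (obj_comp F (X.map u.op) f (s.pt j)).symm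
  ιIso_naturality {i j} u f g α := by
    refine eq_of_heq ?_
    refine (comp_heq rfl rfl (obj_comp F _ _ _) HEq.rfl (mapIso_trans_eqToIso_heq _ _ _)).trans ?_
    refine HEq.trans ?_ (comp_heq rfl (obj_comp F _ _ _).symm (obj_comp F _ _ _).symm
      (mapIso_trans_eqToIso_heq _ _ _).symm (map₂_whiskerLeft_app_heq F (X.map u.op) α _).symm)
    exact heq_of_eq (NatTrans.naturality (F.map₂ α).toNatTrans (s.iso u).hom).symm
  ιIso_id i f := by
    refine eq_of_heq ((mapIso_trans_eqToIso_heq _ _ _).trans ?_)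
    refine (map_heq _ rfl (obj_id (X.comp F) _ _) (s.iso_id i)).trans ?_
    refine (functor_map_id_heq _ _).trans ?_
    have h : ((homDiagram X E).mapId i).inv.toNatTrans.app f =
        eqToHom (obj_id (homDiagram X E) i f).symm := by
      rw [StrictlyUnitaryPseudofunctor.mapId_eq_eqToIso, eqToIso.inv, Cat.eqToHom_app]
    rw [h]
    exact (functor_map_eqToHom_heq (evalAt F (s.pt i) E) _).symm
  ιIso_comp {i j k} u w f := by
    refine eq_of_heq ?_
    have h : ((homDiagram X E).mapComp u w).hom.toNatTrans.app f =
        eqToHom (obj_comp (homDiagram X E) u w f) := by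
      rw [StrictPseudofunctor.mapComp_eq_eqToIso, eqToIso.hom, Cat.eqToHom_app]
    rw [h]
    refine HEq.trans ?_ (comp_id_heq rfl (congrArg (evalAt F (s.pt k) E).obj
      (obj_comp (homDiagram X E) u w f).symm) _ (functor_map_eqToHom_heq (evalAt F (s.pt k) E) _)).symm
    refine HEq.trans ?_ (mapIso_trans_eqToIso_heq _ _ _).symm
    refine HEq.trans ?_ (map_heq (F.map f).toFunctor rfl
      (obj_comp (X.comp F) w.op u.op _).symm (s.iso_comp u w).symm)
    refine HEq.trans ?_ (functor_map_comp_heq _ _ _).symm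
    refine comp_heq rfl (obj_comp F _ _ _) ?_ (mapIso_trans_eqToIso_heq _ _ _) ?_
    · exact (obj_comp F _ _ _).trans (obj_comp F _ _ _)
    · exact (mapIso_trans_eqToIso_heq _ _ _).trans (map_comp_heq F _ _ _)
  ιIso_map₂ {i j u w} α f := by
    refine eq_of_heq (HEq.trans ?_ (mapIso_trans_eqToIso_heq _ _ _).symm)
    refine HEq.trans ?_ (heq_of_eq (congrArg _ (s.iso_map₂ α)))
    refine HEq.trans ?_ (functor_map_comp_heq _ _ _).symm
    exact comp_heq rfl (obj_comp F _ _ _) (obj_comp F _ _ _) (mapIso_trans_eqToIso_heq _ _ _)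
      (map₂_whiskerRight_app_heq F _ _ _)

/-- The 2-natural transformation given by a section. -/
def ofSecObj (s : Sec (X.comp F)) : L X ⟶ F :=
  natMk (L X) F (fun E => desc (secCocone s E))
    (fun {E E'} g => functor_hext (fun a => obj_comp F a.el g _)
      (fun i f f' α => map₂_whiskerRight_app_heq F α g _)
      (fun {i j} u f => by
        refine (map_heq (desc (secCocone s E')) rfl (mk_congr (Strict.assoc _ _ _))
          (L_map_push_heq X g u f)).trans ?_
        refine (mapIso_trans_eqToIso_heq _ _ _).trans ?_
        refine (map_comp_heq F f g _).trans ?_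
        exact map_heq (F.map g).toFunctor rfl (obj_comp F _ _ _).symm
          (mapIso_trans_eqToIso_heq _ _ _).symm))
    (fun α a => map₂_whiskerLeft_app_heq F a.el α _)

lemma ofSecObj_push_heq (s : Sec (X.comp F)) {E : C} {i j : I} (u : i ⟶ j)
    (f : X.obj (op i) ⟶ E) :
    mp(TwoNat.app (ofSecObj s) E) (push (F := homDiagram X E) u f).hom ≍
      mp(F.map f) (s.iso u).hom := mapIso_trans_eqToIso_heq _ _ _

/-- The modification given by a morphism of sections. -/
def ofSecMap {s t : Sec (X.comp F)} (h : s ⟶ t) : ofSecObj s ⟶ ofSecObj t :=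
  modMk (fun E => natTransMk (fun a => mp(F.map a.el) (Sec.Hom.app h a.idx))
      (fun i {_ _} α => (NatTrans.naturality (F.map₂ α).toNatTrans (Sec.Hom.app h i)).symm)
      (fun {i j} u f => by
        refine eq_of_heq ?_
        refine (comp_heq rfl (obj_comp F _ _ _) (obj_comp F _ _ _) (ofSecObj_push_heq s u f)
          (map_comp_heq F _ _ _)).trans ?_
        refine HEq.trans ?_ (comp_heq rfl rfl (obj_comp F _ _ _).symm HEq.rfl
          (ofSecObj_push_heq t u f).symm)
        refine (functor_map_comp_heq _ _ _).symm.trans (HEq.trans ?_ (functor_map_comp_heq _ _ _))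
        exact heq_of_eq (congrArg _ (Sec.Hom.naturality h u).symm)))
    (fun g a => map_comp_heq F a.el g _)

/-- Sections of `F` over `X`, as 2-natural transformations. -/
def ofSec : Sec (X.comp F) ⥤ (L X ⟶ F) where
  obj := ofSecObj
  map := ofSecMap
  map_id _ := modif_ext fun _ _ => CategoryTheory.Functor.map_id _ _
  map_comp _ _ := modif_ext fun _ _ => CategoryTheory.Functor.map_comp _ _ _

/-- Since `𝟙 ≫ f = f` holds strictly, every object of `L X` is on the nose the image of a value of
the universal section. 2-naturality then determines a transformation by its effect on that section.
-/
lemma L_obj_eq {E : C} (a : PseudoColim (homDiagram X E)) :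
    ob((L X).map a.el) ((univSec X).pt a.idx) = a :=
  mk_congr (Strict.id_comp a.el)

lemma nat_obj_eq (θ : L X ⟶ F) {E : C} (a : PseudoColim (homDiagram X E)) :
    ob(TwoNat.app θ E) a = ob(F.map a.el) ((toSec.obj θ).pt a.idx) :=
  (congrArg _ (L_obj_eq a).symm).trans (nat_obj θ a.el _)

/-- The arrow `α` is up to equality `𝟙 _ ◁ α`, the component of `(L X).map₂ α` at a value of the
universal section, where 2-naturality applies. -/
lemma nat_incl_heq (θ : L X ⟶ F) {E : C} {i : I} {f g : X.obj (op i) ⟶ E} (α : f ⟶ g) :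
    mp(TwoNat.app θ E) (incl (F := homDiagram X E) i α) ≍
      ap(F.map₂ α) ((toSec.obj θ).pt i) := by
  refine HEq.trans ?_ (nat_map₂_heq θ α _)
  refine map_heq _ (mk_congr (Strict.id_comp _).symm) (mk_congr (Strict.id_comp _).symm) ?_
  exact incl_heq (Strict.id_comp _).symm (Strict.id_comp _).symm (id_whiskerLeft_heq α).symm

lemma nat_push_heq (θ : L X ⟶ F) {E : C} {i j : I} (u : i ⟶ j) (f : X.obj (op i) ⟶ E) :
    mp(TwoNat.app θ E) (push (F := homDiagram X E) u f).hom ≍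
      mp(F.map f) ((toSec.obj θ).iso u).hom := by
  have h : (X.map u.op ≫ 𝟙 _) ≫ f = X.map u.op ≫ f := by rw [Strict.comp_id]
  refine HEq.trans ?_ (map_heq (F.map f).toFunctor rfl ?_ (toSec_iso_heq θ u).symm)
  · refine HEq.trans ?_ (nat_map_heq θ f _)
    refine map_heq _ (mk_congr (Strict.id_comp _).symm) (mk_congr h.symm) ?_
    exact (push_heq rfl (Strict.id_comp _).symm).trans (L_map_push_heq X f u _).symm
  · refine Eq.trans ?_ (nat_obj θ _ _)
    exact (congrArg _ (mk_congr ((Strict.comp_id _).trans (Strict.id_comp _).symm)))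

lemma modif_app_eq_heq {θ η : L X ⟶ F} (ρ : θ ⟶ η) {E : C} (a : PseudoColim (homDiagram X E)) :
    ap(Modif.app ρ E) a ≍ mp(F.map a.el) (Sec.Hom.app (toSec.map ρ) a.idx) :=
  (app_heq _ (L_obj_eq a).symm).trans (modif_heq ρ a.el _)

/-- A functor on a pseudocolimit is determined by its values on objects, on `incl` and on `push`,
and all three have been expressed through the section. -/
lemma toSec_injective {θ η : L X ⟶ F} (h : toSec.obj θ = toSec.obj η) : θ = η := by
  refine TwoNat.ext (funext fun E => Cat.Hom.ext (functor_hext (fun a => ?_) (fun _ _ _ α => ?_)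
    (fun u f => ?_)))
  · exact (nat_obj_eq θ a).trans (Eq.trans (by rw [h]) (nat_obj_eq η a).symm)
  · exact (nat_incl_heq θ α).trans (HEq.trans (by rw [h]) (nat_incl_heq η α).symm)
  · exact (nat_push_heq θ u f).trans (HEq.trans (by rw [h]) (nat_push_heq η u f).symm)

lemma toSec_faithful {θ η : L X ⟶ F} {ρ ρ' : θ ⟶ η} (h : toSec.map ρ = toSec.map ρ') :
    ρ = ρ' :=
  modif_ext fun E a => eq_of_heq ((modif_app_eq_heq ρ a).trans
    (HEq.trans (by rw [h]) (modif_app_eq_heq ρ' a).symm))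

lemma toSec_ofSecObj (s : Sec (X.comp F)) : toSec.obj (ofSec.obj s) = s :=
  Sec.ext' (fun _ => obj_id F _ _) (fun u => (toSec_iso_heq _ _).trans
    ((ofSecObj_push_heq s u _).trans (map_id_heq F _ _)))

/-- Only the other round trip needs a computation; this one follows from it, because `toSec` is
injective on objects. -/
lemma ofSec_toSecObj (θ : L X ⟶ F) : ofSec.obj (toSec.obj θ) = θ :=
  toSec_injective (toSec_ofSecObj _)

variable (X F) in
lemma ofSec_comp_toSec : ofSec ⋙ toSec = 𝟭 (Sec (X.comp F)) :=
  CategoryTheory.Functor.hext toSec_ofSecObj (fun s t _ =>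
    Sec.hom_heq (toSec_ofSecObj s) (toSec_ofSecObj t) (fun _ => map_id_heq F _ _))

variable (X F) in
lemma toSec_comp_ofSec : toSec ⋙ ofSec = 𝟭 (L X ⟶ F) :=
  CategoryTheory.Functor.hext ofSec_toSecObj (fun θ η ρ =>
    modif_heq_ext (ofSec_toSecObj θ) (ofSec_toSecObj η) (fun _ a => (modif_app_eq_heq ρ a).symm))

lemma catIso_toSec : CatIso (toSec : (L X ⟶ F) ⥤ _) :=
  ⟨ofSec, toSec_comp_ofSec X F, ofSec_comp_toSec X F⟩

lemma catIso_ofSec : CatIso (ofSec : Sec (X.comp F) ⥤ _) :=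
  ⟨toSec, ofSec_comp_toSec X F, toSec_comp_ofSec X F⟩

end Universal

/-! ### The Yoneda isomorphism for 2-functors corepresented by an object -/

section Yoneda

open PseudoColim

variable {C : Type u} [Bicategory.{v, v} C] [Strict C] {A : C}
  {F G : StrictPseudofunctor C Cat.{v, v}}

/-- The object of the one-object 2-category. -/
abbrev pt : Pt.{v} := ⟨⟨PUnit.unit⟩⟩

/-- The generic element of the 2-functor corepresented by `A`. -/
abbrev gen (A : C) : (L (const.{v} A)).obj A :=
  (⟨pt, 𝟙 A⟩ : PseudoColim (homDiagram (const A) A))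

/-- The only arrow of the one-object 2-category is the identity, where `iso_id` applies. Hence a
section over it is just an object. -/
lemma sec_iso_heq_id {K : StrictPseudofunctor Pt.{v}ᵒᵖ Cat.{v, v}} (s : Sec K) {i j : Pt.{v}}
    (u : i ⟶ j) : (s.iso u).hom ≍ 𝟙 (s.pt i) := by
  obtain ⟨⟨⟩⟩ := i
  obtain ⟨⟨⟩⟩ := j
  obtain rfl : u = 𝟙 _ := Discrete.ext (Subsingleton.elim _ _)
  exact s.iso_id _

variable (F) in
/-- The sections over a constant diagram on the one-object 2-category. -/
def constSec (A : C) : F.obj A ⥤ Sec ((const.{v} A).comp F) where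
  obj x :=
    { pt := fun _ => x
      iso := fun _ => eqToIso (obj_id F A x).symm
      iso_id := fun _ => eqToHom_heq (obj_id F A x).symm rfl
      iso_comp := fun _ _ => by
        have h : ob(F.map (𝟙 A)) x = x := obj_id F A x
        refine HEq.trans (b := 𝟙 x) (eqToHom_heq h.symm rfl) (HEq.symm ?_)
        refine (id_comp_heq h rfl _ (eqToHom_heq h.symm rfl)).trans ?_
        exact HEq.trans (functor_map_eqToHom_heq (F.map (𝟙 A)).toFunctor h.symm) (id_heq h)
      iso_map₂ := fun _ => by
        refine (congrArg _ (map₂_id_app F _ _)).trans (Category.comp_id _) }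
  map {x y} p :=
    { app := fun _ => p
      naturality := fun _ => eq_of_heq <|
        (comp_id_heq rfl (obj_id F A y) p (eqToHom_heq (obj_id F A y).symm rfl)).trans <| HEq.symm <|
        (id_comp_heq (obj_id F A x) rfl _ (eqToHom_heq (obj_id F A x).symm rfl)).trans
          (map_id_heq F A p) }
  map_id _ := Sec.hom_ext fun _ => rfl
  map_comp _ _ := Sec.hom_ext fun _ => rfl

variable (F) in
lemma catIso_constSec (A : C) : CatIso (constSec F A) :=
  have h (s : Sec ((const.{v} A).comp F)) : (constSec F A).obj (s.pt pt) = s :=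
    Sec.ext' (fun _ => rfl) (fun u => (eqToHom_heq (obj_id F A _).symm rfl).trans
      (sec_iso_heq_id s u).symm)
  ⟨Sec.eval _ pt, rfl, CategoryTheory.Functor.hext h
    (fun s t _ => Sec.hom_heq (h s) (h t) (fun _ => HEq.rfl))⟩

/-- The Yoneda isomorphism. -/
def yon (F : StrictPseudofunctor C Cat.{v, v}) (A : C) : F.obj A ⥤ (L (const.{v} A) ⟶ F) := constSec F A ⋙ ofSec

lemma catIso_yon : CatIso (yon F A) := (catIso_constSec F A).comp catIso_ofSec

/-- Only the section of a transformation counts, and over the one-object 2-category its isomorphisms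
are identities, so its single value at the generic element is all that remains. -/
lemma const_ext {θ η : L (const.{v} A) ⟶ F}
    (h : ob(TwoNat.app θ A) (gen A) = ob(TwoNat.app η A) (gen A)) : θ = η :=
  toSec_injective (Sec.ext' (fun _ => h) (fun u => (sec_iso_heq_id (toSec.obj θ) u).trans
    (HEq.trans (id_heq h) (sec_iso_heq_id (toSec.obj η) u).symm)))

lemma const_heq {θ η θ' η' : L (const.{v} A) ⟶ F} (hθ : θ = θ') (hη : η = η') {ρ : θ ⟶ η}
    {ρ' : θ' ⟶ η'} (h : ap(Modif.app ρ A) (gen A) ≍ ap(Modif.app ρ' A) (gen A)) : ρ ≍ ρ' := by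
  subst hθ hη
  exact heq_of_eq (toSec_faithful (Sec.hom_ext fun _ => eq_of_heq h))

lemma yon_gen (x : F.obj A) : ob(TwoNat.app ((yon F A).obj x) A) (gen A) = x := obj_id F A x

lemma yon_map_gen {x y : F.obj A} (p : x ⟶ y) :
    ap(Modif.app ((yon F A).map p) A) (gen A) ≍ p := map_id_heq F A p

variable (A) in
-- Naturality of the Yoneda isomorphism in the 2-functor; `yon_precomp` and `yon_map₂_heq` are its
-- naturality in the object and in 2-cells. All are tested at the generic element.
lemma yon_nat (θ : F ⟶ G) : (TwoNat.app θ A).toFunctor ⋙ yon G A =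
    yon F A ⋙ Bicategory.postcomp _ θ := by
  have h (x : F.obj A) : (yon G A).obj (ob(TwoNat.app θ A) x) = (yon F A).obj x ≫ θ :=
    const_ext ((yon_gen _).trans (congrArg _ (yon_gen x).symm))
  exact CategoryTheory.Functor.hext h (fun x y p => const_heq (h x) (h y)
    ((yon_map_gen _).trans (map_heq _ (yon_gen x).symm (yon_gen y).symm (yon_map_gen p).symm)))

/-- The 2-natural transformation which `c` assigns to an arrow. -/
abbrev cMap {A A' : C} (f : A ⟶ A') : L (const.{v} A') ⟶ L (const.{v} A) :=
  ((c C).map f).hom.unop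

/-- The modification which `c` assigns to a 2-cell. -/
abbrev cMap₂ {A A' : C} {f f' : A ⟶ A'} (α : f ⟶ f') : cMap f ⟶ cMap f' :=
  ((c C).map₂ α).hom.unop2

lemma yon_precomp {A A' : C} (f : A ⟶ A') : (F.map f).toFunctor ⋙ yon F A' =
    yon F A ⋙ Bicategory.precomp _ (cMap f) := by
  have e (x : F.obj A) : ob(F.map (f ≫ 𝟙 A')) x = ob(F.map f) x := by rw [Strict.comp_id]
  have h (x : F.obj A) : (yon F A').obj (ob(F.map f) x) = cMap f ≫ (yon F A).obj x :=
    const_ext ((yon_gen _).trans (e x).symm)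
  exact CategoryTheory.Functor.hext h (fun x y p => const_heq (h x) (h y)
    ((yon_map_gen _).trans (map_heq_of_eq (congrArg (fun g => (F.map g).toFunctor)
      (Strict.comp_id f).symm) p)))

lemma yon_map₂_heq {A A' : C} {f f' : A ⟶ A'} (α : f ⟶ f') (x : F.obj A) :
    (yon F A').map (ap(F.map₂ α) x) ≍ cMap₂ α ▷ (yon F A).obj x := by
  refine const_heq (Functor.congr_obj (yon_precomp f) x) (Functor.congr_obj (yon_precomp f') x) ?_
  refine (yon_map_gen _).trans ?_
  exact map₂_app_heq F (Strict.comp_id f).symm (Strict.comp_id f').symm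
    (whiskerRight_id_heq α).symm rfl

end Yoneda

/-! ### Arrows of 2-pro-objects into the image of `c` -/

section Pro

variable {C : Type u} [Bicategory.{v, v} C] [Strict C]

instance (X : Pro C) : Bicategory.{v, v} (TwoProObj.I (C := C) X) := TwoProObj.bicategory (C := C) X

instance (X : Pro C) : Strict (TwoProObj.I (C := C) X) := TwoProObj.strict (C := C) X

instance (X : Pro C) : IsTwoFiltered (TwoProObj.I (C := C) X) :=
  TwoProObj.isTwoFiltered (C := C) X

/-- The diagram of a 2-pro-object. -/
abbrev Pro.diagram (X : Pro C) : StrictPseudofunctor (TwoProObj.I (C := C) X)ᵒᵖ C :=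
  TwoProObj.diagram (C := C) X

/-- The 2-natural transformation underlying an arrow of 2-pro-objects. -/
abbrev ph {X Y : Pro C} (f : X ⟶ Y) : L (Pro.diagram Y) ⟶ L (Pro.diagram X) := f.hom.unop

/-- The modification underlying a 2-cell of 2-pro-objects. -/
abbrev pm {X Y : Pro C} {f g : X ⟶ Y} (η : f ⟶ g) : ph f ⟶ ph g := η.hom.unop2

/-- The arrows of 2-pro-objects given by 2-natural transformations. -/
def toPro (X Y : Pro C) : (L (Pro.diagram Y) ⟶ L (Pro.diagram X)) ⥤ (X ⟶ Y) where
  obj θ := InducedBicategory.mkHom θ.op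
  map ρ := InducedBicategory.mkHom₂ (Bicategory.Opposite.op2 ρ)

lemma catIso_toPro (X Y : Pro C) : CatIso (toPro X Y) :=
  ⟨{ obj := fun f => ph f, map := fun η => pm η }, rfl, rfl⟩

lemma pm_heq {X Y : Pro C} {f g f' g' : X ⟶ Y} (hf : f = f') (hg : g = g') {η : f ⟶ g}
    {η' : f' ⟶ g'} (h : η ≍ η') : pm η ≍ pm η' := by
  subst hf hg h; rfl

lemma pro_heq {X Y : Pro C} {f g f' g' : X ⟶ Y} (hf : f = f') (hg : g = g') {η : f ⟶ g}
    {η' : f' ⟶ g'} (h : pm η ≍ pm η') : η ≍ η' := by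
  subst hf hg
  exact heq_of_eq (InducedBicategory.hom₂_ext (congrArg Bicategory.Opposite.op2 (eq_of_heq h)))

/-- The arrows of 2-pro-objects to the image of an object of `C`. -/
def proYon (X : Pro C) (A : C) : (L (Pro.diagram X)).obj A ⥤ (X ⟶ (c C).obj A) :=
  yon (L (Pro.diagram X)) A ⋙ toPro X ((c C).obj A)

lemma catIso_proYon (X : Pro C) (A : C) : CatIso (proYon X A) := catIso_yon.comp (catIso_toPro _ _)

lemma proYon_precomp {X Y : Pro C} (f : X ⟶ Y) (A : C) :
    (TwoNat.app (ph f) A).toFunctor ⋙ proYon X A = proYon Y A ⋙ Bicategory.precomp _ f := by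
  refine (congrArg (· ⋙ toPro X ((c C).obj A)) (yon_nat A (ph f))).trans rfl

lemma proYon_postcomp (X : Pro C) {A A' : C} (f : A ⟶ A') :
    ((L (Pro.diagram X)).map f).toFunctor ⋙ proYon X A' =
      proYon X A ⋙ Bicategory.postcomp _ ((c C).map f) :=
  (congrArg (· ⋙ toPro X ((c C).obj A')) (yon_precomp f)).trans rfl

lemma proYon_map₂_heq (X : Pro C) {A A' : C} {f f' : A ⟶ A'} (α : f ⟶ f')
    (x : (L (Pro.diagram X)).obj A) : (proYon X A').map (ap((L (Pro.diagram X)).map₂ α) x) ≍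
      (proYon X A).obj x ◁ (c C).map₂ α :=
  pro_heq (Functor.congr_obj (proYon_postcomp X f) x) (Functor.congr_obj (proYon_postcomp X f') x)
    (yon_map₂_heq α x)

lemma proYon_whiskerRight_heq {X Y : Pro C} {f f' : X ⟶ Y} (η : f ⟶ f') (A : C)
    (x : (L (Pro.diagram Y)).obj A) : (proYon X A).map (ap(Modif.app (pm η) A) x) ≍
      η ▷ (proYon Y A).obj x := by
  refine pro_heq (Functor.congr_obj (proYon_precomp f A) x)
    (Functor.congr_obj (proYon_precomp f' A) x) ?_
  refine const_heq (Functor.congr_obj (yon_nat A (ph f)) x)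
    (Functor.congr_obj (yon_nat A (ph f')) x) ?_
  exact (yon_map_gen _).trans (app_heq _ (yon_gen x).symm)

/-- Between images of objects of `C` the Yoneda isomorphism is `c` itself. The case `g = 𝟙 A`
computes evaluations at the generic element. -/
lemma proYon_const {A E : C} (g : A ⟶ E) :
    (proYon ((c C).obj A) E).obj (⟨pt, g⟩ : PseudoColim (homDiagram (const A) E)) =
      (c C).map g := by
  refine InducedBicategory.hom_ext (congrArg Quiver.Hom.op (const_ext ?_))
  exact yon_gen (F := L (const A)) _ |>.trans (PseudoColim.mk_congr (Strict.comp_id g).symm)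

end Pro

/-! ### The extension of a 2-functor to 2-pro-objects -/

section Ran

variable {C : Type u} [Bicategory.{v, v} C] [Strict C] (F : StrictPseudofunctor C Cat.{v, v})

/-- The action of a 2-natural transformation on sections. -/
def ranMap {X Y : Pro C} (f : X ⟶ Y) : Sec ((Pro.diagram X).comp F) ⥤ Sec ((Pro.diagram Y).comp F) :=
  ofSec ⋙ Bicategory.precomp F (ph f) ⋙ toSec

/-- Seen through the isomorphism `ofSec`, the action of `f` is pre-composition with `ph f`. As
`ofSec` can be cancelled, the laws of `ran` on arrows reduce to the unit and associativity laws of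
composition. -/
lemma ranMap_comp_ofSec {X Y : Pro C} (f : X ⟶ Y) :
    ranMap F f ⋙ ofSec = ofSec ⋙ Bicategory.precomp F (ph f) := by
  refine (congrArg (fun P => ofSec ⋙ Bicategory.precomp F (ph f) ⋙ P) (toSec_comp_ofSec _ F)).trans
    ?_
  rfl

/-- The action of a modification on sections. -/
def ranMap₂ {X Y : Pro C} {f g : X ⟶ Y} (η : f ⟶ g) : ranMap F f ⟶ ranMap F g :=
  Functor.whiskerLeft ofSec (Functor.whiskerRight ((precomposing _ _ F).map (pm η)) toSec)

lemma ofSec_map_ranMap₂_heq {X Y : Pro C} {f g : X ⟶ Y} (η : f ⟶ g)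
    (s : Sec ((Pro.diagram X).comp F)) :
    ofSec.map ((ranMap₂ F η).app s) ≍ pm η ▷ ofSec.obj s :=
  map_heq_of_eq (toSec_comp_ofSec _ F) _

/-- The extension of a 2-functor `F` to 2-pro-objects, which sends `X` to the pseudolimit of the
categories `F (X i)`. -/
def ran : StrictPseudofunctor (Pro C) Cat.{v, v} := by
  have hid (X : Pro C) : ranMap F (𝟙 X) = 𝟭 _ :=
    CatIso.cancel_right catIso_ofSec ((ranMap_comp_ofSec F (𝟙 X)).trans
      (congrArg (ofSec ⋙ ·) (precomp_id (L (Pro.diagram X)) F)))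
  have hcomp {X Y Z : Pro C} (f : X ⟶ Y) (g : Y ⟶ Z) :
      ranMap F (f ≫ g) = ranMap F f ⋙ ranMap F g := by
    refine CatIso.cancel_right catIso_ofSec ?_
    rw [Functor.assoc, ranMap_comp_ofSec, ranMap_comp_ofSec, ← Functor.assoc, ranMap_comp_ofSec]
    exact congrArg (ofSec ⋙ ·) (precomp_comp _ _ _)
  refine twoFunctorMk
    { obj := fun X => Cat.of (Sec ((Pro.diagram X).comp F))
      map := fun f => (ranMap F f).toCatHom
      map₂ := fun η => (ranMap₂ F η).toCatHom₂
      map₂_id := ?_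
      map₂_comp := ?_ } ?_ ?_ ?_ ?_
  · exact fun f => Cat.Hom₂.ext (NatTrans.ext (funext fun s =>
      (congrArg toSec.map (id_whiskerRight (ph f) (ofSec.obj s))).trans
        (CategoryTheory.Functor.map_id _ _)))
  · exact fun η κ => Cat.Hom₂.ext (NatTrans.ext (funext fun s =>
      (congrArg toSec.map (comp_whiskerRight (pm η) (pm κ) (ofSec.obj s))).trans
        (CategoryTheory.Functor.map_comp _ _ _)))
  · exact fun X => Cat.Hom.ext (hid X)
  · exact fun f g => Cat.Hom.ext (hcomp f g)
  · exact fun f g g' α => cat_hom₂_heq (Cat.Hom.ext (hcomp f g)) (Cat.Hom.ext (hcomp f g'))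
      (fun s => map_heq toSec ((Strict.assoc _ _ _).trans
          (congrArg (ph g ≫ ·) (ofSec_toSecObj (ph f ≫ ofSec.obj s)).symm))
        ((Strict.assoc _ _ _).trans
          (congrArg (ph g' ≫ ·) (ofSec_toSecObj (ph f ≫ ofSec.obj s)).symm))
        ((whiskerRight_comp_heq (pm α) (ph f) (ofSec.obj s)).symm.trans
          (whiskerRight_heq rfl rfl (ofSec_toSecObj (ph f ≫ ofSec.obj s)).symm HEq.rfl)))
  · exact fun {X Y Z f f'} α g => cat_hom₂_heq (Cat.Hom.ext (hcomp f g))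
      (Cat.Hom.ext (hcomp f' g))
      (fun s => map_heq toSec ((Strict.assoc _ _ _).trans
          (congrArg (ph g ≫ ·) (ofSec_toSecObj (ph f ≫ ofSec.obj s)).symm))
        ((Strict.assoc _ _ _).trans
          (congrArg (ph g ≫ ·) (ofSec_toSecObj (ph f' ≫ ofSec.obj s)).symm))
        ((whisker_assoc_heq (ph g) (pm α) (ofSec.obj s)).trans
          (whiskerLeft_heq rfl (ofSec_toSecObj (ph f ≫ ofSec.obj s)).symm
            (ofSec_toSecObj (ph f' ≫ ofSec.obj s)).symm (ofSec_map_ranMap₂_heq F α s).symm)))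

end Ran

namespace CatIso

variable {D : Type u₁} [Category.{v₁} D] {E : Type u₂} [Category.{v₂} E] {P : D ⥤ E}

lemma map_injective_heq (hP : CatIso P) {x y x' y' : D} (hx : x = x') (hy : y = y') {f : x ⟶ y}
    {g : x' ⟶ y'} (h : P.map f ≍ P.map g) : f ≍ g := by
  subst hx hy
  exact heq_of_eq ((hP.map_bijective _ _).1 (eq_of_heq h))

lemma exists_map_heq (hP : CatIso P) {x y : D} {a b : E} (ha : P.obj x = a) (hb : P.obj y = b)
    (g : a ⟶ b) : ∃ f : x ⟶ y, P.map f ≍ g := by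
  subst ha hb
  obtain ⟨f, hf⟩ := (hP.map_bijective x y).2 g
  exact ⟨f, heq_of_eq hf⟩

lemma exists_iso_heq (hP : CatIso P) {x y : D} {a b : E} (ha : P.obj x = a) (hb : P.obj y = b)
    (g : a ≅ b) : ∃ e : x ≅ y, P.map e.hom ≍ g.hom := by
  subst ha hb
  obtain ⟨f, hf⟩ := (hP.map_bijective x y).2 g.hom
  obtain ⟨f', hf'⟩ := (hP.map_bijective y x).2 g.inv
  exact ⟨⟨f, f', (hP.map_bijective _ _).1 (by simp [hf, hf']),
    (hP.map_bijective _ _).1 (by simp [hf, hf'])⟩, heq_of_eq hf⟩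

end CatIso

/-! ### The extension restricts to the given 2-functor -/

section RanConst

variable {C : Type u} [Bicategory.{v, v} C] [Strict C] (F : StrictPseudofunctor C Cat.{v, v})

/-- The comparison of a 2-functor with the restriction of its extension to 2-pro-objects. -/
def toRan : F ⟶ (c C).comp (ran F) := by
  have h {A A' : C} (f : A ⟶ A') : (F.map f).toFunctor ⋙ constSec F A' =
      constSec F A ⋙ ranMap F ((c C).map f) :=
    CatIso.cancel_right catIso_ofSec ((yon_precomp f).trans
      (congrArg (constSec F A ⋙ ·) (ranMap_comp_ofSec F ((c C).map f)).symm))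
  refine natMk F ((c C).comp (ran F)) (constSec F) h (fun {A A' f f'} α x => ?_)
  exact catIso_ofSec.map_injective_heq (Functor.congr_obj (h f) x) (Functor.congr_obj (h f') x)
    ((yon_map₂_heq α x).trans (ofSec_map_ranMap₂_heq F ((c C).map₂ α) _).symm)

/-- A section over the one-object 2-category amounts to its value, so the components `constSec F A`
of `toRan F` are isomorphisms, and a 2-natural transformation with invertible components is
invertible. -/
theorem nonempty_comp_ran_iso : Nonempty ((c C).comp (ran F) ≅ F) := by
  choose Q h₁ h₂ using catIso_constSec F
  exact ⟨(twoNatIso (toRan F) (fun A => (Q A).toCatHom) (fun A => Cat.Hom.ext (h₁ A))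
    (fun A => Cat.Hom.ext (h₂ A))).symm⟩

end RanConst

/-! ### Equality of pseudocones and of their morphisms -/

namespace Pseudocone

variable {I : Type u₁} [Bicategory.{w₁, v₁} I] {A : Type u₂} [Bicategory.{w₂, v₂} A] [Strict A]
  {X : StrictPseudofunctor Iᵒᵖ A} {Z : A}

lemma ext' {σ τ : Pseudocone X Z} (h : ∀ i, σ.π i = τ.π i)
    (h' : ∀ {i j : I} (u : i ⟶ j), (σ.πIso u).hom ≍ (τ.πIso u).hom) : σ = τ := by
  obtain ⟨p, e, _, _, _⟩ := σ
  obtain ⟨q, e', _, _, _⟩ := τ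
  obtain rfl : p = q := funext h
  have : @e = @e' := by
    funext i j u
    exact Iso.ext (eq_of_heq (h' u))
  subst this
  rfl

lemma hom_ext {σ τ : Pseudocone X Z} {f g : σ ⟶ τ} (h : ∀ i, Hom.app f i = Hom.app g i) :
    f = g :=
  Hom.ext (funext h)

lemma hom_heq {σ τ σ' τ' : Pseudocone X Z} (hσ : σ = σ') (hτ : τ = τ') {f : σ ⟶ τ}
    {g : σ' ⟶ τ'} (h : ∀ i, Hom.app f i ≍ Hom.app g i) : f ≍ g := by
  subst hσ hτ
  exact heq_of_eq (hom_ext fun i => eq_of_heq (h i))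

lemma πIso_id_heq (σ : Pseudocone X Z) (i : I) : (σ.πIso (𝟙 i)).hom ≍ 𝟙 (σ.π i) := by
  rw [σ.πIso_id]
  exact eqToHom_heq _ rfl

lemma πIso_comp_heq (σ : Pseudocone X Z) {i j k : I} (u : i ⟶ j) (w : j ⟶ k) :
    (σ.πIso (u ≫ w)).hom ≍ (σ.πIso u).hom ≫ (σ.πIso w).hom ▷ X.map u.op := by
  rw [σ.πIso_comp, ← Category.assoc]
  exact comp_eqToHom_heq _ _

lemma precompose_πIso_heq {T : A} (σ : Pseudocone X T) (f : Z ⟶ T) {i j : I} (u : i ⟶ j) :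
    (((σ.precompose Z).obj f).πIso u).hom ≍ f ◁ (σ.πIso u).hom :=
  trans_eqToIso_heq _ (Strict.assoc _ _ _).symm

lemma map_πIso_heq {A' : Type u₃} [Bicategory.{w₃, v₃} A'] [Strict A'] (σ : Pseudocone X Z)
    (H : StrictPseudofunctor A A') {i j : I} (u : i ⟶ j) :
    ((σ.map H).πIso u).hom ≍ H.map₂ (σ.πIso u).hom :=
  trans_eqToIso_heq _ (H.map_comp _ _)

end Pseudocone

lemma isPseudolimit_iff {I : Type u₁} [Bicategory.{w₁, v₁} I] {A : Type u₂}
    [Bicategory.{w₂, v₂} A] [Strict A] {X : StrictPseudofunctor Iᵒᵖ A} {T : A}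
    (σ : Pseudocone X T) : σ.IsPseudolimit ↔ ∀ Z, CatIso (σ.precompose Z) := Iff.rfl

/-! ### Sections of a diagram of categories of arrows are pseudocones -/

section Represented

variable {I : Type v} [Bicategory.{v, v} I] {A : Type u₂} [Bicategory.{w₂, v₂} A] [Strict A]
  {G : StrictPseudofunctor Iᵒᵖ Cat.{v, v}} {Y : StrictPseudofunctor Iᵒᵖ A} {Z : A}

/-- Functors from the categories `G i` to the categories of arrows `Z ⟶ Y i`, which are strictly
2-natural in `i`. -/
structure HomNat (G : StrictPseudofunctor Iᵒᵖ Cat.{v, v}) (Y : StrictPseudofunctor Iᵒᵖ A)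
    (Z : A) where
  app (i : I) : G.obj (op i) ⥤ (Z ⟶ Y.obj (op i))
  nat {i j : I} (u : i ⟶ j) : (G.map u.op).toFunctor ⋙ app i =
    app j ⋙ Bicategory.postcomp Z (Y.map u.op)
  nat₂ {i j : I} {u w : i ⟶ j} (α : u ⟶ w) (x : G.obj (op j)) :
    (app i).map (ap(G.map₂ (Bicategory.Opposite.op2 α)) x) ≍
      (app j).obj x ◁ Y.map₂ (Bicategory.Opposite.op2 α)

variable (e : HomNat G Y Z)

lemma HomNat.nat_obj {i j : I} (u : i ⟶ j) (x : G.obj (op j)) :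
    (e.app i).obj (ob(G.map u.op) x) = (e.app j).obj x ≫ Y.map u.op :=
  Functor.congr_obj (e.nat u) x

lemma HomNat.nat_map {i j : I} (u : i ⟶ j) {x y : G.obj (op j)} (p : x ⟶ y) :
    (e.app i).map (mp(G.map u.op) p) ≍ (e.app j).map p ▷ Y.map u.op :=
  map_heq_of_eq (e.nat u) p

/-- The pseudocone given by a section. -/
def HomNat.pseudocone (s : Sec G) : Pseudocone Y Z where
  π i := (e.app i).obj (s.pt i)
  πIso {i j} u := (e.app i).mapIso (s.iso u) ≪≫ eqToIso (e.nat_obj u (s.pt j))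
  πIso_id i := by
    refine eq_of_heq ((mapIso_trans_eqToIso_heq _ _ _).trans ?_)
    refine (map_heq _ rfl (obj_id G _ _) (s.iso_id i)).trans ?_
    exact (functor_map_id_heq _ _).trans (eqToHom_heq _ rfl).symm
  πIso_comp {i j k} u w := by
    rw [← Category.assoc]
    refine eq_of_heq ((mapIso_trans_eqToIso_heq _ _ _).trans (HEq.trans ?_
      (comp_eqToHom_heq _ _).symm))
    refine (map_heq _ rfl (obj_comp G _ _ _) (s.iso_comp u w)).trans ?_
    refine (functor_map_comp_heq _ _ _).trans ?_
    refine comp_heq rfl (e.nat_obj u _) ?_ (mapIso_trans_eqToIso_heq _ _ _).symm ?_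
    · exact (e.nat_obj u _).trans (congrArg (· ≫ Y.map u.op) (e.nat_obj w _))
    · exact (e.nat_map u _).trans (whiskerRight_heq rfl (e.nat_obj w _) rfl
        (mapIso_trans_eqToIso_heq _ _ _).symm)
  πIso_naturality {i j u w} α := by
    refine eq_of_heq (HEq.trans ?_ (mapIso_trans_eqToIso_heq _ _ _).symm)
    refine HEq.trans ?_ (heq_of_eq (congrArg _ (s.iso_map₂ α)))
    refine HEq.trans ?_ (functor_map_comp_heq _ _ _).symm
    exact comp_heq rfl (e.nat_obj _ _).symm (e.nat_obj _ _).symm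
      (mapIso_trans_eqToIso_heq _ _ _) (e.nat₂ α _).symm

lemma HomNat.pseudocone_πIso_heq (s : Sec G) {i j : I} (u : i ⟶ j) :
    ((e.pseudocone s).πIso u).hom ≍ (e.app i).map (s.iso u).hom :=
  trans_eqToIso_heq _ (e.nat_obj u (s.pt j))

/-- The pseudocones given by sections, as a functor. -/
def HomNat.functor : Sec G ⥤ Pseudocone Y Z where
  obj s := e.pseudocone s
  map {s t} f :=
    { app := fun i => (e.app i).map (Sec.Hom.app f i)
      naturality := fun {i j} u => by
        refine eq_of_heq ?_
        refine (comp_heq rfl rfl (e.nat_obj u _).symm HEq.rfl (e.pseudocone_πIso_heq t u)).trans ?_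
        refine HEq.trans ?_ (comp_heq rfl (e.nat_obj u _) (e.nat_obj u _)
          (e.pseudocone_πIso_heq s u).symm (e.nat_map u _))
        refine (functor_map_comp_heq _ _ _).symm.trans (HEq.trans ?_ (functor_map_comp_heq _ _ _))
        exact heq_of_eq (congrArg _ (Sec.Hom.naturality f u)) }
  map_id _ := Pseudocone.hom_ext fun _ => CategoryTheory.Functor.map_id _ _
  map_comp _ _ := Pseudocone.hom_ext fun _ => CategoryTheory.Functor.map_comp _ _ _

/-- The `e.app i` are isomorphisms and strictly 2-natural, so each datum of a pseudocone lifts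
uniquely to a datum of a section, and each law of a section can be checked after applying the
injective `e.app i`. -/
lemma HomNat.catIso_functor (h : ∀ i, CatIso (e.app i)) : CatIso e.functor := by
  refine catIso_of_bijective ⟨fun s t hst => ?_, fun σ => ?_⟩ fun s t => ⟨fun f g hfg => ?_,
    fun g => ?_⟩
  · have hp (i : I) : s.pt i = t.pt i :=
      (h i).obj_bijective.1 (congrArg (fun σ : Pseudocone Y Z => σ.π i) hst)
    refine Sec.ext' hp (fun {i j} u => (h i).map_injective_heq (hp i) (by rw [hp j]) ?_)
    refine (e.pseudocone_πIso_heq s u).symm.trans (HEq.trans ?_ (e.pseudocone_πIso_heq t u))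
    change e.pseudocone s = e.pseudocone t at hst
    rw [hst]
  · choose p hp using fun i => (h i).obj_bijective.2 (σ.π i)
    have hp' {i j : I} (u : i ⟶ j) : (e.app i).obj (ob(G.map u.op) (p j)) = σ.π j ≫ Y.map u.op :=
      (e.nat_obj u (p j)).trans (by rw [hp j])
    choose q hq using fun {i j : I} (u : i ⟶ j) =>
      (h i).exists_iso_heq (x := p i) (y := ob(G.map u.op) (p j)) (hp i) (hp' u) (σ.πIso u)
    refine ⟨
      { pt := p
        iso := q
        iso_id := fun i => (h i).map_injective_heq rfl (obj_id G _ _) ?_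
        iso_comp := fun {i j k} u w => (h i).map_injective_heq rfl (obj_comp G _ _ _) ?_
        iso_map₂ := fun {i j u w} α => ((h i).map_bijective _ _).1 (eq_of_heq ?_) },
      Pseudocone.ext' hp (fun u => (e.pseudocone_πIso_heq _ u).trans (hq u))⟩
    · exact (hq _).trans ((σ.πIso_id_heq i).trans ((id_heq (hp i).symm).trans
        (functor_map_id_heq _ _).symm))
    · refine (hq _).trans ((σ.πIso_comp_heq u w).trans (HEq.trans ?_
        (functor_map_comp_heq _ _ _).symm))
      refine comp_heq (hp i).symm (hp' u).symm ?_ (hq u).symm ?_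
      · exact (congrArg (· ≫ Y.map u.op) (hp' w).symm).trans (e.nat_obj u _).symm
      · exact (whiskerRight_heq (hp j).symm (hp' w).symm rfl (hq w).symm).trans
          (e.nat_map u _).symm
    · refine (functor_map_comp_heq _ _ _).trans (HEq.trans ?_ (hq w).symm)
      refine HEq.trans ?_ (heq_of_eq (σ.πIso_naturality α))
      refine comp_heq (hp i) (hp' u) (hp' w) (hq u) ?_
      exact (e.nat₂ α _).trans (whiskerLeft_heq (hp j) rfl rfl HEq.rfl)
  · exact Sec.hom_ext fun i => ((h i).map_bijective _ _).1
      (congrArg (fun k => Pseudocone.Hom.app k i) hfg)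
  · choose f hf using fun i => ((h i).map_bijective _ _).2 (Pseudocone.Hom.app g i)
    refine ⟨⟨f, fun {i j} u => ((h i).map_bijective _ _).1 (eq_of_heq ?_)⟩,
      Pseudocone.hom_ext hf⟩
    refine (functor_map_comp_heq _ _ _).trans (HEq.trans ?_ (functor_map_comp_heq _ _ _).symm)
    refine (comp_heq rfl rfl (e.nat_obj u _) (heq_of_eq (hf i))
      (e.pseudocone_πIso_heq t u).symm).trans ?_
    refine (heq_of_eq (Pseudocone.Hom.naturality g u)).trans ?_
    refine comp_heq rfl (e.nat_obj u _).symm (e.nat_obj u _).symm (e.pseudocone_πIso_heq s u) ?_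
    refine HEq.trans ?_ (e.nat_map u _).symm
    exact whiskerRight_heq rfl rfl rfl (heq_of_eq (hf j).symm)

end Represented

/-! ### A 2-pro-object is the pseudolimit of its diagram -/

section CanonicalCone

variable {C : Type u} [Bicategory.{v, v} C] [Strict C]

/-- The arrows from a 2-pro-object to the images of the objects of a diagram in `C`. -/
def homNatProYon {I : Type v} [Bicategory.{v, v} I] (D : StrictPseudofunctor Iᵒᵖ C) (X : Pro C) :
    HomNat (D.comp (L (Pro.diagram X))) (D.comp (c C)) X where
  app i := proYon X (D.obj (op i))
  nat u := proYon_postcomp X (D.map u.op)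
  nat₂ α x := proYon_map₂_heq X (D.map₂ (Bicategory.Opposite.op2 α)) x

/-- The pseudocone which exhibits a 2-pro-object as the pseudolimit of its diagram. -/
def canonicalCone (X : Pro C) : Pseudocone ((Pro.diagram X).comp (c C)) X :=
  (homNatProYon (Pro.diagram X) X).pseudocone (univSec (Pro.diagram X))

lemma proYon_precomp_obj {X Y : Pro C} (f : X ⟶ Y) {A : C} (m : (L (Pro.diagram Y)).obj A) :
    (proYon X A).obj (ob(TwoNat.app (ph f) A) m) = f ≫ (proYon Y A).obj m :=
  Functor.congr_obj (proYon_precomp f A) m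

lemma proYon_precomp_map {X Y : Pro C} (f : X ⟶ Y) {A : C} {m m' : (L (Pro.diagram Y)).obj A}
    (p : m ⟶ m') : (proYon X A).map (mp(TwoNat.app (ph f) A) p) ≍ f ◁ (proYon Y A).map p :=
  map_heq_of_eq (proYon_precomp f A) p

/-- An arrow `Z ⟶ X` is a transformation from the `L` of `X` to the `L` of `Z`, hence a section of
the latter over the diagram of `X`. Its values lie in categories isomorphic by Yoneda to those of
the arrows from `Z` to the objects `c (X i)`, so it is a pseudocone with vertex `Z`. This composite
of isomorphisms is composition with the canonical cone, by naturality of `proYon` in the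
2-pro-object. -/
theorem isPseudolimit_canonicalCone (X : Pro C) : (canonicalCone X).IsPseudolimit := by
  refine (isPseudolimit_iff _).2 fun Z => ?_
  have h (f : Z ⟶ X) : ((canonicalCone X).precompose Z).obj f =
      (homNatProYon (Pro.diagram X) Z).functor.obj (toSec.obj (ph f)) :=
    Pseudocone.ext' (fun i => (proYon_precomp_obj f _).symm) (fun {i j} u => by
      refine (Pseudocone.precompose_πIso_heq _ _ _).trans ?_
      refine HEq.trans ?_ ((homNatProYon (Pro.diagram X) Z).pseudocone_πIso_heq
        (toSec.obj (ph f)) u).symm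
      refine (whiskerLeft_heq rfl rfl ?_
        ((homNatProYon (Pro.diagram X) X).pseudocone_πIso_heq _ u)).trans ?_
      · exact ((homNatProYon (Pro.diagram X) X).nat_obj u _).symm
      refine (proYon_precomp_map f _).symm.trans ?_
      exact map_heq (proYon Z _) rfl (nat_obj (ph f) _ _)
        (Sec.mapObj_iso_heq (precomp₁ (Pro.diagram X) (ph f)) _ u).symm)
  have e : toPro Z X ⋙ (canonicalCone X).precompose Z =
      toSec ⋙ (homNatProYon (Pro.diagram X) Z).functor :=
    CategoryTheory.Functor.hext (fun θ => h ((toPro Z X).obj θ)) (fun θ θ' ρ =>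
      Pseudocone.hom_heq (h ((toPro Z X).obj θ)) (h ((toPro Z X).obj θ')) (fun i =>
        (proYon_whiskerRight_heq ((toPro Z X).map ρ) _ _).symm))
  refine CatIso.of_comp_left ?_ (catIso_toPro Z X)
  rw [e]
  exact catIso_toSec.comp (HomNat.catIso_functor _ fun i => catIso_proYon Z _)

end CanonicalCone

/-! ### Restriction along `c` is locally an isomorphism -/

section Evaluation

variable {C : Type u} [Bicategory.{v, v} C] [Strict C]
  (K : StrictPseudofunctor (Pro C) Cat.{v, v})

lemma evalAt_postcomp {B : Type u₁} [Bicategory.{w₁, v₁} B]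
    (F : StrictPseudofunctor B Cat.{v₂, u₂}) {A E E' : B} (x : F.obj A) (g : E ⟶ E') :
    Bicategory.postcomp A g ⋙ evalAt F x E' = evalAt F x E ⋙ (F.map g).toFunctor :=
  CategoryTheory.Functor.hext (fun f => obj_comp F f g x)
    (fun _ _ α => map₂_whiskerRight_app_heq F α g x)

/-- The evaluation of a 2-functor `K` at the arrows from a 2-pro-object to the objects of `C`. -/
def evObj (X : Pro C) (t : K.obj X) : L (Pro.diagram X) ⟶ (c C).comp K :=
  natMk (L (Pro.diagram X)) ((c C).comp K)
    (fun A => proYon X A ⋙ evalAt K t ((c C).obj A))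
    (fun {A A'} f => (congrArg (· ⋙ evalAt K t ((c C).obj A')) (proYon_postcomp X f)).trans
      (congrArg (proYon X A ⋙ ·) (evalAt_postcomp K t ((c C).map f))))
    (fun {A A' f f'} α m => (map_heq (evalAt K t ((c C).obj A'))
      (Functor.congr_obj (proYon_postcomp X f) m) (Functor.congr_obj (proYon_postcomp X f') m)
      (proYon_map₂_heq X α m)).trans (map₂_whiskerLeft_app_heq K _ _ t))

/-- The functor from the value of a 2-functor at a 2-pro-object to the 2-natural
transformations into its restriction to `C`. -/
def ev (X : Pro C) : K.obj X ⥤ (L (Pro.diagram X) ⟶ (c C).comp K) where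
  obj t := evObj K X t
  map {t t'} p := modMk
    (fun A =>
      { app := fun m => mp(K.map ((proYon X A).obj m)) p
        naturality := fun m m' q =>
          (NatTrans.naturality (K.map₂ ((proYon X A).map q)).toNatTrans p).symm })
    (fun {A A'} f m => (map_heq_of_eq (congrArg (fun g => (K.map g).toFunctor)
      (Functor.congr_obj (proYon_postcomp X f) m)) p).trans (map_comp_heq K _ _ p))
  map_id t := modif_ext fun A m => CategoryTheory.Functor.map_id _ _
  map_comp p q := modif_ext fun A m => CategoryTheory.Functor.map_comp _ _ _

/-- Sections do not depend on the bracketing of a composite. -/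
def secAssoc {I : Type v} [Bicategory.{v, v} I] {A : Type u₁} [Bicategory.{w₁, v₁} A]
    {B : Type u₂} [Bicategory.{w₂, v₂} B] (D : StrictPseudofunctor Iᵒᵖ A)
    (F : StrictPseudofunctor A B) (K : StrictPseudofunctor B Cat.{v, v}) :
    Sec ((D.comp F).comp K) ⥤ Sec (D.comp (F.comp K)) where
  obj s := ⟨s.pt, s.iso, s.iso_id, s.iso_comp, s.iso_map₂⟩
  map f := ⟨f.app, f.naturality⟩
  map_id _ := rfl
  map_comp _ _ := rfl

lemma catIso_secAssoc {I : Type v} [Bicategory.{v, v} I] {A : Type u₁} [Bicategory.{w₁, v₁} A]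
    {B : Type u₂} [Bicategory.{w₂, v₂} B] (D : StrictPseudofunctor Iᵒᵖ A)
    (F : StrictPseudofunctor A B) (K : StrictPseudofunctor B Cat.{v, v}) :
    CatIso (secAssoc D F K) :=
  ⟨{ obj := fun s => ⟨s.pt, s.iso, s.iso_id, s.iso_comp, s.iso_map₂⟩
     map := fun f => ⟨f.app, f.naturality⟩
     map_id := fun _ => rfl
     map_comp := fun _ _ => rfl }, rfl, rfl⟩

/-- Preservation of the canonical pseudolimit identifies `K.obj X` with the sections of `K ∘ c` over
the diagram of `X`, and these are the transformations from the `L` of `X` to `K ∘ c`. The functor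
`ev` is this composite, because `toSec` evaluates at the universal section, from which the canonical
cone is built. -/
theorem catIso_ev (hK : PreservesCofilteredPseudolimits.{v} K) (X : Pro C) : CatIso (ev K X) := by
  have h := (isPseudolimit_iff_catIso_secOf _).1
    (hK _ _ _ (canonicalCone X) (isPseudolimit_canonicalCone X))
  have h' (t : K.obj X) : (secAssoc (Pro.diagram X) (c C) K).obj
      ((secOf ((canonicalCone X).map K)).obj t) = toSec.obj (evObj K X t) :=
    Sec.ext' (fun _ => rfl) (fun {i j} u => by
      refine HEq.trans (b := ap(K.map₂ ((proYon X _).map ((univSec (Pro.diagram X)).iso u).hom)) t)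
        ?_ (Sec.mapObj_iso_heq (precomp₁ (Pro.diagram X) (evObj K X t))
          (univSec (Pro.diagram X)) u).symm
      have h₁ := (homNatProYon (Pro.diagram X) X).nat_obj u ((univSec (Pro.diagram X)).pt j)
      refine (cat_app_heq rfl (K.map_comp _ _).symm
        (Pseudocone.map_πIso_heq (canonicalCone X) K u) t).trans ?_
      exact map₂_app_heq K rfl h₁.symm
        ((homNatProYon (Pro.diagram X) X).pseudocone_πIso_heq (univSec (Pro.diagram X)) u) rfl)
  have e : secOf ((canonicalCone X).map K) ⋙ secAssoc (Pro.diagram X) (c C) K =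
      ev K X ⋙ toSec :=
    CategoryTheory.Functor.hext h' (fun t t' p => Sec.hom_heq (h' t) (h' t') (fun _ => HEq.rfl))
  exact CatIso.of_comp_right (e ▸ h.comp (catIso_secAssoc _ _ _)) catIso_toSec

/-- 2-naturality of `ev` in the 2-pro-object: at an element `m`, both sides are the value at `t` of
`K` applied to the composite of `f` with the arrow that `m` names. -/
lemma evObj_precomp {X Y : Pro C} (f : X ⟶ Y) (t : K.obj X) :
    evObj K Y (ob(K.map f) t) = ph f ≫ evObj K X t := by
  refine TwoNat.ext (funext fun A => Cat.Hom.ext (CategoryTheory.Functor.hext (fun m => ?_)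
    (fun m m' p => ?_)))
  · exact (obj_comp K f _ t).symm.trans
      (congrArg (fun g => ob(K.map g) t) (proYon_precomp_obj f m).symm)
  · refine (map₂_whiskerLeft_app_heq K f _ t).symm.trans ?_
    exact map₂_app_heq K (proYon_precomp_obj f m).symm (proYon_precomp_obj f m').symm
      (proYon_precomp_map f p).symm rfl

lemma ev_precomp {X Y : Pro C} (f : X ⟶ Y) :
    (K.map f).toFunctor ⋙ ev K Y = ev K X ⋙ Bicategory.precomp _ (ph f) :=
  CategoryTheory.Functor.hext (evObj_precomp K f) (fun t t' p =>
    modif_heq_ext (evObj_precomp K f t) (evObj_precomp K f t') (fun A m =>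
      (map_comp_heq K f _ p).symm.trans (map_heq_of_eq (congrArg (fun g => (K.map g).toFunctor)
        (proYon_precomp_obj f m).symm) p)))

lemma ev_map₂_heq {X Y : Pro C} {f f' : X ⟶ Y} (η : f ⟶ f') (t : K.obj X) :
    (ev K Y).map (ap(K.map₂ η) t) ≍ pm η ▷ evObj K X t :=
  modif_heq_ext (evObj_precomp K f t) (evObj_precomp K f' t) (fun A m => by
    refine (map₂_whiskerRight_app_heq K η _ t).symm.trans ?_
    exact map₂_app_heq K (proYon_precomp_obj f m).symm (proYon_precomp_obj f' m).symm
      (proYon_whiskerRight_heq η A m).symm rfl)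

variable {K} {H : StrictPseudofunctor (Pro C) Cat.{v, v}}

lemma evObj_postcomp (ψ : H ⟶ K) (X : Pro C) (t : H.obj X) :
    evObj K X (ob(TwoNat.app ψ X) t) = evObj H X t ≫ precomp₁ (c C) ψ :=
  TwoNat.ext (funext fun _ => Cat.Hom.ext (CategoryTheory.Functor.hext
    (fun _ => (nat_obj ψ _ t).symm) (fun _ _ _ => (nat_map₂_heq ψ _ t).symm)))

lemma ev_postcomp (ψ : H ⟶ K) (X : Pro C) : (TwoNat.app ψ X).toFunctor ⋙ ev K X =
    ev H X ⋙ Bicategory.postcomp _ (precomp₁ (c C) ψ) :=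
  CategoryTheory.Functor.hext (evObj_postcomp ψ X) (fun t t' p =>
    modif_heq_ext (evObj_postcomp ψ X t) (evObj_postcomp ψ X t') (fun _ _ =>
      (nat_map_heq ψ _ p).symm))

lemma ev_modif_heq {ψ ψ' : H ⟶ K} (ρ : ψ ⟶ ψ') (X : Pro C) (t : H.obj X) :
    (ev K X).map (ap(Modif.app ρ X) t) ≍ evObj H X t ◁ precomp₂ (c C) ρ :=
  modif_heq_ext (evObj_postcomp ψ X t) (evObj_postcomp ψ' X t) (fun _ _ => (modif_heq ρ _ t).symm)

/-- Here `θ` need not be a restriction. At the generic element both sides reduce to the naturality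
of `θ` along `𝟙 A`; this is why the extension of `θ` built below restricts to `θ`. -/
lemma evObj_const (θ : (c C).comp H ⟶ (c C).comp K) (A : C) (t : H.obj ((c C).obj A)) :
    evObj K ((c C).obj A) (ob(TwoNat.app θ A) t) = evObj H ((c C).obj A) t ≫ θ := by
  have e : (proYon ((c C).obj A) A).obj (gen A) = (c C).map (𝟙 A) := proYon_const (𝟙 A)
  exact const_ext ((congrArg (fun g => ob(K.map g) (ob(TwoNat.app θ A) t)) e).trans
    ((nat_obj θ (𝟙 A) t).symm.trans
      (congrArg (fun g => ob(TwoNat.app θ A) (ob(H.map g) t)) e.symm)))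

lemma ev_const (θ : (c C).comp H ⟶ (c C).comp K) (A : C) :
    (TwoNat.app θ A).toFunctor ⋙ ev K ((c C).obj A) =
      ev H ((c C).obj A) ⋙ Bicategory.postcomp _ θ :=
  CategoryTheory.Functor.hext (evObj_const θ A) (fun t t' p =>
    const_heq (evObj_const θ A t) (evObj_const θ A t') (by
      have e : (proYon ((c C).obj A) A).obj (gen A) = (c C).map (𝟙 A) := proYon_const (𝟙 A)
      refine HEq.trans (map_heq_of_eq (congrArg (fun g => (K.map g).toFunctor) e) _) ?_
      refine (nat_map_heq θ (𝟙 A) p).symm.trans ?_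
      exact map_heq_of_eq (congrArg (fun g => (H.map g).toFunctor ⋙ (TwoNat.app θ A).toFunctor)
        e.symm) p))

lemma ev_const_modif_heq {θ θ' : (c C).comp H ⟶ (c C).comp K} (κ : θ ⟶ θ') (A : C)
    (t : H.obj ((c C).obj A)) :
    (ev K ((c C).obj A)).map (ap(Modif.app κ A) t) ≍ evObj H ((c C).obj A) t ◁ κ :=
  const_heq (evObj_const θ A t) (evObj_const θ' A t) (by
    have e : (proYon ((c C).obj A) A).obj (gen A) = (c C).map (𝟙 A) := proYon_const (𝟙 A)
    refine HEq.trans (map_heq_of_eq (congrArg (fun g => (K.map g).toFunctor) e) _) ?_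
    refine (modif_heq κ (𝟙 A) t).symm.trans ?_
    exact app_heq (Cat.Hom₂.toNatTrans (Modif.app κ A))
      (congrArg (fun g => ob(H.map g) t) e.symm))

/-- Restriction to `C` is fully faithful on 2-natural transformations into a 2-functor which
preserves 2-cofiltered pseudolimits. -/
theorem catIso_mapFunctor_precomp (H : StrictPseudofunctor (Pro C) Cat.{v, v})
    (hK : PreservesCofilteredPseudolimits.{v} K) :
    CatIso ((precomp Cat.{v, v} (c C)).mapFunctor H K) := by
  have hev := catIso_ev K hK
  choose Q hQ₁ hQ₂ using hev
  refine catIso_of_bijective ⟨fun ψ ψ' h => ?_, fun θ => ?_⟩ fun ψ ψ' => ⟨fun ρ ρ' h => ?_,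
    fun κ => ?_⟩
  -- The functor `ev K X` can be cancelled, and it turns the component of `ψ` at `X` into
  -- post-composition with the restriction of `ψ`.
  · refine TwoNat.ext (funext fun X => Cat.Hom.ext ((catIso_ev K hK X).cancel_right ?_))
    rw [ev_postcomp, ev_postcomp]
    exact congrArg (fun θ => ev H X ⋙ Bicategory.postcomp _ θ) h
  -- Naturality of `ev` leaves no choice: the component at `X` must be post-composition with `θ`,
  -- transported along the evaluations. Only the evaluation of `K` has to be inverted, so nothing is
  -- asked of `H`.
  · let P (X : Pro C) : H.obj X ⥤ K.obj X := ev H X ⋙ Bicategory.postcomp _ θ ⋙ Q X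
    have hP (X : Pro C) : P X ⋙ ev K X = ev H X ⋙ Bicategory.postcomp _ θ :=
      congrArg (fun R => (ev H X ⋙ Bicategory.postcomp _ θ) ⋙ R) (hQ₂ X)
    have hP₁ (X : Pro C) (t : H.obj X) : evObj K X ((P X).obj t) = evObj H X t ≫ θ :=
      Functor.congr_obj (hP X) t
    have hnat {X Y : Pro C} (f : X ⟶ Y) : (H.map f).toFunctor ⋙ P Y = P X ⋙ (K.map f).toFunctor := by
      refine (catIso_ev K hK Y).cancel_right ?_
      refine (congrArg ((H.map f).toFunctor ⋙ ·) (hP Y)).trans ?_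
      refine (congrArg (· ⋙ Bicategory.postcomp _ θ) (ev_precomp H f)).trans ?_
      refine (congrArg (ev H X ⋙ ·) (precomp_postcomp (ph f) θ)).trans ?_
      refine (congrArg (· ⋙ Bicategory.precomp _ (ph f)) (hP X)).symm.trans ?_
      exact (congrArg (P X ⋙ ·) (ev_precomp K f)).symm
    let ψ : H ⟶ K := natMk H K P hnat (fun {X Y f f'} α t => by
      refine (catIso_ev K hK Y).map_injective_heq (Functor.congr_obj (hnat f) t)
        (Functor.congr_obj (hnat f') t) ?_
      refine (map_heq_of_eq (hP Y) _).trans ?_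
      refine HEq.trans ?_ (ev_map₂_heq K α _).symm
      refine (whiskerRight_heq (evObj_precomp H f t) (evObj_precomp H f' t) rfl
        (ev_map₂_heq H α t)).trans ?_
      refine (whiskerRight_comp_heq (pm α) (evObj H X t) θ).symm.trans ?_
      exact whiskerRight_heq rfl rfl (hP₁ X t).symm HEq.rfl)
    refine ⟨ψ, TwoNat.ext (funext fun A => Cat.Hom.ext
      ((catIso_ev K hK ((c C).obj A)).cancel_right ?_))⟩
    exact (hP _).trans (ev_const θ A).symm
  · refine modif_ext fun X t => ((catIso_ev K hK X).map_bijective _ _).1 (eq_of_heq ?_)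
    refine (ev_modif_heq ρ X t).trans (HEq.trans ?_ (ev_modif_heq ρ' X t).symm)
    exact heq_of_eq (congrArg (evObj H X t ◁ ·) h)
  -- For modifications, the component at `t` is the unique arrow that `ev K X` sends to the
  -- whiskering of `κ` with `evObj H X t`.
  · choose r hr using fun (X : Pro C) (t : H.obj X) =>
      (catIso_ev K hK X).exists_map_heq (evObj_postcomp ψ X t) (evObj_postcomp ψ' X t)
        (evObj H X t ◁ κ)
    refine ⟨modMk (fun X =>
      { app := r X
        naturality := fun t t' p => ((catIso_ev K hK X).map_bijective _ _).1 (eq_of_heq ?_) })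
        (fun {X Y} f t => ?_), modif_ext fun A t => ?_⟩
    · refine (functor_map_comp_heq _ _ _).trans (HEq.trans ?_ (functor_map_comp_heq _ _ _).symm)
      refine (comp_heq (evObj_postcomp ψ X t) (evObj_postcomp ψ X t') (evObj_postcomp ψ' X t')
        (map_heq_of_eq (ev_postcomp ψ X) p) (hr X t')).trans ?_
      refine HEq.trans ?_ (comp_heq (evObj_postcomp ψ X t) (evObj_postcomp ψ' X t)
        (evObj_postcomp ψ' X t') (hr X t) (map_heq_of_eq (ev_postcomp ψ' X) p)).symm
      exact heq_of_eq (whisker_exchange _ _).symm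
    · refine (catIso_ev K hK Y).map_injective_heq (nat_obj ψ f t) (nat_obj ψ' f t) ?_
      refine (hr Y _).trans (HEq.trans ?_ (map_heq_of_eq (ev_precomp K f) _).symm)
      refine (whiskerLeft_heq (evObj_precomp H f t) rfl rfl HEq.rfl).trans ?_
      refine (comp_whiskerLeft_heq (ph f) (evObj H X t) κ).trans ?_
      exact whiskerLeft_heq rfl (evObj_postcomp ψ X t).symm (evObj_postcomp ψ' X t).symm
        (hr X t).symm
    · refine ((catIso_ev K hK ((c C).obj A)).map_bijective _ _).1 (eq_of_heq ?_)
      exact (hr _ t).trans (ev_const_modif_heq κ A t).symm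

end Evaluation

/-! ### 2-filtered pseudocolimits of categories -/

namespace IsTwoFiltered

variable {I : Type u₁} [Bicategory.{w₁, v₁} I] [IsTwoFiltered I]

/-- The isomorphism given by the second axiom need not be `α`, but a further arrow given by the
third identifies the two. So every 2-cell becomes invertible after whiskering. -/
lemma exists_isIso {i j : I} {u v : i ⟶ j} (α : u ⟶ v) :
    ∃ (k : I) (w : j ⟶ k), IsIso (α ▷ w) := by
  obtain ⟨k, w, ⟨e⟩⟩ := exists_iso u v
  obtain ⟨l, w', h⟩ := exists_eq (α ▷ w) e.hom
  refine ⟨l, w ≫ w', ?_⟩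
  rw [Bicategory.whiskerRight_comp, h]
  infer_instance

lemma exists_isIso₂ {i i' j : I} {u v : i ⟶ j} (α : u ⟶ v) {u' v' : i' ⟶ j} (β : u' ⟶ v') :
    ∃ (k : I) (w : j ⟶ k), IsIso (α ▷ w) ∧ IsIso (β ▷ w) := by
  obtain ⟨k, w, h⟩ := exists_isIso α
  obtain ⟨l, w', h'⟩ := exists_isIso (β ▷ w)
  refine ⟨l, w ≫ w', ?_, ?_⟩ <;> rw [Bicategory.whiskerRight_comp] <;> infer_instance

lemma exists_square {i j k : I} (u : i ⟶ j) (v : i ⟶ k) :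
    ∃ (l : I) (p : j ⟶ l) (q : k ⟶ l), Nonempty (u ≫ p ≅ v ≫ q) := by
  obtain ⟨m, ⟨p⟩, ⟨q⟩⟩ := exists_cospan j k
  obtain ⟨l, r, ⟨e⟩⟩ := exists_iso (u ≫ p) (v ≫ q)
  exact ⟨l, p ≫ r, q ≫ r, ⟨(α_ _ _ _).symm ≪≫ e ≪≫ α_ _ _ _⟩⟩

end IsTwoFiltered

open IsTwoFiltered

namespace PseudoColim

variable {I : Type v} [Bicategory.{v, v} I] [Strict I] (F : StrictPseudofunctor I Cat.{v, v})

section Extension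

variable {F} {i j k l : I} {x : F.obj i} {y : F.obj j}

/-- The image of an arrow under the functor assigned to `p`. -/
def extend (p : k ⟶ l) {u : i ⟶ k} {v : j ⟶ k} (f : ob(F.map u) x ⟶ ob(F.map v) y) :
    ob(F.map (u ≫ p)) x ⟶ ob(F.map (v ≫ p)) y :=
  eqToHom (obj_comp F u p x) ≫ mp(F.map p) f ≫ eqToHom (obj_comp F v p y).symm

lemma extend_heq (p : k ⟶ l) {u : i ⟶ k} {v : j ⟶ k} (f : ob(F.map u) x ⟶ ob(F.map v) y) :
    extend p f ≍ mp(F.map p) f := by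
  rw [extend]; simp

/-- The compatibility of two arrows with two 2-cells. -/
def Sq {u u' : i ⟶ k} {v v' : j ⟶ k} (f : ob(F.map u) x ⟶ ob(F.map v) y)
    (f' : ob(F.map u') x ⟶ ob(F.map v') y) (σ : u ⟶ u') (τ : v ⟶ v') : Prop :=
  f ≫ ap(F.map₂ τ) y = ap(F.map₂ σ) x ≫ f'

lemma Sq.comp {u u' u'' : i ⟶ k} {v v' v'' : j ⟶ k} {f : ob(F.map u) x ⟶ ob(F.map v) y}
    {f' : ob(F.map u') x ⟶ ob(F.map v') y} {f'' : ob(F.map u'') x ⟶ ob(F.map v'') y}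
    {σ : u ⟶ u'} {τ : v ⟶ v'} {σ' : u' ⟶ u''} {τ' : v' ⟶ v''} (h : Sq f f' σ τ)
    (h' : Sq f' f'' σ' τ') : Sq f f'' (σ ≫ σ') (τ ≫ τ') := by
  rw [Sq] at *
  rw [map₂_comp_app, map₂_comp_app, ← Category.assoc, h, Category.assoc, h', Category.assoc]

lemma Sq.symm {u u' : i ⟶ k} {v v' : j ⟶ k} {f : ob(F.map u) x ⟶ ob(F.map v) y}
    {f' : ob(F.map u') x ⟶ ob(F.map v') y} {σ : u ≅ u'} {τ : v ≅ v'}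
    (h : Sq f f' σ.hom τ.hom) : Sq f' f σ.inv τ.inv := by
  rw [Sq] at *
  have hτ : ap(F.map₂ τ.hom) y ≫ ap(F.map₂ τ.inv) y = 𝟙 _ := by
    rw [← map₂_comp_app, Iso.hom_inv_id, map₂_id_app]
  have hσ : ap(F.map₂ σ.inv) x ≫ ap(F.map₂ σ.hom) x = 𝟙 _ := by
    rw [← map₂_comp_app, Iso.inv_hom_id, map₂_id_app]
  have h' := congrArg (fun g => ap(F.map₂ σ.inv) x ≫ g ≫ ap(F.map₂ τ.inv) y) h
  simp only [Category.assoc, hτ, Category.comp_id] at h'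
  rw [h', ← Category.assoc, hσ, Category.id_comp]

lemma Sq.of_heq {u u' : i ⟶ k} {v v' : j ⟶ k} (hu : u = u') (hv : v = v')
    {f : ob(F.map u) x ⟶ ob(F.map v) y} {f' : ob(F.map u') x ⟶ ob(F.map v') y} (h : f ≍ f') :
    Sq f f' (eqToHom hu) (eqToHom hv) := by
  subst hu hv h
  simp [Sq]

lemma Sq.extend {u u' : i ⟶ k} {v v' : j ⟶ k} {f : ob(F.map u) x ⟶ ob(F.map v) y}
    {f' : ob(F.map u') x ⟶ ob(F.map v') y} {σ : u ⟶ u'} {τ : v ⟶ v'} (h : Sq f f' σ τ)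
    (p : k ⟶ l) : Sq (extend p f) (extend p f') (σ ▷ p) (τ ▷ p) := by
  refine eq_of_heq ?_
  refine (comp_heq (obj_comp F _ _ _) (obj_comp F _ _ _) (obj_comp F _ _ _) (extend_heq p f)
    (map₂_whiskerRight_app_heq F _ _ _)).trans ?_
  refine HEq.trans ?_ (comp_heq (obj_comp F _ _ _) (obj_comp F _ _ _) (obj_comp F _ _ _)
    (map₂_whiskerRight_app_heq F _ _ _) (extend_heq p f')).symm
  exact (functor_map_comp_heq _ _ _).symm.trans
    ((heq_of_eq (congrArg _ h)).trans (functor_map_comp_heq _ _ _))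

lemma Sq.whisker {u : i ⟶ k} {v : j ⟶ k} (f : ob(F.map u) x ⟶ ob(F.map v) y) {p p' : k ⟶ l}
    (ρ : p ⟶ p') : Sq (PseudoColim.extend p f) (PseudoColim.extend p' f) (u ◁ ρ) (v ◁ ρ) := by
  refine eq_of_heq ?_
  refine (comp_heq (obj_comp F _ _ _) (obj_comp F _ _ _) (obj_comp F _ _ _) (extend_heq p f)
    (map₂_whiskerLeft_app_heq F _ _ _)).trans ?_
  refine HEq.trans ?_ (comp_heq (obj_comp F _ _ _) (obj_comp F _ _ _) (obj_comp F _ _ _)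
    (map₂_whiskerLeft_app_heq F _ _ _) (extend_heq p' f)).symm
  exact heq_of_eq (NatTrans.naturality (F.map₂ ρ).toNatTrans f)

lemma extend_extend_heq {m : I} (p : k ⟶ l) (r : l ⟶ m) {u : i ⟶ k} {v : j ⟶ k}
    (f : ob(F.map u) x ⟶ ob(F.map v) y) :
    PseudoColim.extend r (PseudoColim.extend p f) ≍ PseudoColim.extend (p ≫ r) f :=
  (extend_heq _ _).trans ((map_heq _ (obj_comp F _ _ _) (obj_comp F _ _ _)
    (extend_heq _ _)).trans ((map_comp_heq F _ _ _).symm.trans (extend_heq _ _).symm))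

end Extension

/-- A representative of an arrow in a 2-filtered pseudocolimit. -/
structure Germ {i : I} (x : F.obj i) {j : I} (y : F.obj j) : Type v where
  k : I
  u : i ⟶ k
  v : j ⟶ k
  f : ob(F.map u) x ⟶ ob(F.map v) y

/-! ### The calculus of germs -/

namespace Germ

variable {F} {i : I} {x : F.obj i} {j : I} {y : F.obj j}

lemma ext' {k : I} {u u' : i ⟶ k} {v v' : j ⟶ k} (hu : u = u') (hv : v = v')
    {f : ob(F.map u) x ⟶ ob(F.map v) y} {f' : ob(F.map u') x ⟶ ob(F.map v') y} (h : f ≍ f') :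
    (⟨k, u, v, f⟩ : Germ F x y) = ⟨k, u', v', f'⟩ := by
  subst hu hv h; rfl

/-- Two representatives are equivalent if they are identified, up to invertible 2-cells, at a later
index. -/
def Equivalent (a b : Germ F x y) : Prop :=
  ∃ (l : I) (p : a.k ⟶ l) (q : b.k ⟶ l) (σ : a.u ≫ p ≅ b.u ≫ q) (τ : a.v ≫ p ≅ b.v ≫ q),
    Sq (extend p a.f) (extend q b.f) σ.hom τ.hom

lemma Equivalent.refl (a : Germ F x y) : Equivalent a a :=
  ⟨a.k, 𝟙 _, 𝟙 _, Iso.refl _, Iso.refl _, Sq.of_heq rfl rfl HEq.rfl⟩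

lemma Equivalent.symm {a b : Germ F x y} (h : Equivalent a b) : Equivalent b a := by
  obtain ⟨l, p, q, σ, τ, h⟩ := h
  exact ⟨l, q, p, σ.symm, τ.symm, h.symm⟩

variable [IsTwoFiltered I]

lemma Equivalent.trans {a b c : Germ F x y} (h : Equivalent a b) (h' : Equivalent b c) :
    Equivalent a c := by
  obtain ⟨l, p, q, σ, τ, h⟩ := h
  obtain ⟨l', p', q', σ', τ', h'⟩ := h'
  -- The two comparisons share the index of `b`; the square `ρ` over it pastes them, and
  -- `Sq.whisker` makes the middle piece commute.
  obtain ⟨m, r, r', ⟨ρ⟩⟩ := exists_square q p'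
  refine ⟨m, p ≫ r, q' ≫ r', eqToIso (Strict.assoc _ _ _).symm ≪≫ whiskerRightIso σ r ≪≫
    eqToIso (Strict.assoc _ _ _) ≪≫ whiskerLeftIso b.u ρ ≪≫ eqToIso (Strict.assoc _ _ _).symm ≪≫
    whiskerRightIso σ' r' ≪≫ eqToIso (Strict.assoc _ _ _),
    eqToIso (Strict.assoc _ _ _).symm ≪≫ whiskerRightIso τ r ≪≫
    eqToIso (Strict.assoc _ _ _) ≪≫ whiskerLeftIso b.v ρ ≪≫ eqToIso (Strict.assoc _ _ _).symm ≪≫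
    whiskerRightIso τ' r' ≪≫ eqToIso (Strict.assoc _ _ _), ?_⟩
  refine (Sq.of_heq (Strict.assoc _ _ _).symm (Strict.assoc _ _ _).symm
    (extend_extend_heq _ _ _).symm).comp ((h.extend r).comp ?_)
  refine (Sq.of_heq (Strict.assoc _ _ _) (Strict.assoc _ _ _)
    (extend_extend_heq _ _ _)).comp ((Sq.whisker _ ρ.hom).comp ?_)
  refine (Sq.of_heq (Strict.assoc _ _ _).symm (Strict.assoc _ _ _).symm
    (extend_extend_heq _ _ _).symm).comp ((h'.extend r').comp ?_)
  exact Sq.of_heq (Strict.assoc _ _ _) (Strict.assoc _ _ _) (extend_extend_heq _ _ _)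

lemma Equivalent.of_extend (a : Germ F x y) {l : I} (p : a.k ⟶ l) :
    Equivalent ⟨l, a.u ≫ p, a.v ≫ p, extend p a.f⟩ a :=
  ⟨l, 𝟙 l, p, eqToIso (Strict.comp_id (a.u ≫ p)), eqToIso (Strict.comp_id (a.v ≫ p)),
    Sq.of_heq (Strict.comp_id (a.u ≫ p)) (Strict.comp_id (a.v ≫ p)) ((extend_heq _ _).trans (map_id_heq F _ _))⟩

/-- No invertibility of `σ` and `τ` is needed, since both become invertible at a later stage. This
is what lets `preEquiv_map₂` treat arbitrary 2-cells. -/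
lemma Equivalent.of_sq {k : I} {u u' : i ⟶ k} {v v' : j ⟶ k} {f : ob(F.map u) x ⟶ ob(F.map v) y}
    {f' : ob(F.map u') x ⟶ ob(F.map v') y} (σ : u ⟶ u') (τ : v ⟶ v') (h : Sq f f' σ τ) :
    Equivalent (⟨k, u, v, f⟩ : Germ F x y) ⟨k, u', v', f'⟩ := by
  obtain ⟨l, w, hσ, hτ⟩ := exists_isIso₂ σ τ
  exact ⟨l, w, w, asIso (σ ▷ w), asIso (τ ▷ w), h.extend w⟩

variable (x) in
/-- The representatives of arrows with domain `x`, up to equivalence. -/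
def Class (y : F.obj j) : Type v := Quot (Equivalent (x := x) (y := y))

lemma mk_eq_iff {a b : Germ F x y} :
    (Quot.mk _ a : Class x y) = Quot.mk _ b ↔ Equivalent a b := by
  refine ⟨fun h => ?_, fun h => Quot.sound h⟩
  have e : Equivalence (Equivalent (x := x) (y := y)) :=
    ⟨Equivalent.refl, Equivalent.symm, Equivalent.trans⟩
  exact (Quot.eqvGen_exact h).rec (fun _ _ h => h) (fun a => Equivalent.refl a)
    (fun _ _ _ h => h.symm) (fun _ _ _ _ _ h h' => h.trans h')

/-- Post-composition of representatives with an arrow. -/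
def post {y' : F.obj j} (g : y ⟶ y') (a : Germ F x y) : Germ F x y' :=
  ⟨a.k, a.u, a.v, a.f ≫ mp(F.map a.v) g⟩

lemma Sq.post {k : I} {u u' : i ⟶ k} {v v' : j ⟶ k} {f : ob(F.map u) x ⟶ ob(F.map v) y}
    {f' : ob(F.map u') x ⟶ ob(F.map v') y} {σ : u ⟶ u'} {τ : v ⟶ v'} (h : Sq f f' σ τ)
    {y' : F.obj j} (g : y ⟶ y') :
    Sq (f ≫ mp(F.map v) g) (f' ≫ mp(F.map v') g) σ τ := by
  rw [Sq] at *
  have := NatTrans.naturality (F.map₂ τ).toNatTrans g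
  rw [Category.assoc, this, ← Category.assoc, h, Category.assoc]

lemma extend_post {k l : I} {u : i ⟶ k} {v : j ⟶ k} (f : ob(F.map u) x ⟶ ob(F.map v) y)
    {y' : F.obj j} (g : y ⟶ y') (p : k ⟶ l) :
    extend p (f ≫ mp(F.map v) g) = extend p f ≫ mp(F.map (v ≫ p)) g :=
  eq_of_heq ((extend_heq _ _).trans ((functor_map_comp_heq _ _ _).trans
    (comp_heq (obj_comp F _ _ _).symm (obj_comp F _ _ _).symm (obj_comp F _ _ _).symm
      (extend_heq _ _).symm (map_comp_heq F _ _ _).symm)))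

lemma Equivalent.post {a b : Germ F x y} (h : Equivalent a b) {y' : F.obj j} (g : y ⟶ y') :
    Equivalent (a.post g) (b.post g) := by
  obtain ⟨l, p, q, σ, τ, h⟩ := h
  refine ⟨l, p, q, σ, τ, ?_⟩
  have h' := Sq.post h g
  rw [← extend_post, ← extend_post] at h'
  exact h'

variable {j' : I} (w : j ⟶ j')

/-- The arrow obtained by pre-composition with an arrow between the indices. -/
def preHom {k : I} {u : i ⟶ k} {v : j' ⟶ k} (f : ob(F.map u) x ⟶ ob(F.map v) (ob(F.map w) y)) :
    ob(F.map u) x ⟶ ob(F.map (w ≫ v)) y := f ≫ eqToHom (obj_comp F w v y).symm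

lemma preHom_heq {k : I} {u : i ⟶ k} {v : j' ⟶ k}
    (f : ob(F.map u) x ⟶ ob(F.map v) (ob(F.map w) y)) : preHom w f ≍ f := comp_eqToHom_heq _ _

/-- Pre-composition of representatives with an arrow between the indices. -/
def pre (a : Germ F x (ob(F.map w) y)) : Germ F x y := ⟨a.k, a.u, w ≫ a.v, preHom w a.f⟩

lemma sq_preHom_iff {k : I} {u u' : i ⟶ k} {v v' : j' ⟶ k}
    {f : ob(F.map u) x ⟶ ob(F.map v) (ob(F.map w) y)}
    {f' : ob(F.map u') x ⟶ ob(F.map v') (ob(F.map w) y)} {σ : u ⟶ u'} {τ : v ⟶ v'} :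
    Sq (preHom w f) (preHom w f') σ (w ◁ τ) ↔ Sq f f' σ τ := by
  have h₁ : preHom w f ≫ ap(F.map₂ (w ◁ τ)) y ≍ f ≫ ap(F.map₂ τ) (ob(F.map w) y) :=
    comp_heq rfl (obj_comp F _ _ _) (obj_comp F _ _ _) (preHom_heq w f)
      (map₂_whiskerLeft_app_heq F _ _ _)
  have h₂ : ap(F.map₂ σ) x ≫ preHom w f' ≍ ap(F.map₂ σ) x ≫ f' :=
    comp_heq rfl rfl (obj_comp F _ _ _) HEq.rfl (preHom_heq w f')
  exact ⟨fun h => eq_of_heq (h₁.symm.trans ((heq_of_eq h).trans h₂)),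
    fun h => eq_of_heq (h₁.trans ((heq_of_eq h).trans h₂.symm))⟩

lemma extend_preHom_heq {k l : I} {u : i ⟶ k} {v : j' ⟶ k}
    (f : ob(F.map u) x ⟶ ob(F.map v) (ob(F.map w) y)) (p : k ⟶ l) :
    extend p (preHom w f) ≍ preHom w (extend p f) :=
  (extend_heq _ _).trans ((map_heq _ rfl (obj_comp F _ _ _) (preHom_heq _ _)).trans
    ((extend_heq _ _).symm.trans (preHom_heq _ _).symm))

lemma sq_extend_preHom {k l : I} {u u' : i ⟶ k} {v v' : j' ⟶ k}
    {f : ob(F.map u) x ⟶ ob(F.map v) (ob(F.map w) y)}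
    {f' : ob(F.map u') x ⟶ ob(F.map v') (ob(F.map w) y)} {σ : u ⟶ u'}
    {τ : w ≫ v ⟶ w ≫ v'} (h : Sq (preHom w f) (preHom w f') σ τ) (p : k ⟶ l) :
    Sq (preHom w (extend p f)) (preHom w (extend p f')) (σ ▷ p)
      (eqToHom (Strict.assoc _ _ _).symm ≫ τ ▷ p ≫ eqToHom (Strict.assoc _ _ _)) := by
  have := (Sq.of_heq rfl (Strict.assoc w v p).symm (extend_preHom_heq w f p).symm).comp
    ((h.extend p).comp (Sq.of_heq rfl (Strict.assoc w v' p) (extend_preHom_heq w f' p)))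
  simpa using this

lemma Equivalent.pre {a b : Germ F x (ob(F.map w) y)} (h : Equivalent a b) :
    Equivalent (a.pre w) (b.pre w) := by
  obtain ⟨l, p, q, σ, τ, h⟩ := h
  refine ⟨l, p, q, Iso.refl _ ≪≫ σ ≪≫ Iso.refl _, eqToIso (Strict.assoc _ _ _) ≪≫
    whiskerLeftIso w τ ≪≫ eqToIso (Strict.assoc _ _ _).symm, ?_⟩
  exact (Sq.of_heq rfl (Strict.assoc _ _ _) (extend_preHom_heq w a.f p)).comp
    (((sq_preHom_iff w).2 h).comp
      (Sq.of_heq rfl (Strict.assoc _ _ _).symm (extend_preHom_heq w b.f q).symm))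

/-- The given 2-cell `τ` relates arrows that start with `w`, but it need not be whiskered by `w`.
The second axiom of 2-filteredness supplies some invertible `τ'` between the arrows without `w`, and
the third makes `w ◁ τ'` agree with `τ` at a later stage, where `w` can be stripped off. -/
lemma Equivalent.of_pre {a b : Germ F x (ob(F.map w) y)} (h : Equivalent (a.pre w) (b.pre w)) :
    Equivalent a b := by
  obtain ⟨l, p, q, σ, τ, h⟩ := h
  refine (Equivalent.of_extend a p).symm.trans (Equivalent.trans ?_ (Equivalent.of_extend b q))
  have h₁ := (Sq.of_heq rfl (Strict.assoc _ _ _).symm (extend_preHom_heq w a.f p).symm).comp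
    (h.comp (Sq.of_heq rfl (Strict.assoc _ _ _) (extend_preHom_heq w b.f q)))
  obtain ⟨m, r, ⟨τ'⟩⟩ := exists_iso (a.v ≫ p) (b.v ≫ q)
  refine (Equivalent.of_extend _ r).symm.trans (Equivalent.trans ?_ (Equivalent.of_extend _ r))
  have h₂ := sq_extend_preHom w h₁ r
  obtain ⟨n, s, hs⟩ := exists_eq (eqToHom (Strict.assoc w (a.v ≫ p) r).symm ≫ ((eqToHom
    (Strict.assoc w a.v p).symm ≫ τ.hom ≫ eqToHom (Strict.assoc w b.v q)) ▷ r) ≫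
      eqToHom (Strict.assoc w (b.v ≫ q) r)) (w ◁ τ'.hom)
  refine (Equivalent.of_extend _ s).symm.trans (Equivalent.trans ?_ (Equivalent.of_extend _ s))
  have h₃ := sq_extend_preHom w h₂ s
  have e : eqToHom (Strict.assoc _ _ _).symm ≫ (w ◁ τ'.hom) ▷ s ≫ eqToHom (Strict.assoc _ _ _) =
      w ◁ (τ'.hom ▷ s) := by
    simp [Strict.associator_eqToIso]
  have h₄ := (congrArg (fun ζ => Sq (preHom w (extend s (extend r (extend p a.f))))
    (preHom w (extend s (extend r (extend q b.f)))) _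
    (eqToHom (Strict.assoc _ _ _).symm ≫ ζ ≫ eqToHom (Strict.assoc _ _ _))) hs).mp h₃
  have h₅ := (congrArg (fun ζ => Sq (preHom w (extend s (extend r (extend p a.f))))
    (preHom w (extend s (extend r (extend q b.f)))) _ ζ) e).mp h₄
  exact Equivalent.of_sq _ _ ((sq_preHom_iff w).1 h₅)

/-- A square on `a.v` and `w` makes the second leg of the representative pass through `w` at a later
stage. -/
lemma exists_pre_equivalent (a : Germ F x y) :
    ∃ b : Germ F x (ob(F.map w) y), Equivalent (b.pre w) a := by
  obtain ⟨l, p, q, ⟨τ⟩⟩ := exists_square a.v w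
  let f : ob(F.map (a.u ≫ p)) x ⟶ ob(F.map q) (ob(F.map w) y) :=
    extend p a.f ≫ ap(F.map₂ τ.hom) y ≫ eqToHom (obj_comp F w q y)
  have hf : preHom w f = extend p a.f ≫ ap(F.map₂ τ.hom) y := by simp [preHom, f]
  refine ⟨⟨l, a.u ≫ p, q, f⟩, Equivalent.trans (Equivalent.symm ?_) (Equivalent.of_extend a p)⟩
  refine Equivalent.of_sq (𝟙 _) τ.hom ?_
  rw [Sq, map₂_id_app, Category.id_comp]
  exact hf.symm

variable (x) in
/-- The bijection induced by pre-composition with an arrow between the indices. -/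
noncomputable def preEquiv (y : F.obj j) : Class x (ob(F.map w) y) ≃ Class x y :=
  Equiv.ofBijective (Quot.map (Germ.pre w) fun _ _ h => h.pre w) (by
    refine ⟨?_, ?_⟩
    · rintro ⟨a⟩ ⟨b⟩ h
      exact mk_eq_iff.2 ((mk_eq_iff.1 h).of_pre w)
    · rintro ⟨a⟩
      obtain ⟨b, hb⟩ := exists_pre_equivalent w a
      exact ⟨Quot.mk _ b, mk_eq_iff.2 hb⟩)

variable (x) in
/-- Post-composition of classes with an arrow. -/
def classMap {y y' : F.obj j} (g : y ⟶ y') : Class x y → Class x y' :=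
  Quot.map (Germ.post g) fun _ _ h => h.post g

lemma preEquiv_classMap {y y' : F.obj j} (g : y ⟶ y') (z : Class x (ob(F.map w) y)) :
    preEquiv x w y' (classMap x (mp(F.map w) g) z) = classMap x g (preEquiv x w y z) := by
  obtain ⟨a⟩ := z
  refine congrArg (Quot.mk _) (ext' rfl rfl ?_)
  refine (preHom_heq _ _).trans ?_
  exact comp_heq rfl (obj_comp F _ _ _).symm (obj_comp F _ _ _).symm (preHom_heq _ _).symm
    (map_comp_heq F _ _ _).symm

lemma preEquiv_id (z : Class x y) :
    preEquiv x (𝟙 j) y (classMap x (eqToHom (obj_id F j y).symm) z) = z := by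
  obtain ⟨a⟩ := z
  refine congrArg (Quot.mk _) (ext' rfl (Strict.id_comp _) ?_)
  refine (preHom_heq _ _).trans ?_
  exact comp_id_heq rfl (congrArg _ (obj_id F j y)) _ (functor_map_eqToHom_heq _ _)

lemma preEquiv_comp {l : I} (w' : j' ⟶ l) (z : Class x (ob(F.map (w ≫ w')) y)) :
    preEquiv x w y (preEquiv x w' (ob(F.map w) y)
      (classMap x (eqToHom (obj_comp F w w' y)) z)) = preEquiv x (w ≫ w') y z := by
  obtain ⟨a⟩ := z
  refine congrArg (Quot.mk _) (ext' rfl (Strict.assoc _ _ _).symm ?_)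
  refine (preHom_heq _ _).trans ((preHom_heq _ _).trans (HEq.trans ?_ (preHom_heq _ _).symm))
  exact comp_id_heq rfl (congrArg _ (obj_comp F w w' y).symm) _ (functor_map_eqToHom_heq _ _)

lemma preEquiv_map₂ {w w' : j ⟶ j'} (α : w ⟶ w') (z : Class x (ob(F.map w) y)) :
    preEquiv x w' y (classMap x (ap(F.map₂ α) y) z) = preEquiv x w y z := by
  obtain ⟨a⟩ := z
  refine (Quot.sound (Equivalent.of_sq (𝟙 _) (α ▷ a.v) ?_)).symm
  refine eq_of_heq (HEq.trans ?_ (id_comp_heq rfl rfl _ (heq_of_eq (map₂_id_app F _ _))).symm)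
  refine HEq.trans ?_ (preHom_heq _ _).symm
  exact comp_heq rfl (obj_comp F _ _ _) (obj_comp F _ _ _) (preHom_heq _ _)
    (map₂_whiskerRight_app_heq F _ _ _)

variable (x) in
/-- The classes of representatives of arrows with domain `x`, as a pseudocone of types. -/
noncomputable def classCocone : Cocone F (Type v) where
  ι j :=
    { obj := fun y => Class x y
      map := fun g => TypeCat.ofHom (classMap x g)
      map_id := fun y => by
        ext ⟨a⟩
        exact congrArg (Quot.mk _) (ext' rfl rfl (by simp))
      map_comp := fun g g' => by
        ext ⟨a⟩
        exact congrArg (Quot.mk _) (ext' rfl rfl (heq_of_eq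
          ((congrArg (a.f ≫ ·) (CategoryTheory.Functor.map_comp _ g g')).trans
            (Category.assoc _ _ _).symm))) }
  -- A pseudocone asks for the direction from the classes at `y` to the classes at its image under
  -- `w`, opposite to `preEquiv`.
  ιIso w y := (preEquiv x w y).symm.toIso
  ιIso_naturality w y y' g := by
    ext z
    refine (Equiv.symm_apply_eq _).2 ?_
    refine Eq.trans ?_ (preEquiv_classMap w g _).symm
    exact congrArg _ ((preEquiv x w y).apply_symm_apply z).symm
  ιIso_id j y := by
    ext z
    refine (Equiv.symm_apply_eq _).2 ?_
    rw [F.mapId_eq_eqToIso, eqToIso.inv, Cat.eqToHom_app]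
    exact (preEquiv_id z).symm
  ιIso_comp u w y := by
    ext z
    refine (Equiv.symm_apply_eq _).2 ((Equiv.symm_apply_eq _).2 ?_)
    rw [F.mapComp_eq_eqToIso, eqToIso.hom, Cat.eqToHom_app]
    exact ((preEquiv_comp u w _).trans ((preEquiv x (u ≫ w) y).apply_symm_apply z)).symm
  ιIso_map₂ α y := by
    ext z
    refine ((Equiv.symm_apply_eq _).2 ?_).symm
    exact ((preEquiv_map₂ α _).trans ((preEquiv x _ y).apply_symm_apply z)).symm

end Germ

/-! ### Representation at a stage of arrows, equalities and isomorphisms -/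

variable {F} [IsTwoFiltered I] {i : I} {x y : F.obj i}

/-- The pseudocone of germs with source `x` induces a functor from the pseudocolimit to types. It
lets the two arrows act on the germ of the identity, which gives the germs of `f` and of `g`; hence
these are equivalent. -/
theorem exists_map_eq_of_incl_eq {f g : x ⟶ y} (h : incl i f = incl i g) :
    ∃ (k : I) (w : i ⟶ k), mp(F.map w) f = mp(F.map w) g := by
  let a : Germ F x x := ⟨i, 𝟙 i, 𝟙 i, 𝟙 _⟩
  have h₁ : (Quot.mk _ (a.post f) : Germ.Class x y) = Quot.mk _ (a.post g) :=
    congrArg (fun m : (⟨i, x⟩ : PseudoColim F) ⟶ ⟨i, y⟩ =>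
      TypeCat.Hom.hom ((desc (Germ.classCocone x)).map m) (Quot.mk _ a : Germ.Class x x)) h
  obtain ⟨l, p, q, σ, τ, h⟩ : ∃ (l : I) (p q : i ⟶ l) (σ τ : 𝟙 i ≫ p ≅ 𝟙 i ≫ q),
      Sq (extend p (𝟙 _ ≫ mp(F.map (𝟙 i)) f)) (extend q (𝟙 _ ≫ mp(F.map (𝟙 i)) g)) σ.hom τ.hom :=
    Germ.mk_eq_iff.1 h₁
  -- Both legs of the two germs are identities, so `σ` and `τ` are parallel and can be made equal at
  -- a later stage. Naturality of the resulting 2-cell at `g` then allows it to be cancelled.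
  obtain ⟨m, r, hr⟩ := exists_eq (I := I) (u := 𝟙 i ≫ p) (v := 𝟙 i ≫ q) σ.hom τ.hom
  refine ⟨m, (𝟙 i ≫ p) ≫ r, ?_⟩
  have h₂ := h.extend r
  have e (g : x ⟶ y) (p : i ⟶ l) : extend r (extend p (𝟙 _ ≫ mp(F.map (𝟙 i)) g)) =
      mp(F.map ((𝟙 i ≫ p) ≫ r)) g := by
    refine eq_of_heq ((extend_heq _ _).trans (HEq.trans ?_ (map_comp_heq F _ _ _).symm))
    refine map_heq (F.map r).toFunctor rfl rfl ?_
    refine (extend_heq _ _).trans (HEq.trans ?_ (map_comp_heq F _ _ _).symm)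
    exact map_heq (F.map p).toFunctor rfl rfl (heq_of_eq (Category.id_comp (mp(F.map (𝟙 i)) g)))
  have h₃ : mp(F.map ((𝟙 i ≫ p) ≫ r)) f ≫ ap(F.map₂ (τ.hom ▷ r)) y =
      ap(F.map₂ (σ.hom ▷ r)) x ≫ mp(F.map ((𝟙 i ≫ q) ≫ r)) g := by
    rw [← e, ← e]; exact h₂
  have h₄ : ap(F.map₂ (τ.hom ▷ r)) x ≫ mp(F.map ((𝟙 i ≫ q) ≫ r)) g =
      mp(F.map ((𝟙 i ≫ p) ≫ r)) g ≫ ap(F.map₂ (τ.hom ▷ r)) y :=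
    (NatTrans.naturality (F.map₂ (τ.hom ▷ r)).toNatTrans g).symm
  have hr' : σ.hom ▷ r = τ.hom ▷ r := hr
  rw [hr', h₄] at h₃
  have hτ : ap(F.map₂ (τ.hom ▷ r)) y ≫ ap(F.map₂ (τ.inv ▷ r)) y = 𝟙 _ := by
    rw [← map₂_comp_app, hom_inv_whiskerRight, map₂_id_app]
  have h₅ := congrArg (· ≫ ap(F.map₂ (τ.inv ▷ r)) y) h₃
  simpa only [Category.assoc, hτ, Category.comp_id] using h₅

/-- By naturality of `push`, a representative of `m` stays one when it is moved to a later stage. -/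
lemma push_comp_extend {a b : PseudoColim F} {m : a ⟶ b} {k l : I} {u : a.idx ⟶ k} {v : b.idx ⟶ k}
    {f : ob(F.map u) a.el ⟶ ob(F.map v) b.el}
    (h : (push u a.el).hom ≫ incl k f = m ≫ (push v b.el).hom) (p : k ⟶ l) :
    (push (u ≫ p) a.el).hom ≫ incl l (extend p f) = m ≫ (push (v ≫ p) b.el).hom := by
  have h₁ := mk_congr (obj_comp F u p a.el)
  have h₂ := mk_congr (obj_comp F v p b.el)
  refine eq_of_heq ((comp_heq rfl h₁ h₂ (push_comp_heq _ _ _).symm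
    (incl_heq (obj_comp F _ _ _) (obj_comp F _ _ _) (extend_heq p f))).trans ?_)
  refine HEq.trans ?_ (comp_heq rfl rfl h₂.symm HEq.rfl (push_comp_heq v p b.el))
  rw [Category.assoc, ← push_naturality, ← Category.assoc, h, Category.assoc]

/-- A pair of arrows of indices and an arrow which represent an arrow of the pseudocolimit. -/
theorem exists_representative {a b : PseudoColim F} (m : a ⟶ b) :
    ∃ (k : I) (u : a.idx ⟶ k) (v : b.idx ⟶ k) (f : ob(F.map u) a.el ⟶ ob(F.map v) b.el),
      (push u a.el).hom ≫ incl k f = m ≫ (push v b.el).hom := by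
  suffices key : ∀ {a b : PseudoColim F} (p : PreHom F a b),
      ∃ (k : I) (u : a.idx ⟶ k) (v : b.idx ⟶ k) (f : ob(F.map u) a.el ⟶ ob(F.map v) b.el),
        (push u a.el).hom ≫ incl k f = (Quot.mk _ p : a ⟶ b) ≫ (push v b.el).hom by
    obtain ⟨p⟩ := m
    exact key p
  intro a b p
  induction p with
  | id a =>
    refine ⟨a.idx, 𝟙 _, 𝟙 _, 𝟙 _, ?_⟩
    exact (congrArg _ (incl_id _ _)).trans ((Category.comp_id _).trans (Category.id_comp _).symm)
  | incl i f => exact ⟨i, 𝟙 i, 𝟙 i, mp(F.map (𝟙 i)) f, (push_naturality (𝟙 i) f).symm⟩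
  | @push i j u x =>
    refine ⟨j, u, 𝟙 j, eqToHom (obj_id F j _).symm, ?_⟩
    refine congrArg ((push u x).hom ≫ ·) (eq_of_heq ?_)
    rw [incl_eqToHom]
    exact (eqToHom_heq _ rfl).trans (push_id_heq j (ob(F.map u) x)).symm
  | @pull i j u x =>
    refine ⟨j, 𝟙 j, u, eqToHom (obj_id F j _), ?_⟩
    refine Eq.trans ?_ (push u x).inv_hom_id.symm
    refine eq_of_heq ?_
    rw [incl_eqToHom]
    exact (comp_eqToHom_heq _ _).trans (push_id_heq j (ob(F.map u) x))
  | @comp a b c m n ih ih' =>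
    obtain ⟨k, u, v, f, h⟩ := ih
    obtain ⟨l, u', v', f', h'⟩ := ih'
    -- The two representatives see the middle object through different arrows `v` and `u'`; the
    -- 2-cell `τ` connects its two images at a common stage.
    obtain ⟨q, p, p', ⟨τ⟩⟩ := exists_square v u'
    refine ⟨q, u ≫ p, v' ≫ p', extend p f ≫ ap(F.map₂ τ.hom) b.el ≫ extend p' f', ?_⟩
    let m' : a ⟶ b := Quot.mk _ m
    let n' : b ⟶ c := Quot.mk _ n
    change _ = (m' ≫ n') ≫ _
    change _ = m' ≫ _ at h
    change _ = n' ≫ _ at h'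
    rw [Category.assoc, ← push_comp_extend h' p', ← push_map₂ τ.hom, incl_comp, incl_comp,
      ← Category.assoc, push_comp_extend h p]
    simp only [Category.assoc]

/-- As source and target have the same index, the two legs of a representative are parallel; they
become isomorphic at a later stage, and the representative can be corrected by that isomorphism. -/
theorem exists_push_comp_incl (m : (⟨i, x⟩ : PseudoColim F) ⟶ ⟨i, y⟩) :
    ∃ (k : I) (w : i ⟶ k) (f : ob(F.map w) x ⟶ ob(F.map w) y),
      (push w x).hom ≫ incl k f = m ≫ (push w y).hom := by
  obtain ⟨k, u, v, f, h⟩ := exists_representative m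
  obtain ⟨l, r, ⟨e⟩⟩ := exists_iso (I := I) (i := i) u v
  refine ⟨l, u ≫ r, extend r f ≫ ap(F.map₂ e.inv) y, ?_⟩
  rw [incl_comp, ← Category.assoc, push_comp_extend h r, Category.assoc]
  exact congrArg _ (push_map₂ e.inv y)

lemma incl_map_eq_of_incl_eq {f g : x ⟶ y} (h : incl i f = incl i g) {k : I} (w : i ⟶ k) :
    incl k (mp(F.map w) f) = incl k (mp(F.map w) g) := by
  rw [← cancel_epi (push w x).hom, ← push_naturality, ← push_naturality, h]

/-- A representative `g` of the inverse composes with the image of `f` to identities in the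
pseudocolimit; the two equations are realised one after the other at later stages. -/
theorem exists_isIso_map_of_isIso_incl {f : x ⟶ y} (h : IsIso (incl i f)) :
    ∃ (k : I) (w : i ⟶ k), IsIso (mp(F.map w) f) := by
  obtain ⟨k, w, g, hg⟩ := exists_push_comp_incl (inv (incl i f))
  have h₁ : incl k (mp(F.map w) f ≫ g) = incl k (𝟙 _) := by
    rw [incl_comp, incl_id, ← cancel_epi (push w x).hom, ← Category.assoc, ← push_naturality,
      Category.assoc, hg, ← Category.assoc, IsIso.hom_inv_id, Category.comp_id, Category.id_comp]
  have h₂ : incl k (g ≫ mp(F.map w) f) = incl k (𝟙 _) := by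
    rw [incl_comp, incl_id, ← cancel_epi (push w y).hom, ← Category.assoc, hg,
      Category.assoc, ← push_naturality, ← Category.assoc, IsIso.inv_hom_id, Category.comp_id,
      Category.id_comp]
  obtain ⟨l, w₁, h₃⟩ := exists_map_eq_of_incl_eq h₁
  obtain ⟨n, w₂, h₄⟩ := exists_map_eq_of_incl_eq (incl_map_eq_of_incl_eq h₂ w₁)
  refine ⟨n, w ≫ w₁ ≫ w₂, ?_⟩
  have e : ((F.map w).toFunctor ⋙ (F.map w₁).toFunctor ⋙ (F.map w₂).toFunctor) =
      (F.map (w ≫ w₁ ≫ w₂)).toFunctor := by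
    rw [F.map_comp, F.map_comp]; rfl
  rw [← e]
  refine ⟨mp(F.map w₂) (mp(F.map w₁) g), ?_, ?_⟩
  · simpa using congrArg (fun q => mp(F.map w₂) q) h₃
  · simpa using h₄

end PseudoColim

/-! ### The index 2-category of a pseudolimit of 2-pro-objects -/

section Lam

variable {C : Type u} [Bicategory.{v, v} C] [Strict C] {K : Type v} [Bicategory.{v, v} K] [Strict K]
  (D : StrictPseudofunctor Kᵒᵖ (Pro C))

/-- The index 2-category of the value of a diagram of 2-pro-objects. -/
abbrev idxAt (k : K) : Type v := TwoProObj.I (C := C) (D.obj (op k))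

/-- The value of a diagram of 2-pro-objects. -/
abbrev diagAt (k : K) : StrictPseudofunctor (idxAt D k)ᵒᵖ C := Pro.diagram (D.obj (op k))

/-- The covariant 2-functor which underlies a contravariant diagram of 2-pro-objects. -/
def lam : StrictPseudofunctor K (StrictPseudofunctor C Cat.{v, v}) :=
  twoFunctorMk
    { obj := fun k => L (diagAt D k)
      map := fun u => ph (D.map u.op)
      map₂ := fun α => pm (D.map₂ (Bicategory.Opposite.op2 α))
      map₂_id := fun u => congrArg pm (D.map₂_id u.op)
      map₂_comp := fun α β => congrArg pm
        (D.map₂_comp (Bicategory.Opposite.op2 α) (Bicategory.Opposite.op2 β)) }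
    (fun k => congrArg ph (D.map_id (op k)))
    (fun u w => congrArg ph (D.map_comp w.op u.op))
    (fun u _ _ α => pm_heq (D.map_comp _ _) (D.map_comp _ _)
      (map₂_whiskerRight_heq D (Bicategory.Opposite.op2 α) u.op))
    (fun α w => pm_heq (D.map_comp _ _) (D.map_comp _ _)
      (map₂_whiskerLeft_heq D w.op (Bicategory.Opposite.op2 α)))

variable {D}

/-- The action of an arrow of indices on elements. -/
abbrev act {k k' : K} (u : k ⟶ k') (E : C) :
    PseudoColim (homDiagram (diagAt D k) E) ⥤ PseudoColim (homDiagram (diagAt D k') E) :=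
  (TwoNat.app ((lam D).map u) E).toFunctor

/-- The action of a 2-cell of indices on elements. -/
abbrev act₂ {k k' : K} {u w : k ⟶ k'} (α : u ⟶ w) (E : C) : act (D := D) u E ⟶ act w E :=
  (Modif.app ((lam D).map₂ α) E).toNatTrans

lemma act_id (k : K) (E : C) : act (D := D) (𝟙 k) E = 𝟭 _ :=
  congrArg (fun θ : (lam D).obj k ⟶ (lam D).obj k => (TwoNat.app θ E).toFunctor) ((lam D).map_id k)

lemma act_comp {k k' k'' : K} (u : k ⟶ k') (w : k' ⟶ k'') (E : C) :
    act (D := D) (u ≫ w) E = act u E ⋙ act w E :=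
  congrArg (fun θ : (lam D).obj k ⟶ (lam D).obj k'' => (TwoNat.app θ E).toFunctor)
    ((lam D).map_comp u w)

lemma act_nat {k k' : K} (u : k ⟶ k') {E E' : C} (g : E ⟶ E') :
    ((L (diagAt D k)).map g).toFunctor ⋙ act u E' = act u E ⋙ ((L (diagAt D k')).map g).toFunctor :=
  congrArg Cat.Hom.toFunctor (TwoNat.naturality ((lam D).map u) g)

lemma act₂_id {k k' : K} (u : k ⟶ k') (E : C) : act₂ (D := D) (𝟙 u) E = 𝟙 _ :=
  congrArg (fun ρ : (lam D).map u ⟶ (lam D).map u => (Modif.app ρ E).toNatTrans)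
    ((lam D).map₂_id u)

lemma act₂_comp {k k' : K} {u w z : k ⟶ k'} (α : u ⟶ w) (β : w ⟶ z) (E : C) :
    act₂ (D := D) (α ≫ β) E = act₂ α E ≫ act₂ β E :=
  congrArg (fun ρ : (lam D).map u ⟶ (lam D).map z => (Modif.app ρ E).toNatTrans)
    ((lam D).map₂_comp α β)

variable {E : C}

lemma act₂_whiskerLeft_heq {k k' k'' : K} (u : k ⟶ k') {w w' : k' ⟶ k''} (α : w ⟶ w')
    (x : PseudoColim (homDiagram (diagAt D k) E)) :
    (act₂ (u ◁ α) E).app x ≍ (act₂ α E).app ((act u E).obj x) :=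
  modif_app_heq ((lam D).map_comp _ _) ((lam D).map_comp _ _)
    (map₂_whiskerLeft_heq (lam D) u α) E rfl

lemma act₂_whiskerRight_heq {k k' k'' : K} {u u' : k ⟶ k'} (α : u ⟶ u') (w : k' ⟶ k'')
    (x : PseudoColim (homDiagram (diagAt D k) E)) :
    (act₂ (α ▷ w) E).app x ≍ (act w E).map ((act₂ α E).app x) :=
  modif_app_heq ((lam D).map_comp _ _) ((lam D).map_comp _ _)
    (map₂_whiskerRight_heq (lam D) α w) E rfl

lemma act₂_heq {k k' : K} {u u' w w' : k ⟶ k'} (hu : u = u') (hw : w = w') {α : u ⟶ w}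
    {β : u' ⟶ w'} (h : α ≍ β) (x : PseudoColim (homDiagram (diagAt D k) E)) :
    (act₂ α E).app x ≍ (act₂ β E).app x := by
  subst hu hw h; rfl

lemma act₂_eqToHom_heq {k k' : K} {u u' : k ⟶ k'} (h : u = u')
    (x : PseudoColim (homDiagram (diagAt D k) E)) :
    (act₂ (eqToHom h) E).app x ≍ 𝟙 ((act u E).obj x) := by
  subst h
  rw [eqToHom_refl, act₂_id]
  rfl

end Lam

variable {C : Type u} [Bicategory.{v, v} C] [Strict C] {K : Type v} [Bicategory.{v, v} K] [Strict K]

/-- The objects of the index 2-category of the pseudolimit of a diagram of 2-pro-objects. -/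
structure Ix (D : StrictPseudofunctor Kᵒᵖ (Pro C)) : Type v where
  k : K
  i : idxAt D k

namespace Ix

variable {D : StrictPseudofunctor Kᵒᵖ (Pro C)}

/-- The object of `C` at an index. -/
abbrev val (o : Ix D) : C := (diagAt D o.k).obj (op o.i)

/-- The element of the pseudocolimit given by an arrow. -/
abbrev elt (o : Ix D) {E : C} (f : o.val ⟶ E) : PseudoColim (homDiagram (diagAt D o.k) E) :=
  ⟨o.i, f⟩

/-- The arrows of the index 2-category. -/
structure Hom (o o' : Ix D) : Type v where
  u : o.k ⟶ o'.k
  r : o'.val ⟶ o.val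
  -- Thus `r` represents, at the index `o'.i` and up to the isomorphism `ψ`, the arrow of
  -- 2-pro-objects assigned to `u` followed by the projection to `o.val`.
  ψ : (act u o.val).obj (o.elt (𝟙 _)) ≅ o'.elt r

namespace Hom

lemma ext' {o o' : Ix D} {A B : Hom o o'} (hu : A.u = B.u) (hr : A.r = B.r)
    (h : A.ψ.hom ≍ B.ψ.hom) : A = B := by
  obtain ⟨u, r, ψ⟩ := A
  obtain ⟨u', r', ψ'⟩ := B
  obtain rfl : u = u' := hu
  obtain rfl : r = r' := hr
  obtain rfl : ψ = ψ' := Iso.ext (eq_of_heq h)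
  rfl

/-- The element given by `f` is the image under `f` of the generic one, and the action of `A.u` is
strictly natural in `C`. This lets `ψ`, given at the generic element only, be extended to all `f`.
-/
lemma obj_eq {o o' : Ix D} (A : Hom o o') {E : C} (f : o.val ⟶ E) :
    (act A.u E).obj (o.elt f) =
      ob((L (diagAt D o'.k)).map f) ((act A.u o.val).obj (o.elt (𝟙 _))) := by
  refine Eq.trans ?_ (Functor.congr_obj (act_nat A.u f) (o.elt (𝟙 _)))
  exact congrArg (act A.u E).obj (PseudoColim.mk_congr (Strict.id_comp f).symm)

/-- The action of an arrow of the index 2-category on elements. -/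
def ext {o o' : Ix D} (A : Hom o o') {E : C} (f : o.val ⟶ E) :
    (act A.u E).obj (o.elt f) ≅ o'.elt (A.r ≫ f) :=
  eqToIso (A.obj_eq f) ≪≫ ((L (diagAt D o'.k)).map f).toFunctor.mapIso A.ψ

lemma ext_heq {o o' : Ix D} (A : Hom o o') {E : C} (f : o.val ⟶ E) :
    (A.ext f).hom ≍ mp((L (diagAt D o'.k)).map f) A.ψ.hom :=
  id_comp_heq rfl (A.obj_eq f) _ (eqToHom_heq (A.obj_eq f) (A.obj_eq f))

lemma ext_id_heq {o o' : Ix D} (A : Hom o o') : (A.ext (𝟙 _)).hom ≍ A.ψ.hom :=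
  (A.ext_heq _).trans (map_id_heq _ _ _)

lemma ext_comp_heq {o o' : Ix D} (A : Hom o o') {E E' : C} (f : o.val ⟶ E) (g : E ⟶ E') :
    (A.ext (f ≫ g)).hom ≍ mp((L (diagAt D o'.k)).map g) (A.ext f).hom :=
  (A.ext_heq _).trans ((map_comp_heq _ f g _).trans
    (map_heq _ (A.obj_eq f).symm rfl (A.ext_heq f).symm))

lemma ext_naturality {o o' : Ix D} (A : Hom o o') {E : C} {f f' : o.val ⟶ E} (β : f ⟶ f') :
    (act A.u E).map (PseudoColim.incl (F := homDiagram (diagAt D o.k) E) o.i β) ≫ (A.ext f').hom =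
      (A.ext f).hom ≫ PseudoColim.incl (F := homDiagram (diagAt D o'.k) E) o'.i (A.r ◁ β) := by
  have h₁ := nat_map₂_heq ((lam D).map A.u) β (o.elt (𝟙 _))
  have h₂ := NatTrans.naturality ((L (diagAt D o'.k)).map₂ β).toNatTrans A.ψ.hom
  refine eq_of_heq ?_
  refine HEq.trans ?_ ((heq_of_eq h₂.symm).trans (comp_heq (A.obj_eq f).symm rfl rfl
    (A.ext_heq f).symm HEq.rfl))
  refine comp_heq (A.obj_eq f) (A.obj_eq f') rfl ?_ (A.ext_heq f')
  refine HEq.trans ?_ h₁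
  exact map_heq (act A.u E) (PseudoColim.mk_congr (Strict.id_comp f).symm)
    (PseudoColim.mk_congr (Strict.id_comp f').symm) (PseudoColim.incl_heq
      (Strict.id_comp f).symm (Strict.id_comp f').symm (id_whiskerLeft_heq β).symm)

/-- The identities of the index 2-category. -/
def id (o : Ix D) : Hom o o where
  u := 𝟙 _
  r := 𝟙 _
  ψ := eqToIso (Functor.congr_obj (act_id o.k o.val) _)

/-- The composition of the index 2-category. -/
def comp {o o' o'' : Ix D} (A : Hom o o') (B : Hom o' o'') : Hom o o'' where
  u := A.u ≫ B.u
  r := B.r ≫ A.r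
  ψ := eqToIso (Functor.congr_obj (act_comp A.u B.u o.val) _) ≪≫
    (act B.u o.val).mapIso A.ψ ≪≫ B.ext A.r

lemma comp_heq {o o' o'' : Ix D} (A : Hom o o') (B : Hom o' o'') :
    (A.comp B).ψ.hom ≍ (act B.u o.val).map A.ψ.hom ≫ (B.ext A.r).hom :=
  id_comp_heq rfl (Functor.congr_obj (act_comp A.u B.u o.val) _) _
    (eqToHom_heq (Functor.congr_obj (act_comp A.u B.u o.val) _)
      (Functor.congr_obj (act_comp A.u B.u o.val) _))

/-- The compatibility of this extension with composition; it yields the strict associativity of the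
composition of the index 2-category. -/
lemma comp_ext_heq {o o' o'' : Ix D} (A : Hom o o') (B : Hom o' o'') {E : C} (f : o.val ⟶ E) :
    ((A.comp B).ext f).hom ≍ (act B.u E).map (A.ext f).hom ≫ (B.ext (A.r ≫ f)).hom := by
  refine ((A.comp B).ext_heq f).trans ?_
  refine (map_heq _ (Functor.congr_obj (act_comp A.u B.u o.val) _) rfl (A.comp_heq B)).trans ?_
  refine (functor_map_comp_heq _ _ _).trans ?_
  refine TwoPro.comp_heq ?_ ?_ (PseudoColim.mk_congr (Strict.assoc _ _ _)) ?_
    (B.ext_comp_heq A.r f).symm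
  · exact (Functor.congr_obj (act_nat B.u f) _).symm.trans (congrArg _ (A.obj_eq f).symm)
  · exact (Functor.congr_obj (act_nat B.u f) _).symm
  · refine (map_heq_of_eq (act_nat B.u f) _).symm.trans ?_
    exact map_heq (act B.u E) (A.obj_eq f).symm rfl (A.ext_heq f).symm

end Hom

/-- The 2-cells of the index 2-category. -/
structure Hom₂ {o o' : Ix D} (A B : Hom o o') : Type v where
  α : A.u ⟶ B.u
  θ : A.r ⟶ B.r
  w : A.ψ.hom ≫ PseudoColim.incl (F := homDiagram (diagAt D o'.k) o.val) o'.i θ =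
    (act₂ α o.val).app (o.elt (𝟙 _)) ≫ B.ψ.hom

namespace Hom₂

variable {o o' o'' : Ix D}

lemma ext' {A B : Hom o o'} {x y : Hom₂ A B} (h : x.α = y.α) (h' : x.θ = y.θ) : x = y := by
  obtain ⟨α, θ, _⟩ := x
  obtain ⟨β, ζ, _⟩ := y
  obtain rfl : α = β := h
  obtain rfl : θ = ζ := h'
  rfl

instance : Category (Hom o o') where
  Hom := Hom₂
  id A := ⟨𝟙 _, 𝟙 _,
    (congrArg (A.ψ.hom ≫ ·) (PseudoColim.incl_id _ _)).trans ((Category.comp_id _).trans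
      ((Category.id_comp _).symm.trans (congrArg (· ≫ A.ψ.hom)
        (NatTrans.congr_app (act₂_id A.u o.val) _).symm)))⟩
  comp {A B B'} x y := ⟨x.α ≫ y.α, x.θ ≫ y.θ,
    (congrArg (A.ψ.hom ≫ ·) (PseudoColim.incl_comp _ _ _)).trans <|
      (Category.assoc _ _ _).symm.trans <| (congrArg (· ≫ _) x.w).trans <|
      (Category.assoc _ _ _).trans <| (congrArg (_ ≫ ·) y.w).trans <|
      (Category.assoc _ _ _).symm.trans <| congrArg (· ≫ B'.ψ.hom)
        (NatTrans.congr_app (act₂_comp x.α y.α o.val) _).symm⟩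
  id_comp _ := ext' (Category.id_comp _) (Category.id_comp _)
  comp_id _ := ext' (Category.comp_id _) (Category.comp_id _)
  assoc _ _ _ := ext' (Category.assoc _ _ _) (Category.assoc _ _ _)

lemma heq_ext {A B A' B' : Hom o o'} (hA : A = A') (hB : B = B') {x : A ⟶ B} {y : A' ⟶ B'}
    (h : x.α ≍ y.α) (h' : x.θ ≍ y.θ) : x ≍ y := by
  subst hA hB
  exact heq_of_eq (ext' (eq_of_heq h) (eq_of_heq h'))

/-- The law `w` is imposed at the generic element; the modification law of `act₂` carries it to
every `f`. Left whiskering needs the case where `f` is the arrow `r` of the first factor. -/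
lemma w_ext {A B : Hom o o'} (x : Hom₂ A B) {E : C} (f : o.val ⟶ E) :
    (A.ext f).hom ≫ PseudoColim.incl (F := homDiagram (diagAt D o'.k) E) o'.i (x.θ ▷ f) =
      (act₂ x.α E).app (o.elt f) ≫ (B.ext f).hom := by
  have h₁ := modif_heq ((lam D).map₂ x.α) f (o.elt (𝟙 _))
  have h₂ := congrArg (fun q => mp((L (diagAt D o'.k)).map f) q) x.w
  refine eq_of_heq ?_
  refine (TwoPro.comp_heq (A.obj_eq f) rfl rfl (A.ext_heq f) HEq.rfl).trans ?_
  refine (functor_map_comp_heq ((L (diagAt D o'.k)).map f).toFunctor A.ψ.hom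
    (PseudoColim.incl (F := homDiagram (diagAt D o'.k) o.val) o'.i x.θ)).symm.trans ?_
  refine (heq_of_eq h₂).trans ?_
  refine (functor_map_comp_heq _ _ _).trans ?_
  refine TwoPro.comp_heq (A.obj_eq f).symm (B.obj_eq f).symm rfl ?_ (B.ext_heq f).symm
  refine h₁.symm.trans ?_
  exact app_heq (act₂ x.α E) (PseudoColim.mk_congr (Strict.id_comp f))

/-- The left whiskering of the index 2-category. -/
def whiskerLeft (A : Hom o o') {B B' : Hom o' o''} (x : B ⟶ B') : A.comp B ⟶ A.comp B' where
  α := A.u ◁ x.α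
  θ := x.θ ▷ A.r
  w := by
    have h := NatTrans.naturality (act₂ x.α o.val) A.ψ.hom
    refine eq_of_heq ?_
    refine (TwoPro.comp_heq (Functor.congr_obj (act_comp A.u B.u o.val) _) rfl rfl
      (A.comp_heq B) HEq.rfl).trans ?_
    refine HEq.trans ?_ (TwoPro.comp_heq (Functor.congr_obj (act_comp A.u B.u o.val) _)
      (Functor.congr_obj (act_comp A.u B'.u o.val) _) rfl
      (act₂_whiskerLeft_heq A.u x.α (o.elt (𝟙 _))) (A.comp_heq B')).symm
    exact heq_of_eq <| (Category.assoc _ _ _).trans <| (congrArg (_ ≫ ·) (w_ext x A.r)).trans <|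
      (Category.assoc _ _ _).symm.trans <| (congrArg (· ≫ (B'.ext A.r).hom) h).trans <|
      Category.assoc _ _ _

/-- The right whiskering of the index 2-category. -/
def whiskerRight {A A' : Hom o o'} (x : A ⟶ A') (B : Hom o' o'') : A.comp B ⟶ A'.comp B where
  α := x.α ▷ B.u
  θ := B.r ◁ x.θ
  w := by
    have h := congrArg (fun q => (act B.u o.val).map q) x.w
    simp only [CategoryTheory.Functor.map_comp] at h
    refine eq_of_heq ?_
    refine (TwoPro.comp_heq (Functor.congr_obj (act_comp A.u B.u o.val) _) rfl rfl
      (A.comp_heq B) HEq.rfl).trans ?_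
    refine HEq.trans ?_ (TwoPro.comp_heq (Functor.congr_obj (act_comp A.u B.u o.val) _)
      (Functor.congr_obj (act_comp A'.u B.u o.val) _) rfl
      (act₂_whiskerRight_heq x.α B.u (o.elt (𝟙 _))) (A'.comp_heq B)).symm
    exact heq_of_eq <| (Category.assoc _ _ _).trans <|
      (congrArg (_ ≫ ·) (B.ext_naturality x.θ).symm).trans <|
      (Category.assoc _ _ _).symm.trans <| (congrArg (· ≫ (B.ext A'.r).hom) h).trans <|
      Category.assoc _ _ _

end Hom₂

instance : CategoryStruct (Ix D) where
  Hom := Hom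
  id := Hom.id
  comp := Hom.comp

lemma id_comp' {o o' : Ix D} (A : o ⟶ o') : 𝟙 o ≫ A = A :=
  Hom.ext' (Strict.id_comp _) (Strict.comp_id _) (by
    have e : (act (𝟙 o.k) o.val).obj (o.elt (𝟙 _)) = o.elt (𝟙 _) :=
      Functor.congr_obj (act_id o.k o.val) _
    refine (Hom.comp_heq _ _).trans ?_
    refine HEq.trans ?_ A.ext_id_heq
    refine id_comp_heq rfl (congrArg _ e) _ ?_
    refine (map_heq (act A.u o.val) rfl e.symm (eqToHom_heq e rfl)).trans ?_
    exact (functor_map_id_heq _ _).trans (id_heq (congrArg _ e)))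

lemma comp_id' {o o' : Ix D} (A : o ⟶ o') : A ≫ 𝟙 o' = A :=
  Hom.ext' (Strict.comp_id _) (Strict.id_comp _) (by
    have e : (act (𝟙 o'.k) o.val).obj (o'.elt A.r) = o'.elt A.r :=
      Functor.congr_obj (act_id o'.k o.val) _
    have e' : (act (𝟙 o'.k) o'.val).obj (o'.elt (𝟙 _)) = o'.elt (𝟙 _) :=
      Functor.congr_obj (act_id o'.k o'.val) _
    refine (Hom.comp_heq _ _).trans ?_
    refine (comp_id_heq e ?_ _ ?_).trans (map_heq_of_eq (act_id o'.k o.val) A.ψ.hom)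
    · exact PseudoColim.mk_congr (Strict.id_comp A.r)
    · refine ((Hom.id o').ext_heq A.r).trans ?_
      refine (functor_map_eqToHom_heq _ e').trans (id_heq ?_)
      exact (congrArg _ e').trans (PseudoColim.mk_congr (Strict.id_comp A.r)))

lemma assoc' {o o' o'' o''' : Ix D} (A : o ⟶ o') (B : o' ⟶ o'') (B' : o'' ⟶ o''') :
    (A ≫ B) ≫ B' = A ≫ B ≫ B' :=
  Hom.ext' (Strict.assoc _ _ _) (Strict.assoc _ _ _).symm (by
    refine (Hom.comp_heq _ _).trans (HEq.trans ?_ (Hom.comp_heq _ _).symm)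
    have e := Functor.congr_obj (act_comp (D := D) A.u B.u o.val) (o.elt (𝟙 _))
    refine (TwoPro.comp_heq (congrArg (act B'.u o.val).obj e) rfl rfl
      ((map_heq (act B'.u o.val) e rfl (A.comp_heq B)).trans (functor_map_comp_heq _ _ _))
        HEq.rfl).trans ?_
    refine (heq_of_eq (Category.assoc _ _ _)).trans ?_
    refine TwoPro.comp_heq ?_ ?_ (PseudoColim.mk_congr (Strict.assoc _ _ _).symm) ?_
      (B.comp_ext_heq B' A.r).symm
    · exact (Functor.congr_obj (act_comp B.u B'.u o.val) _).symm
    · exact (Functor.congr_obj (act_comp B.u B'.u o.val) _).symm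
    · exact (map_heq_of_eq (act_comp B.u B'.u o.val) _).symm)

lemma conj_of_heq {E : Type u₁} [Category.{v₁} E] {x y x' y' : E} (hx : x = x') (hy : y = y')
    {f : x ⟶ y} {f' : x' ⟶ y'} (h : f ≍ f') : f = eqToHom hx ≫ f' ≫ eqToHom hy.symm := by
  subst hx hy h; simp

lemma eqToHom_comp_comp {E : Type u₁} [Category.{v₁} E] {x₁ x₂ x₃ x₄ x₅ : E} (h₁ : x₁ = x₂)
    (h₂ : x₂ = x₃) (h₃ : x₃ = x₄) (h₄ : x₁ = x₅) (h₅ : x₅ = x₄) {f : x₁ ⟶ x₂} {g : x₃ ⟶ x₄}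
    (hf : f = eqToHom h₁) (hg : g = eqToHom h₃) :
    f ≫ eqToHom h₂ ≫ g = eqToHom h₄ ≫ eqToHom h₅ := by
  rw [hf, hg, eqToHom_trans, eqToHom_trans, eqToHom_trans]

lemma eqToHom_comp_eq {E : Type u₁} [Category.{v₁} E] {x₁ x₂ x₃ : E} (h₁ : x₁ = x₂)
    (h₂ : x₂ = x₃) (h₃ : x₁ = x₃) {f : x₁ ⟶ x₃} {g : x₂ ⟶ x₃} (hf : f = eqToHom h₃)
    (hg : g = eqToHom h₂) : eqToHom h₁ ≫ g = f := by
  rw [hf, hg, eqToHom_trans]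

lemma whiskerLeft_eqToHom' {o o' o'' : Ix D} (A : o ⟶ o') {B B' : o' ⟶ o''} (h : B = B') :
    Hom₂.whiskerLeft A (eqToHom h) = eqToHom (by rw [h]) := by
  subst h
  exact Hom₂.ext' (Bicategory.whiskerLeft_id _ _) (id_whiskerRight _ _)

lemma whiskerRight_eqToHom' {o o' o'' : Ix D} {A A' : o ⟶ o'} (h : A = A') (B : o' ⟶ o'') :
    Hom₂.whiskerRight (eqToHom h) B = eqToHom (by rw [h]) := by
  subst h
  exact Hom₂.ext' (id_whiskerRight _ _) (Bicategory.whiskerLeft_id _ _)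

/-- Composition is strictly unital and associative, so the coherence 2-cells are equalities and the
laws are checked on `α` and `θ`. The arrows `r` compose in the reverse order, so on `θ` left and
right whiskering are exchanged. -/
instance : Bicategory (Ix D) where
  homCategory o o' := inferInstanceAs (Category (Hom o o'))
  whiskerLeft A _ _ x := Hom₂.whiskerLeft A x
  whiskerRight x B := Hom₂.whiskerRight x B
  associator A B B' := eqToIso (C := Hom _ _) (assoc' A B B')
  leftUnitor A := eqToIso (C := Hom _ _) (id_comp' A)
  rightUnitor A := eqToIso (C := Hom _ _) (comp_id' A)
  whiskerLeft_id _ _ := Hom₂.ext' (Bicategory.whiskerLeft_id _ _) (id_whiskerRight _ _)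
  whiskerLeft_comp _ _ _ _ _ _ :=
    Hom₂.ext' (Bicategory.whiskerLeft_comp _ _ _) (comp_whiskerRight _ _ _)
  id_whiskerLeft x := conj_of_heq (E := Hom _ _) (id_comp' _) (id_comp' _) (Hom₂.heq_ext (id_comp' _) (id_comp' _)
    (id_whiskerLeft_heq x.α) (whiskerRight_id_heq x.θ))
  comp_whiskerLeft A B _ _ x := conj_of_heq (E := Hom _ _) (assoc' _ _ _) (assoc' _ _ _)
    (Hom₂.heq_ext (assoc' _ _ _) (assoc' _ _ _) (comp_whiskerLeft_heq A.u B.u x.α)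
      (whiskerRight_comp_heq x.θ B.r A.r))
  id_whiskerRight _ _ := Hom₂.ext' (id_whiskerRight _ _) (Bicategory.whiskerLeft_id _ _)
  comp_whiskerRight _ _ _ :=
    Hom₂.ext' (comp_whiskerRight _ _ _) (Bicategory.whiskerLeft_comp _ _ _)
  whiskerRight_id x := conj_of_heq (E := Hom _ _) (comp_id' _) (comp_id' _) (Hom₂.heq_ext (comp_id' _) (comp_id' _)
    (whiskerRight_id_heq x.α) (id_whiskerLeft_heq x.θ))
  whiskerRight_comp x B B' := conj_of_heq (E := Hom _ _) (assoc' _ _ _).symm (assoc' _ _ _).symm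
    (Hom₂.heq_ext (assoc' _ _ _).symm (assoc' _ _ _).symm (whiskerRight_comp_heq x.α B.u B'.u)
      (comp_whiskerLeft_heq B'.r B.r x.θ))
  whisker_assoc A _ _ x B := conj_of_heq (E := Hom _ _) (assoc' _ _ _) (assoc' _ _ _)
    (Hom₂.heq_ext (assoc' _ _ _) (assoc' _ _ _) (whisker_assoc_heq A.u x.α B.u)
      (whisker_assoc_heq B.r x.θ A.r).symm)
  whisker_exchange _ _ := Hom₂.ext' (whisker_exchange _ _) (whisker_exchange _ _).symm
  pentagon A B B' B'' := eqToHom_comp_comp (E := Hom _ _) _ (assoc' A (B ≫ B') B'') _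
    (assoc' (A ≫ B) B' B'') (assoc' A B (B' ≫ B''))
    (whiskerRight_eqToHom' (assoc' A B B') B'') (whiskerLeft_eqToHom' A (assoc' B B' B''))
  triangle A B := eqToHom_comp_eq (E := Hom _ _) (assoc' A (𝟙 _) B) _ _
    (whiskerRight_eqToHom' (comp_id' A) B) (whiskerLeft_eqToHom' A (id_comp' B))

instance : Strict (Ix D) where
  id_comp := id_comp'
  comp_id := comp_id'
  assoc := assoc'
  leftUnitor_eqToIso _ := rfl
  rightUnitor_eqToIso _ := rfl
  associator_eqToIso _ _ _ := rfl

/-- The diagram of the pseudolimit of a diagram of 2-pro-objects. -/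
def diagram (D : StrictPseudofunctor Kᵒᵖ (Pro C)) : StrictPseudofunctor (Ix D)ᵒᵖ C :=
  twoFunctorMk
    { obj := fun o => o.unop.val
      map := fun A => Hom.r A.unop
      map₂ := fun x => Hom₂.θ x.unop2 }
    (fun _ => rfl) (fun _ _ => rfl) (fun _ _ _ _ => HEq.rfl) (fun _ _ => HEq.rfl)

end Ix

/-! ### Isomorphisms of a 2-filtered pseudocolimit at a stage -/

namespace PseudoColim

variable {I : Type v} [Bicategory.{v, v} I] [Strict I] [IsTwoFiltered I]
  {F : StrictPseudofunctor I Cat.{v, v}} {i : I} {x y : F.obj i}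

/-- An isomorphism of the pseudocolimit is represented by an isomorphism. -/
theorem exists_iso_push_comp_incl (m : (⟨i, x⟩ : PseudoColim F) ≅ ⟨i, y⟩) :
    ∃ (k : I) (w : i ⟶ k) (f : ob(F.map w) x ≅ ob(F.map w) y),
      (push w x).hom ≫ incl k f.hom = m.hom ≫ (push w y).hom := by
  obtain ⟨k, w, f, h⟩ := exists_push_comp_incl m.hom
  have hf : IsIso (incl k f) := by
    rw [← Iso.eq_inv_comp] at h
    rw [h]
    infer_instance
  obtain ⟨l, p, hp⟩ := exists_isIso_map_of_isIso_incl hf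
  have hp' : IsIso (extend p f) := by
    have h₁ : ∀ {a b a' b' : F.obj l} (_ : a = a') (_ : b = b') {g : a ⟶ b} {g' : a' ⟶ b'}
        (_ : g ≍ g') (_ : IsIso g), IsIso g' := by
      rintro a b _ _ rfl rfl g _ rfl h
      exact h
    exact h₁ (Functor.congr_obj (congrArg Cat.Hom.toFunctor (F.map_comp w p)).symm x)
      (Functor.congr_obj (congrArg Cat.Hom.toFunctor (F.map_comp w p)).symm y)
      (extend_heq p f).symm hp
  exact ⟨l, w ≫ p, asIso (extend p f), push_comp_extend (a := ⟨i, x⟩) (b := ⟨i, y⟩) h p⟩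

end PseudoColim

variable {C : Type u} [Bicategory.{v, v} C] [Strict C] {K : Type v} [Bicategory.{v, v} K] [Strict K]

/-! ### The index 2-category is 2-filtered -/

namespace Ix

variable {D : StrictPseudofunctor Kᵒᵖ (Pro C)}

/-- The arrow from an index along an arrow of the indexing 2-category of the diagram. -/
def ofObj (o : Ix D) {l : K} (w : o.k ⟶ l) :
    o ⟶ ⟨l, ((act (D := D) w o.val).obj (o.elt (𝟙 _))).idx⟩ :=
  Hom.mk (o' := ⟨l, ((act (D := D) w o.val).obj (o.elt (𝟙 _))).idx⟩) w
    ((act (D := D) w o.val).obj (o.elt (𝟙 _))).el (Iso.refl _)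

/-- The arrow given by an arrow of the index 2-category of a value of the diagram. -/
def inc {k : K} {i q : idxAt D k} (a : i ⟶ q) : (⟨k, i⟩ : Ix D) ⟶ ⟨k, q⟩ :=
  Hom.mk (o := ⟨k, i⟩) (o' := ⟨k, q⟩) (𝟙 k) ((diagAt D k).map a.op)
    (eqToIso (Functor.congr_obj (act_id k _) _) ≪≫
      PseudoColim.push (F := homDiagram (diagAt D k) _) a (𝟙 _) ≪≫
      eqToIso (PseudoColim.mk_congr (Strict.comp_id _)))

lemma inc_ψ_heq {k : K} {i q : idxAt D k} (a : i ⟶ q) :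
    (inc a).ψ.hom ≍ (PseudoColim.push (F := homDiagram (diagAt D k) _) a (𝟙 _)).hom :=
  (id_comp_heq rfl (Functor.congr_obj (act_id k _) _) _
    (eqToHom_heq (Functor.congr_obj (act_id k _) _) (Functor.congr_obj (act_id k _) _))).trans
    (comp_id_heq rfl (PseudoColim.mk_congr (Strict.comp_id _).symm) _
      (eqToHom_heq (PseudoColim.mk_congr (Strict.comp_id _)) rfl))

lemma inc_ext_heq {k : K} {i q : idxAt D k} (a : i ⟶ q) {E : C}
    (f : (diagAt D k).obj (op i) ⟶ E) :
    (Hom.ext (inc a) (o := ⟨k, i⟩) (o' := ⟨k, q⟩) f).hom ≍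
      (PseudoColim.push (F := homDiagram (diagAt D k) E) a f).hom := by
  refine (Hom.ext_heq (inc a) (o := ⟨k, i⟩) (o' := ⟨k, q⟩) f).trans ?_
  refine (map_heq _ (Functor.congr_obj (act_id k _) _)
    (PseudoColim.mk_congr (Strict.comp_id _).symm) (inc_ψ_heq a)).trans ?_
  exact (L_map_push_heq _ f a _).trans (PseudoColim.push_heq rfl (Strict.id_comp f))

lemma comp_inc_ψ_heq {o : Ix D} {l : K} {p q : idxAt D l} (A : o ⟶ ⟨l, p⟩) (a : p ⟶ q) :
    (A ≫ inc a).ψ.hom ≍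
      A.ψ.hom ≫ (PseudoColim.push (F := homDiagram (diagAt D l) o.val) a A.r).hom := by
  refine (Hom.comp_heq A (inc a)).trans ?_
  exact comp_heq (Functor.congr_obj (act_id l _) _) (Functor.congr_obj (act_id l _) _) rfl
    (map_heq_of_eq (act_id l _) _) (inc_ext_heq a A.r)

/-- The 2-cell given by a representative of an arrow between elements. -/
def twoCell {o : Ix D} {l : K} {p p' q : idxAt D l} {A : o ⟶ ⟨l, p⟩} {B : o ⟶ ⟨l, p'⟩}
    (α : A.u ⟶ B.u)
    (m : (⟨p, A.r⟩ : PseudoColim (homDiagram (diagAt D l) o.val)) ⟶ ⟨p', B.r⟩)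
    (hm : A.ψ.hom ≫ m = (act₂ α o.val).app (o.elt (𝟙 _)) ≫ B.ψ.hom)
    (a : p ⟶ q) (b : p' ⟶ q)
    (θ : (diagAt D l).map a.op ≫ A.r ⟶ (diagAt D l).map b.op ≫ B.r)
    (h : (PseudoColim.push (F := homDiagram (diagAt D l) o.val) a A.r).hom ≫
        PseudoColim.incl (F := homDiagram (diagAt D l) o.val) q θ =
      m ≫ (PseudoColim.push (F := homDiagram (diagAt D l) o.val) b B.r).hom) :
    A ≫ inc a ⟶ B ≫ inc b where
  α := α ▷ 𝟙 l
  θ := θ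
  w := by
    have hα : (act₂ (α ▷ 𝟙 l) o.val).app (o.elt (𝟙 _)) ≍ (act₂ α o.val).app (o.elt (𝟙 _)) :=
      act₂_heq (Strict.comp_id _) (Strict.comp_id _) (whiskerRight_id_heq α) _
    refine eq_of_heq ?_
    refine (comp_heq (congrArg (fun u => (act u o.val).obj (o.elt (𝟙 _))) (Strict.comp_id A.u))
      rfl rfl (comp_inc_ψ_heq A a) HEq.rfl).trans ?_
    refine HEq.trans (heq_of_eq ?_)
      (comp_heq (congrArg (fun u => (act u o.val).obj (o.elt (𝟙 _))) (Strict.comp_id A.u))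
      (congrArg (fun u => (act u o.val).obj (o.elt (𝟙 _))) (Strict.comp_id B.u))
      rfl hα (comp_inc_ψ_heq B b)).symm
    exact (Category.assoc _ _ _).trans <| (congrArg (A.ψ.hom ≫ ·) h).trans <|
      (Category.assoc _ _ _).symm.trans <| (congrArg (· ≫ _) hm).trans (Category.assoc _ _ _)

/-- A 2-cell with invertible components is invertible. -/
noncomputable def isoMk {o o' : Ix D} {A B : o ⟶ o'} (x : A ⟶ B) (_ : IsIso x.α)
    (hθ : IsIso x.θ) : A ≅ B where
  hom := x
  inv := Hom₂.mk (inv x.α) (@inv _ _ _ _ x.θ hθ) (by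
    have h₁ : (act₂ (inv x.α) o.val).app (o.elt (𝟙 _)) ≫ (act₂ x.α o.val).app (o.elt (𝟙 _)) = 𝟙 _ :=
      (NatTrans.congr_app (act₂_comp (inv x.α) x.α o.val) _).symm.trans <|
        (NatTrans.congr_app (congrArg (fun β => act₂ β o.val) (IsIso.inv_hom_id x.α)) _).trans
        (NatTrans.congr_app (act₂_id B.u o.val) _)
    have h₂ : PseudoColim.incl (F := homDiagram (diagAt D o'.k) o.val) o'.i x.θ ≫
        PseudoColim.incl (F := homDiagram (diagAt D o'.k) o.val) o'.i (@inv _ _ _ _ x.θ hθ) = 𝟙 _ :=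
      (PseudoColim.incl_comp _ _ _).symm.trans
        ((congrArg (PseudoColim.incl _) (@IsIso.hom_inv_id _ _ _ _ x.θ hθ)).trans (PseudoColim.incl_id _ _))
    have hw := x.w
    refine (Category.id_comp _).symm.trans <| (congrArg (· ≫ _) h₁.symm).trans <|
      (Category.assoc _ _ _).trans <| congrArg (_ ≫ ·) ?_
    refine (Category.assoc _ _ _).symm.trans <| (congrArg (· ≫ _) hw.symm).trans <|
      (Category.assoc _ _ _).trans <| (congrArg (_ ≫ ·) h₂).trans (Category.comp_id _))
  hom_inv_id := Hom₂.ext' (IsIso.hom_inv_id x.α) (@IsIso.hom_inv_id _ _ _ _ x.θ hθ)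
  inv_hom_id := Hom₂.ext' (IsIso.inv_hom_id x.α) (@IsIso.inv_hom_id _ _ _ _ x.θ hθ)

/-- The isomorphisms `ψ` of `A` and `B` turn `α` into an isomorphism between the elements given by
`A.r` and `B.r`. It is represented by an isomorphism of arrows of `C` after some `a`, and this is
the component `θ` of an invertible 2-cell. -/
lemma exists_comp_inc_iso {o : Ix D} {l : K} {p : idxAt D l} (A B : o ⟶ ⟨l, p⟩) (α : A.u ≅ B.u) :
    ∃ (q : idxAt D l) (a : p ⟶ q), Nonempty (A ≫ inc a ≅ B ≫ inc a) := by
  have h₁ : IsIso ((act₂ α.hom o.val).app (o.elt (𝟙 _))) :=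
    ⟨(act₂ α.inv o.val).app (o.elt (𝟙 _)),
      (NatTrans.congr_app (act₂_comp α.hom α.inv o.val) _).symm.trans <|
        (NatTrans.congr_app (congrArg (fun β => act₂ β o.val) α.hom_inv_id) _).trans
        (NatTrans.congr_app (act₂_id A.u o.val) _),
      (NatTrans.congr_app (act₂_comp α.inv α.hom o.val) _).symm.trans <|
        (NatTrans.congr_app (congrArg (fun β => act₂ β o.val) α.inv_hom_id) _).trans
        (NatTrans.congr_app (act₂_id B.u o.val) _)⟩
  let m := A.ψ.symm ≪≫ asIso ((act₂ α.hom o.val).app (o.elt (𝟙 _))) ≪≫ B.ψ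
  obtain ⟨q, a, θ, h⟩ := PseudoColim.exists_iso_push_comp_incl
    (F := homDiagram (diagAt D l) o.val) m
  have hm : A.ψ.hom ≫ m.hom = (act₂ α.hom o.val).app (o.elt (𝟙 _)) ≫ B.ψ.hom :=
    (Category.assoc _ _ _).symm.trans <|
      (congrArg (· ≫ _) A.ψ.hom_inv_id).trans (Category.id_comp _)
  exact ⟨q, a, ⟨isoMk (twoCell α.hom m.hom hm a a θ.hom h)
    (inferInstanceAs (IsIso (α.hom ▷ 𝟙 l))) (inferInstanceAs (IsIso θ.hom))⟩⟩

variable [IsTwoFiltered K]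

/-- Each axiom is applied first in `K`, which settles the components `u` and `α`. Then
2-filteredness of the index 2-category at the new object of `K` settles `r` and `θ`. -/
instance : IsTwoFiltered (Ix D) where
  exists_cospan o o' := by
    obtain ⟨l, ⟨w⟩, ⟨w'⟩⟩ := IsTwoFiltered.exists_cospan o.k o'.k
    obtain ⟨q, ⟨a⟩, ⟨b⟩⟩ := IsTwoFiltered.exists_cospan (I := idxAt D l)
      ((act (D := D) w o.val).obj (o.elt (𝟙 _))).idx ((act (D := D) w' o'.val).obj (o'.elt (𝟙 _))).idx
    exact ⟨⟨l, q⟩, ⟨o.ofObj w ≫ inc a⟩, ⟨o'.ofObj w' ≫ inc b⟩⟩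
  exists_iso {o o'} A B := by
    obtain ⟨l, w, ⟨α⟩⟩ := IsTwoFiltered.exists_iso A.u B.u
    obtain ⟨q, a, ⟨e⟩⟩ := exists_comp_inc_iso (A ≫ o'.ofObj w) (B ≫ o'.ofObj w) α
    exact ⟨⟨l, q⟩, o'.ofObj w ≫ inc a, ⟨eqToIso (assoc' _ _ _).symm ≪≫ e ≪≫ eqToIso (assoc' _ _ _)⟩⟩
  exists_eq {o o' A B} x y := by
    obtain ⟨l, w, h⟩ := IsTwoFiltered.exists_eq x.α y.α
    let x' := x ▷ o'.ofObj w
    let y' := y ▷ o'.ofObj w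
    -- As `ψ` is invertible, the law `w` determines the image of `θ` in the pseudocolimit from `α`;
    -- equality of the `θ` themselves then holds at a later index.
    have h₁ : PseudoColim.incl (F := homDiagram (diagAt D l) o.val) _ x'.θ =
        PseudoColim.incl (F := homDiagram (diagAt D l) o.val) _ y'.θ := by
      refine (cancel_epi (A ≫ o'.ofObj w).ψ.hom).1 ?_
      exact x'.w.trans ((congrArg (fun β => (act₂ β o.val).app (o.elt (𝟙 _)) ≫ _) h).trans y'.w.symm)
    obtain ⟨q, a, h₂⟩ := PseudoColim.exists_map_eq_of_incl_eq h₁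
    have h₃ : x' ▷ inc a = y' ▷ inc a := Hom₂.ext' (congrArg (· ▷ 𝟙 l) h) h₂
    refine ⟨⟨l, q⟩, o'.ofObj w ≫ inc a, ?_⟩
    rw [Bicategory.whiskerRight_comp, Bicategory.whiskerRight_comp]
    exact congrArg (fun z => _ ≫ z ≫ _) h₃

end Ix

/-! ### The action of a section on elements -/

section RanMap

variable {C : Type u} [Bicategory.{v, v} C] [Strict C] {F : StrictPseudofunctor C Cat.{v, v}}
  {X Y : Pro C}

/-- The action of a section on elements. -/
abbrev Sec.ext {I : Type v} [Bicategory.{v, v} I] [Strict I] {Z : StrictPseudofunctor Iᵒᵖ C}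
    (s : Sec (Z.comp F)) (E : C) : PseudoColim (homDiagram Z E) ⥤ F.obj E :=
  (TwoNat.app (ofSecObj s) E).toFunctor

lemma ranMap_ext (f : X ⟶ Y) (s : Sec ((Pro.diagram X).comp F)) (E : C) :
    ((ranMap F f).obj s).ext E = (TwoNat.app (ph f) E).toFunctor ⋙ s.ext E :=
  congrArg (fun θ : L (Pro.diagram Y) ⟶ F => (TwoNat.app θ E).toFunctor)
    (ofSec_toSecObj (ph f ≫ ofSecObj s))

end RanMap

variable {C : Type u} [Bicategory.{v, v} C] [Strict C] {K : Type v} [Bicategory.{v, v} K] [Strict K]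

/-! ### Sections over the index 2-category are sections of sections -/

namespace Ix

variable {D : StrictPseudofunctor Kᵒᵖ (Pro C)} {F : StrictPseudofunctor C Cat.{v, v}}

/-- The components of the structural isomorphisms of a section. -/
abbrev isoAt (t : Sec (D.comp (ran F))) (o : Ix D) {l : K} (u : o.k ⟶ l) :
    Sec.pt (t.pt o.k) o.i ≅ (Sec.ext (F := F) (t.pt l) o.val).obj ((act u o.val).obj (o.elt (𝟙 _))) :=
  (Sec.eval ((diagAt D o.k).comp F) o.i).mapIso (t.iso u)

lemma isoAt_id_heq (t : Sec (D.comp (ran F))) (o : Ix D) :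
    (isoAt t o (𝟙 o.k)).hom ≍ 𝟙 (Sec.pt (t.pt o.k) o.i) :=
  Sec.hom_app_heq (G := (diagAt D o.k).comp F) (g := 𝟙 (t.pt o.k)) rfl
    (obj_id (D.comp (ran F)) _ _) (t.iso_id o.k) o.i

lemma isoAt_comp_heq (t : Sec (D.comp (ran F))) (o : Ix D) {l m : K} (u : o.k ⟶ l) (w : l ⟶ m) :
    (isoAt t o (u ≫ w)).hom ≍ (isoAt t o u).hom ≫
      ap(Modif.app (ofSecMap (F := F) (t.iso w).hom) o.val) ((act u o.val).obj (o.elt (𝟙 _))) :=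
  Sec.hom_app_heq rfl (obj_comp (D.comp (ran F)) _ _ _) (t.iso_comp u w) o.i

lemma isoAt_map₂ (t : Sec (D.comp (ran F))) (o : Ix D) {l : K} {u w : o.k ⟶ l} (α : u ⟶ w) :
    (isoAt t o u).hom ≫ (Sec.ext (F := F) (t.pt l) o.val).map ((act₂ α o.val).app (o.elt (𝟙 _))) =
      (isoAt t o w).hom :=
  congrArg (fun h => Sec.Hom.app h o.i) (t.iso_map₂ α)

lemma ext_naturality {l : K} {s s' : Sec ((diagAt D l).comp F)} (h : s ⟶ s') {E : C}
    {x : PseudoColim (homDiagram (diagAt D l) E)} {i : idxAt D l} {f : (diagAt D l).obj (op i) ⟶ E}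
    (m : x ⟶ ⟨i, f⟩) :
    ap(Modif.app (ofSecMap h) E) x ≫ (s'.ext E).map m =
      (s.ext E).map m ≫ mp(F.map f) (Sec.Hom.app h i) :=
  ((Modif.app (ofSecMap h) E).toNatTrans.naturality m).symm

lemma ext_ext_heq {l : K} (s : Sec ((diagAt D l).comp F)) {o : Ix D} {i : idxAt D l}
    (A : o ⟶ ⟨l, i⟩) {E : C} (f : o.val ⟶ E) :
    (s.ext E).map (Hom.ext A f).hom ≍ mp(F.map f) ((s.ext o.val).map (Hom.ψ A).hom) := by
  refine (map_heq (s.ext E) (Hom.obj_eq A f) rfl (Hom.ext_heq A f)).trans ?_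
  exact nat_map_heq (ofSecObj s) f _

/-- The section over the index 2-category given by a section of the values. -/
def flattenObj (t : Sec (D.comp (ran F))) : Sec ((Ix.diagram D).comp F) where
  pt o := Sec.pt (t.pt o.k) o.i
  -- The isomorphism of `t` along `u` ends at the value on the transported generic element; `ψ`
  -- replaces that element by the one given by `r`, whose value is `F.map r` of the point at `o'`.
  iso {o o'} A := isoAt t o (Hom.u A) ≪≫ (Sec.ext (F := F) (t.pt o'.k) o.val).mapIso (Hom.ψ A)
  iso_id o := by
    have e : (act (D := D) (𝟙 o.k) o.val).obj (o.elt (𝟙 _)) = o.elt (𝟙 _) :=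
      Functor.congr_obj (act_id o.k o.val) _
    refine HEq.trans (comp_id_heq (congrArg (Sec.ext (F := F) (t.pt o.k) o.val).obj e) rfl
      (isoAt t o (𝟙 o.k)).hom ?_) (isoAt_id_heq t o)
    exact (map_heq (Sec.ext (F := F) (t.pt o.k) o.val) e rfl (eqToHom_heq e e)).trans
      (functor_map_id_heq _ _)
  iso_comp {o o' o''} A B := by
    let T := Sec.ext (F := F) (t.pt o''.k) o.val
    have e := Functor.congr_obj (act_comp (D := D) (Hom.u A) (Hom.u B) o.val) (o.elt (𝟙 _))
    have h₂ := ext_naturality (F := F) (t.iso (Hom.u B)).hom (Hom.ψ A).hom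
    have h₃ := ranMap_ext (F := F) (D.map (Hom.u B).op) (t.pt o''.k) o.val
    have h₄ : T.map (Hom.ψ (A ≫ B)).hom ≍
        (Sec.ext (F := F) ((ranMap F (D.map (Hom.u B).op)).obj (t.pt o''.k)) o.val).map
          (Hom.ψ A).hom ≫ mp(F.map (Hom.r A)) ((Sec.ext (F := F) (t.pt o''.k) o'.val).map
            (Hom.ψ B).hom) := by
      refine (map_heq T e rfl (Hom.comp_heq A B)).trans ?_
      refine (functor_map_comp_heq T _ _).trans ?_
      exact comp_heq (Functor.congr_obj h₃ _).symm (Functor.congr_obj h₃ _).symm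
        (obj_comp F _ _ _) (map_heq_of_eq h₃ _).symm (ext_ext_heq _ B (Hom.r A))
    refine (comp_heq rfl ?_ (obj_comp F _ _ _) (isoAt_comp_heq t o (Hom.u A) (Hom.u B)) h₄).trans ?_
    · exact (congrArg T.obj e).trans (Functor.congr_obj h₃ _).symm
    · refine heq_of_eq ?_
      refine (Category.assoc _ _ _).trans <| (congrArg ((isoAt t o (Hom.u A)).hom ≫ ·) <|
        (Category.assoc _ _ _).symm.trans <| (congrArg (· ≫ _) h₂).trans <|
        (Category.assoc _ _ _).trans <| congrArg (_ ≫ ·)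
          (CategoryTheory.Functor.map_comp _ _ _).symm).trans (Category.assoc _ _ _).symm
  iso_map₂ {o o' A B} x := by
    let T := Sec.ext (F := F) (t.pt o'.k) o.val
    refine (Category.assoc _ _ _).trans <| (congrArg ((isoAt t o (Hom.u A)).hom ≫ ·) <|
      (T.map_comp (Hom.ψ A).hom (PseudoColim.incl (F := homDiagram (diagAt D o'.k) o.val) o'.i
        (Hom₂.θ x))).symm.trans <| (congrArg T.map (Hom₂.w x)).trans <| T.map_comp _ _).trans <|
      (Category.assoc _ _ _).symm.trans <| congrArg (· ≫ _) (isoAt_map₂ t o (Hom₂.α x))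

/-- The section over the index 2-category given by a section of the values. -/
def flatten (D : StrictPseudofunctor Kᵒᵖ (Pro C)) (F : StrictPseudofunctor C Cat.{v, v}) :
    Sec (D.comp (ran F)) ⥤ Sec ((Ix.diagram D).comp F) where
  obj := flattenObj
  map {t t'} h :=
    { app := fun o => Sec.Hom.app (h.app o.k) o.i
      naturality := fun {o o'} A => by
        have h₁ : Sec.Hom.app (h.app o.k) o.i ≫ (isoAt t' o (Hom.u A)).hom =
            (isoAt t o (Hom.u A)).hom ≫ ap(Modif.app (ofSecMap (F := F) (h.app o'.k)) o.val)
              ((act (Hom.u A) o.val).obj (o.elt (𝟙 _))) :=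
          congrArg (fun h => Sec.Hom.app h o.i) (h.naturality (Hom.u A))
        refine (Category.assoc _ _ _).symm.trans <| (congrArg (· ≫ _) h₁).trans <|
          (Category.assoc _ _ _).trans <| (congrArg (_ ≫ ·)
            (ext_naturality (F := F) (h.app o'.k) (Hom.ψ A).hom)).trans (Category.assoc _ _ _).symm }
  map_id _ := Sec.hom_ext fun _ => rfl
  map_comp _ _ := Sec.hom_ext fun _ => rfl

lemma inc_id {k : K} (i : idxAt D k) : inc (𝟙 i) = 𝟙 (⟨k, i⟩ : Ix D) :=
  Hom.ext' rfl ((diagAt D k).map_id _) (by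
    have e := Functor.congr_obj (act_id (D := D) k ((diagAt D k).obj (op i))) ⟨i, 𝟙 _⟩
    exact (inc_ψ_heq _).trans ((PseudoColim.push_id_heq _ _).trans (eqToHom_heq e e).symm))

lemma inc_comp {k : K} {i j q : idxAt D k} (a : i ⟶ j) (b : j ⟶ q) :
    inc (a ≫ b) = (inc a : (⟨k, i⟩ : Ix D) ⟶ ⟨k, j⟩) ≫ inc b :=
  Hom.ext' (Strict.id_comp _).symm ((diagAt D k).map_comp b.op a.op) (by
    refine HEq.trans ?_ (comp_inc_ψ_heq (inc a) b).symm
    refine (inc_ψ_heq _).trans ((PseudoColim.push_comp_heq a b _).symm.trans ?_)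
    exact comp_heq (Functor.congr_obj (act_id k _) _).symm (PseudoColim.mk_congr (Strict.comp_id _))
      (PseudoColim.mk_congr (congrArg _ (Strict.comp_id _))) (inc_ψ_heq a).symm
      (PseudoColim.push_heq rfl (Strict.comp_id _)))

/-- The 2-cell given by a 2-cell of the index 2-category of a value of the diagram. -/
def inc₂ {k : K} {i q : idxAt D k} {a b : i ⟶ q} (α : a ⟶ b) :
    (inc a : (⟨k, i⟩ : Ix D) ⟶ ⟨k, q⟩) ⟶ inc b where
  α := 𝟙 (𝟙 k)
  θ := (diagAt D k).map₂ (Bicategory.Opposite.op2 α)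
  w := by
    have e := Functor.congr_obj (act_id (D := D) k ((diagAt D k).obj (op i))) ⟨i, 𝟙 _⟩
    refine Eq.trans (eq_of_heq ?_) ((Category.id_comp _).symm.trans (congrArg (· ≫ (inc b).ψ.hom)
        (NatTrans.congr_app (act₂_id (𝟙 k) _) _).symm))
    refine HEq.trans (comp_heq e (PseudoColim.mk_congr (Strict.comp_id _).symm)
      (PseudoColim.mk_congr (Strict.comp_id _).symm) (inc_ψ_heq a) (PseudoColim.incl_heq
        (F := homDiagram (diagAt D k) _) (Strict.comp_id _).symm (Strict.comp_id _).symm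
        (whiskerRight_id_heq _).symm)) ?_
    exact (heq_of_eq (PseudoColim.push_map₂ (F := homDiagram (diagAt D k) _) α (𝟙 _))).trans
      (inc_ψ_heq b).symm

/-- The restriction of a section to the index 2-category of a value. -/
def restrict (s : Sec ((Ix.diagram D).comp F)) (k : K) : Sec ((diagAt D k).comp F) where
  pt i := s.pt ⟨k, i⟩
  iso a := s.iso (inc a)
  iso_id i := (s.iso_heq (inc_id i)).trans (s.iso_id _)
  iso_comp a b := (s.iso_heq (inc_comp a b)).trans (s.iso_comp _ _)
  iso_map₂ α := s.iso_map₂ (inc₂ α)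

lemma iso_comp_inc_heq (s : Sec ((Ix.diagram D).comp F)) {o : Ix D} {l : K} {p q : idxAt D l}
    (A : o ⟶ ⟨l, p⟩) (a : p ⟶ q) : (s.iso (A ≫ inc a)).hom ≍
      (s.iso A).hom ≫ ((restrict s l).ext o.val).map
        (PseudoColim.push (F := homDiagram (diagAt D l) o.val) a (Hom.r A)).hom :=
  (s.iso_comp A (inc a)).trans (comp_heq rfl rfl (obj_comp F _ _ _).symm HEq.rfl
    (ofSecObj_push_heq (restrict s l) a (Hom.r A)).symm)

/-- The key to inverting `flatten`: the isomorphisms of `s` respect arbitrary arrows `m` of the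
pseudocolimit, not only 2-cells of `Ix D`. The reason is that `m` has a representative at some
index, by 2-filteredness of the index 2-category at `l`, and this representative is a 2-cell of `Ix
D` after composition with arrows `inc`. -/
lemma iso_comp_restrict (s : Sec ((Ix.diagram D).comp F)) {o : Ix D} {l : K} {p p' : idxAt D l}
    {A : o ⟶ ⟨l, p⟩} {B : o ⟶ ⟨l, p'⟩} (α : A.u ⟶ B.u)
    (m : (⟨p, A.r⟩ : PseudoColim (homDiagram (diagAt D l) o.val)) ⟶ ⟨p', B.r⟩)
    (hm : A.ψ.hom ≫ m = (act₂ α o.val).app (o.elt (𝟙 _)) ≫ B.ψ.hom) :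
    (s.iso A).hom ≫ ((restrict s l).ext o.val).map m = (s.iso B).hom := by
  obtain ⟨q, a, b, θ, h⟩ := PseudoColim.exists_representative m
  have h₁ := s.iso_map₂ (twoCell α m hm a b θ h)
  let R := (restrict s l).ext o.val
  have h₂ := (R.map_comp _ _).symm.trans ((congrArg R.map h).trans (R.map_comp _ _))
  -- After composition with the invertible image of `push b`, the claim is the law `iso_map₂` of `s`
  -- for the 2-cell given by the representative.
  refine (cancel_mono (R.mapIso (PseudoColim.push
    (F := homDiagram (diagAt D l) o.val) b B.r)).hom).1 ?_
  refine (Category.assoc _ _ _).trans <| (congrArg (_ ≫ ·) h₂.symm).trans <|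
    (Category.assoc _ _ _).symm.trans <| eq_of_heq ?_
  refine (comp_heq rfl ?_ rfl (iso_comp_inc_heq s A a).symm HEq.rfl).trans <|
    (heq_of_eq h₁).trans (iso_comp_inc_heq s B b)
  rfl

lemma ofObj_ext_heq (o : Ix D) {l : K} (u : o.k ⟶ l) {E : C} (f : o.val ⟶ E) :
    (Hom.ext (ofObj o u) f).hom ≍ 𝟙 ((act u E).obj (o.elt f)) :=
  (Hom.ext_heq (ofObj o u) f).trans ((functor_map_id_heq _ _).trans
    (id_heq (Hom.obj_eq (ofObj o u) f).symm))

lemma inc_comp_ofObj_ψ_heq {k l : K} (u : k ⟶ l) {i j : idxAt D k} (a : i ⟶ j) :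
    ((inc a : (⟨k, i⟩ : Ix D) ⟶ ⟨k, j⟩) ≫ ofObj ⟨k, j⟩ u).ψ.hom ≍
      (act (D := D) u _).map
        (PseudoColim.push (F := homDiagram (diagAt D k) _) a (𝟙 ((diagAt D k).obj (op i)))).hom := by
  have e := Functor.congr_obj (act_id (D := D) k ((diagAt D k).obj (op i))) ⟨i, 𝟙 _⟩
  refine (Hom.comp_heq _ _).trans ?_
  refine HEq.trans (comp_id_heq rfl (Hom.obj_eq (ofObj ⟨k, j⟩ u) _).symm _
    (ofObj_ext_heq ⟨k, j⟩ u _)) ?_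
  exact map_heq (act u _) e (PseudoColim.mk_congr (Strict.comp_id _).symm) (inc_ψ_heq a)

/-- This square makes the isomorphisms along `ofObj` a morphism of sections. The direct route along
`u` and the route through `inc a` differ by the transported `push a`, so `iso_comp_restrict`
applies. -/
lemma ofObj_comp_restrict_iso (s : Sec ((Ix.diagram D).comp F)) {k l : K} (u : k ⟶ l)
    {i j : idxAt D k} (a : i ⟶ j) :
    (s.iso (ofObj (⟨k, i⟩ : Ix D) u)).hom ≫
        (Sec.iso ((ranMap F (D.map u.op)).obj (restrict s l)) a).hom =
      (s.iso (inc a)).hom ≫ mp(F.map ((diagAt D k).map a.op))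
        (s.iso (ofObj (⟨k, j⟩ : Ix D) u)).hom := by
  let B := (inc a : (⟨k, i⟩ : Ix D) ⟶ ⟨k, j⟩) ≫ ofObj ⟨k, j⟩ u
  let R := (restrict s l).ext ((diagAt D k).obj (op i))
  let α : u ⟶ Hom.u B := eqToHom (Strict.id_comp u).symm
  have e : (act u _).obj (⟨i, 𝟙 _⟩ : PseudoColim (homDiagram (diagAt D k) _)) =
      (act (Hom.u B) _).obj ⟨i, 𝟙 _⟩ :=
    congrArg (fun w => (act w ((diagAt D k).obj (op i))).obj ⟨i, 𝟙 _⟩) (Strict.id_comp u).symm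
  have e' : (⟨_, Hom.r B⟩ : PseudoColim (homDiagram (diagAt D l) _)) =
      (act u _).obj ⟨j, (diagAt D k).map a.op ≫ 𝟙 _⟩ :=
    (Hom.obj_eq (ofObj (⟨k, j⟩ : Ix D) u) _).symm.trans
      (congrArg (act u _).obj (PseudoColim.mk_congr (Strict.comp_id _).symm))
  let m := (act₂ α ((diagAt D k).obj (op i))).app ⟨i, 𝟙 _⟩ ≫ (Hom.ψ B).hom
  have hm : m ≍ (act (D := D) u _).map
        (PseudoColim.push (F := homDiagram (diagAt D k) _) a (𝟙 ((diagAt D k).obj (op i)))).hom :=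
    (id_comp_heq e.symm rfl _ (act₂_eqToHom_heq (Strict.id_comp u).symm _)).trans
      (inc_comp_ofObj_ψ_heq u a)
  have h₁ := iso_comp_restrict s (A := ofObj (⟨k, i⟩ : Ix D) u) (B := B) α m (Category.id_comp _)
  refine eq_of_heq ?_
  refine HEq.trans ?_ ((heq_of_eq h₁).trans (s.iso_comp _ _))
  refine comp_heq rfl rfl ?_ HEq.rfl ?_
  · exact (obj_comp F _ _ _).symm
  · refine (toSec_iso_heq (ph (D.map u.op) ≫ ofSecObj (restrict s l)) a).trans ?_
    exact map_heq R rfl e'.symm hm.symm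

lemma iso_ofObj_id_heq (s : Sec ((Ix.diagram D).comp F)) {k : K} (i : idxAt D k) :
    (s.iso (ofObj (⟨k, i⟩ : Ix D) (𝟙 k))).hom ≍ 𝟙 (s.pt ⟨k, i⟩) := by
  have e := Functor.congr_obj (act_id (D := D) k ((diagAt D k).obj (op i))) ⟨i, 𝟙 _⟩
  have h := iso_comp_restrict s (A := 𝟙 (⟨k, i⟩ : Ix D)) (B := ofObj (⟨k, i⟩ : Ix D) (𝟙 k))
    (𝟙 (𝟙 k)) (eqToHom e.symm) ((eqToHom_trans e e.symm).trans
      ((NatTrans.congr_app (act₂_id (𝟙 k) _) _).symm.trans (Category.comp_id _).symm))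
  let R := (restrict s k).ext ((diagAt D k).obj (op i))
  refine (heq_of_eq h.symm).trans (HEq.trans ?_ (s.iso_id _))
  exact comp_id_heq rfl (congrArg R.obj e) _ ((map_heq R rfl e (eqToHom_heq e.symm rfl)).trans
    (functor_map_id_heq _ _))

lemma ofObj_comp_ofObj_ψ_heq (o : Ix D) {l m : K} (u : o.k ⟶ l) (w : l ⟶ m) :
    (Hom.ψ (ofObj o u ≫ ofObj _ w)).hom ≍ 𝟙 ((act (u ≫ w) o.val).obj (o.elt (𝟙 _))) := by
  have e₁ := Functor.congr_obj (act_comp (D := D) u w o.val) (o.elt (𝟙 _))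
  let o' : Ix D := ⟨l, ((act (D := D) u o.val).obj (o.elt (𝟙 _))).idx⟩
  let r : o'.val ⟶ o.val := ((act (D := D) u o.val).obj (o.elt (𝟙 _))).el
  have h₁ := ofObj_ext_heq o' w r
  have h₂ : (act w o.val).map (Hom.ψ (ofObj o u)).hom ≍
      𝟙 ((act w o.val).obj ((act u o.val).obj (o.elt (𝟙 _)))) :=
    functor_map_id_heq (act w o.val) _
  have h₃ := comp_id_heq rfl (Hom.obj_eq (ofObj o' w) r).symm
    ((act w o.val).map (Hom.ψ (ofObj o u)).hom) h₁
  exact (Hom.comp_heq (ofObj o u) (ofObj o' w)).trans (h₃.trans (h₂.trans (id_heq e₁.symm)))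

lemma iso_ofObj_comp_heq (s : Sec ((Ix.diagram D).comp F)) {k l m : K} (u : k ⟶ l) (w : l ⟶ m)
    (i : idxAt D k) : (s.iso (ofObj (⟨k, i⟩ : Ix D) (u ≫ w))).hom ≍
      (s.iso (ofObj (⟨k, i⟩ : Ix D) u ≫ ofObj _ w)).hom := by
  let A := ofObj (⟨k, i⟩ : Ix D) u ≫ ofObj _ w
  have e₁ := Functor.congr_obj (act_comp (D := D) u w ((diagAt D k).obj (op i))) ⟨i, 𝟙 _⟩
  have e₂ := Hom.obj_eq (ofObj (⟨l, _⟩ : Ix D) w) (Hom.r (ofObj (⟨k, i⟩ : Ix D) u))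
  have e : (⟨_, Hom.r A⟩ : PseudoColim (homDiagram (diagAt D m) _)) =
      (act (u ≫ w) _).obj ⟨i, 𝟙 _⟩ := e₂.symm.trans e₁.symm
  have hA := ofObj_comp_ofObj_ψ_heq (⟨k, i⟩ : Ix D) u w
  have h := iso_comp_restrict s (A := A) (B := ofObj (⟨k, i⟩ : Ix D) (u ≫ w))
    (𝟙 (u ≫ w)) (eqToHom e) (Eq.trans (eq_of_heq ((comp_id_heq rfl e.symm _
      (eqToHom_heq e rfl)).trans hA)) ((NatTrans.congr_app (act₂_id (u ≫ w) _) _).symm.trans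
        (Category.comp_id _).symm))
  let R := (restrict s m).ext ((diagAt D k).obj (op i))
  refine (heq_of_eq h.symm).trans ?_
  exact comp_id_heq rfl (congrArg R.obj e.symm) _ ((map_heq R rfl e.symm (eqToHom_heq e rfl)).trans
    (functor_map_id_heq _ _))

/-- The section of the values given by a section over the index 2-category. -/
def unflattenObj (s : Sec ((Ix.diagram D).comp F)) : Sec (D.comp (ran F)) where
  pt k := restrict s k
  iso {k l} u := Sec.isoMk (fun i => s.iso (ofObj (⟨k, i⟩ : Ix D) u))
    (fun a => ofObj_comp_restrict_iso s u a)
  iso_id k := Sec.hom_heq (G := (diagAt D k).comp F) rfl (obj_id (D.comp (ran F)) _ _)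
    fun i => iso_ofObj_id_heq s i
  iso_comp {k l m} u w := Sec.hom_heq (G := (diagAt D k).comp F) rfl
    (obj_comp (D.comp (ran F)) _ _ _)
    fun i => (iso_ofObj_comp_heq s u w i).trans (s.iso_comp _ _)
  iso_map₂ {k l u w} α := Sec.hom_ext (G := (diagAt D k).comp F) fun i =>
    iso_comp_restrict s (A := ofObj (⟨k, i⟩ : Ix D) u) (B := ofObj (⟨k, i⟩ : Ix D) w) α
      ((act₂ α _).app ⟨i, 𝟙 _⟩) ((Category.id_comp _).trans (Category.comp_id _).symm)

/-- The inverse restricts a section along the arrows `inc` and `ofObj`. Nothing is lost: an arrow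
`A` differs from `ofObj o A.u` only by `A.ψ`, so `iso_comp_restrict` recovers the isomorphism at
`A`. -/
lemma catIso_flatten : CatIso (flatten D F) := by
  let T : Sec ((Ix.diagram D).comp F) ⥤ Sec (D.comp (ran F)) :=
    { obj := unflattenObj
      map := fun {s s'} h =>
        { app := fun k =>
            { app := fun i => h.app ⟨k, i⟩
              naturality := fun a => h.naturality (inc a) }
          naturality := fun {k l} u => Sec.hom_ext fun i => h.naturality (ofObj (⟨k, i⟩ : Ix D) u) }
      map_id := fun _ => Sec.hom_ext fun _ => Sec.hom_ext fun _ => rfl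
      map_comp := fun _ _ => Sec.hom_ext fun _ => Sec.hom_ext fun _ => rfl }
  have h₁ (t) : unflattenObj (flattenObj (D := D) (F := F) t) = t := by
    have hp (k : K) : restrict (flattenObj t) k = t.pt k :=
      Sec.ext' (G := (diagAt D k).comp F) (fun _ => rfl) fun {i j} a => by
        have e := Functor.congr_obj (act_id (D := D) k ((diagAt D k).obj (op i))) ⟨i, 𝟙 _⟩
        let R := Sec.ext (F := F) (t.pt k) ((diagAt D k).obj (op i))
        refine HEq.trans (id_comp_heq (congrArg R.obj e) (obj_id F _ _).symm _
          ((isoAt_id_heq t ⟨k, i⟩).trans (id_heq (obj_id F _ _).symm))) ?_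
        refine (map_heq R e (PseudoColim.mk_congr (Strict.comp_id _).symm) (inc_ψ_heq a)).trans ?_
        exact (ofSecObj_push_heq _ a _).trans (map_id_heq F _ _)
    refine Sec.ext' hp fun {k l} u => ?_
    refine Sec.hom_heq (G := (diagAt D k).comp F) (hp k) (congrArg (ranMap F (D.map u.op)).obj (hp l))
      fun i => ?_
    exact comp_id_heq rfl rfl _
      (functor_map_id_heq (Sec.ext (F := F) (t.pt l) ((diagAt D k).obj (op i))) _)
  have h₂ (s) : flattenObj (unflattenObj (D := D) (F := F) s) = s :=
    Sec.ext' (fun _ => rfl) fun {o o'} A => heq_of_eq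
      (iso_comp_restrict s (A := ofObj o (Hom.u A)) (B := A) (𝟙 _) (Hom.ψ A).hom
        (congrArg (· ≫ (Hom.ψ A).hom) (NatTrans.congr_app (act₂_id (Hom.u A) _) _).symm))
  refine ⟨T, CategoryTheory.Functor.hext h₁ fun t t' _ => ?_,
    CategoryTheory.Functor.hext h₂ fun s s' _ => ?_⟩
  · exact Sec.hom_heq (h₁ t) (h₁ t') fun k => Sec.hom_heq (congrArg (fun z => Sec.pt z k) (h₁ t))
      (congrArg (fun z => Sec.pt z k) (h₁ t')) fun i => HEq.rfl
  · exact Sec.hom_heq (h₂ s) (h₂ s') fun o => HEq.rfl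

end Ix

variable {C : Type u} [Bicategory.{v, v} C] [Strict C]

/-! ### The extension of `L Z` is `Pro(Z, -)` -/

section Represented

/-- Sections of a 2-functor `L Z`, as arrows of 2-pro-objects. -/
abbrev secToPro (Z X : Pro C) :
    Sec ((Pro.diagram X).comp (L (Pro.diagram Z))) ⥤ (Z ⟶ X) := ofSec ⋙ toPro Z X

lemma catIso_secToPro (Z X : Pro C) : CatIso (secToPro Z X) := catIso_ofSec.comp (catIso_toPro Z X)

lemma ranMap_secToPro (Z : Pro C) {X Y : Pro C} (f : X ⟶ Y) :
    ranMap (L (Pro.diagram Z)) f ⋙ secToPro Z Y = secToPro Z X ⋙ Bicategory.postcomp Z f :=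
  (congrArg (· ⋙ toPro Z Y) (ranMap_comp_ofSec (L (Pro.diagram Z)) f)).trans rfl

lemma ranMap₂_secToPro_heq (Z : Pro C) {X Y : Pro C} {f g : X ⟶ Y} (η : f ⟶ g)
    (s : Sec ((Pro.diagram X).comp (L (Pro.diagram Z)))) :
    (secToPro Z Y).map ((ranMap₂ (L (Pro.diagram Z)) η).app s) ≍ (secToPro Z X).obj s ◁ η :=
  pro_heq (Functor.congr_obj (ranMap_secToPro Z f) s) (Functor.congr_obj (ranMap_secToPro Z g) s)
    (ofSec_map_ranMap₂_heq _ η s)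

variable {K : Type v} [Bicategory.{v, v} K] [Strict K] (D : StrictPseudofunctor Kᵒᵖ (Pro C))

/-- The values of the extension of `L Z` are the categories of arrows from `Z`. -/
def homNatRan (Z : Pro C) : HomNat (D.comp (ran (L (Pro.diagram Z)))) D Z where
  app k := secToPro Z (D.obj (op k))
  nat u := ranMap_secToPro Z (D.map u.op)
  nat₂ α x := ranMap₂_secToPro_heq Z (D.map₂ (Bicategory.Opposite.op2 α)) x

variable {D} {V : Pro C} (σ : Pseudocone D V)

lemma secOf_map_ran_iso_heq (F : StrictPseudofunctor C Cat.{v, v})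
    (s : Sec ((Pro.diagram V).comp F)) {k l : K} (u : k ⟶ l) :
    (Sec.iso ((secOf (σ.map (ran F))).obj s) u).hom ≍ (ranMap₂ F (σ.πIso u).hom).app s :=
  cat_app_heq rfl ((ran F).map_comp _ _).symm (σ.map_πIso_heq (ran F) u) s

/-- Under the identification of the extension of `L Z` with the arrows from `Z`, composition with
`σ` is the section map of the image cone in `Cat`. -/
lemma secToPro_comp_precompose (Z : Pro C) :
    secToPro Z V ⋙ σ.precompose Z =
      secOf (σ.map (ran (L (Pro.diagram Z)))) ⋙ (homNatRan D Z).functor := by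
  have h (s) : (secToPro Z V ⋙ σ.precompose Z).obj s =
      (secOf (σ.map (ran (L (Pro.diagram Z)))) ⋙ (homNatRan D Z).functor).obj s := by
    refine Pseudocone.ext' (fun k => (Functor.congr_obj (ranMap_secToPro Z (σ.π k)) s).symm) ?_
    intro k l u
    refine (σ.precompose_πIso_heq _ u).trans ?_
    refine HEq.trans ?_ ((homNatRan D Z).pseudocone_πIso_heq _ u).symm
    refine (ranMap₂_secToPro_heq Z (σ.πIso u).hom s).symm.trans ?_
    exact map_heq (secToPro Z _) rfl (Functor.congr_obj (congrArg Cat.Hom.toFunctor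
      ((ran (L (Pro.diagram Z))).map_comp (σ.π l) (D.map u.op))) s)
      (secOf_map_ran_iso_heq σ (L (Pro.diagram Z)) s u).symm
  exact CategoryTheory.Functor.hext h fun s t f => Pseudocone.hom_heq (h s) (h t) fun k =>
    (map_heq_of_eq (ranMap_secToPro Z (σ.π k)) f).symm

lemma catIso_secOf_of_isPseudolimit (hσ : σ.IsPseudolimit) (Z : Pro C) :
    CatIso (secOf (σ.map (ran (L (Pro.diagram Z))))) := by
  have h := (catIso_secToPro Z V).comp (hσ Z)
  rw [secToPro_comp_precompose] at h
  exact h.of_comp_right ((homNatRan D Z).catIso_functor fun _ => catIso_secToPro Z _)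

end Represented

/-! ### Detecting invertible arrows of 2-pro-objects -/

section Invertible

variable {X Y : Pro C}

/-- An arrow of 2-pro-objects is invertible if its actions on the categories of arrows are. -/
lemma catIso_ranMap (f : X ⟶ Y) (h : ∀ Z : Pro C, CatIso (ranMap (L (Pro.diagram Z)) f))
    (F : StrictPseudofunctor C Cat.{v, v}) : CatIso (ranMap F f) := by
  have hp (Z : Pro C) : CatIso (Bicategory.postcomp Z f) := by
    have h₁ := (h Z).comp (catIso_secToPro Z Y)
    rw [ranMap_secToPro] at h₁
    exact h₁.of_comp_left (catIso_secToPro Z X)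
  -- The Yoneda argument: surjectivity at `Y` gives a one-sided inverse, injectivity at `X` makes it
  -- two-sided, and `ran F` preserves inverses.
  obtain ⟨g, hg⟩ := (hp Y).obj_bijective.2 (𝟙 Y)
  have hg' : f ≫ g = 𝟙 X := (hp X).obj_bijective.1 (by
    change (f ≫ g) ≫ f = 𝟙 X ≫ f
    change g ≫ f = 𝟙 Y at hg
    rw [Strict.assoc, hg, Strict.comp_id, Strict.id_comp])
  have e₁ := (ran F).map_comp f g
  have e₂ := (ran F).map_comp g f
  rw [hg', (ran F).map_id] at e₁
  change g ≫ f = 𝟙 Y at hg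
  rw [hg, (ran F).map_id] at e₂
  exact ⟨ranMap F g, congrArg Cat.Hom.toFunctor e₁.symm, congrArg Cat.Hom.toFunctor e₂.symm⟩

end Invertible

/-! ### The extension preserves small 2-cofiltered pseudolimits -/

section Preservation

variable {K : Type v} [Bicategory.{v, v} K] [Strict K] [IsTwoFiltered K]
  {D : StrictPseudofunctor Kᵒᵖ (Pro C)}

variable (D) in
/-- The pseudolimit of a diagram of 2-pro-objects. -/
def flatPro : Pro C := ({ I := Ix D, diagram := Ix.diagram D } : TwoProObj.{v, u} C)

variable {V : Pro C} (σ : Pseudocone D V)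

/-- The section over the index 2-category which corresponds to a pseudocone. -/
def coneSec : Sec ((Ix.diagram D).comp (L (Pro.diagram V))) :=
  (Ix.flatten D (L (Pro.diagram V))).obj
    ((secOf (σ.map (ran (L (Pro.diagram V))))).obj (toSec.obj (𝟙 (L (Pro.diagram V)))))

/-- The arrow to the pseudolimit which corresponds to a pseudocone. -/
def comparison : V ⟶ flatPro D := (toPro V (flatPro D)).obj (ofSec.obj (coneSec σ))

/-- The isomorphisms which induce the structural isomorphisms of the sections over the index
2-category given by a pseudocone. -/
def coneHom {o o' : Ix D} (A : o ⟶ o') :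
    ob(TwoNat.app (ph (σ.π o.k)) o.val) (o.elt (𝟙 _)) ⟶
      ob(TwoNat.app (ph (σ.π o'.k)) o.val) (o'.elt (Ix.Hom.r A)) :=
  ap(Modif.app (pm (σ.πIso (Ix.Hom.u A)).hom) o.val) (o.elt (𝟙 _)) ≫
    mp(TwoNat.app (ph (σ.π o'.k)) o.val) (Ix.Hom.ψ A).hom

/-- The arrow `coneHom σ A` involves neither `F` nor `s`. This uniformity is what allows a single
arrow `comparison σ` to serve for all `F`. -/
lemma flatten_secOf_iso_heq (F : StrictPseudofunctor C Cat.{v, v})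
    (s : Sec ((Pro.diagram V).comp F)) {o o' : Ix D} (A : o ⟶ o') :
    (Sec.iso ((Ix.flatten D F).obj ((secOf (σ.map (ran F))).obj s)) A).hom ≍
      (s.ext o.val).map (coneHom σ A) := by
  refine HEq.trans ?_ (functor_map_comp_heq (s.ext o.val) _ _).symm
  have e := ranMap_ext (F := F) (σ.π o'.k) s o.val
  refine comp_heq rfl (Functor.congr_obj e _) (Functor.congr_obj e _) ?_ (map_heq_of_eq e _)
  exact Sec.hom_app_heq (G := (diagAt D o.k).comp F) rfl
    (Functor.congr_obj (congrArg Cat.Hom.toFunctor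
      ((ran F).map_comp (σ.π o'.k) (D.map (Ix.Hom.u A).op))) s).symm
    (secOf_map_ran_iso_heq σ F s (Ix.Hom.u A)) o.i

lemma ext_toSec_id (V : Pro C) (E : C) :
    (Sec.ext (toSec.obj (𝟙 (L (Pro.diagram V)))) E) = 𝟭 _ :=
  congrArg (fun θ : L (Pro.diagram V) ⟶ L (Pro.diagram V) => (TwoNat.app θ E).toFunctor)
    (ofSec_toSecObj (𝟙 (L (Pro.diagram V))))

lemma comparison_gen (o : Ix D) :
    ob(TwoNat.app (ph (comparison σ)) o.val) (⟨o, 𝟙 _⟩ : PseudoColim (homDiagram (Ix.diagram D) _)) =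
      ob(TwoNat.app (ph (σ.π o.k)) o.val) (o.elt (𝟙 _)) :=
  (obj_id (L (Pro.diagram V)) _ _).trans (Functor.congr_obj (ext_toSec_id V o.val) _)

lemma comparison_obj (o : Ix D) {E : C} (g : o.val ⟶ E) :
    ob(TwoNat.app (ph (comparison σ)) E) (⟨o, g⟩ : PseudoColim (homDiagram (Ix.diagram D) E)) =
      ob(TwoNat.app (ph (σ.π o.k)) E) (o.elt g) := by
  refine (nat_obj_eq (ph (comparison σ)) _).trans (Eq.trans ?_ (nat_obj_eq (ph (σ.π o.k)) _).symm)
  exact congrArg ((L (Pro.diagram V)).map g).toFunctor.obj (comparison_gen σ o)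

lemma comparison_push_heq {o o' : Ix D} (A : o ⟶ o') :
    mp(TwoNat.app (ph (comparison σ)) o.val)
      (PseudoColim.push (F := homDiagram (Ix.diagram D) _) A (𝟙 _)).hom ≍ coneHom σ A := by
  refine (ofSecObj_push_heq (coneSec σ) A (𝟙 _)).trans ?_
  refine (map_id_heq (L (Pro.diagram V)) _ _).trans ?_
  exact (flatten_secOf_iso_heq σ _ _ A).trans (map_heq_of_eq (ext_toSec_id V o.val) _)

/-- A Yoneda argument: `comparison σ` was defined as the value of the left side on the identity, for
`F` the `L` of `V`. For general `F`, both sides send `s` to the image under `s.ext` of that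
universal value. -/
lemma secOf_comp_flatten (F : StrictPseudofunctor C Cat.{v, v}) :
    secOf (σ.map (ran F)) ⋙ Ix.flatten D F = ranMap F (comparison σ) := by
  have h (s) : (secOf (σ.map (ran F)) ⋙ Ix.flatten D F).obj s =
      (ranMap F (comparison σ)).obj s := by
    refine Sec.ext' (G := (Ix.diagram D).comp F)
      (fun o => congrArg (s.ext o.val).obj (comparison_gen σ o).symm) fun {o o'} A => ?_
    refine (flatten_secOf_iso_heq σ F s A).trans ?_
    refine HEq.trans ?_ (toSec_iso_heq (ph (comparison σ) ≫ ofSecObj s) A).symm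
    refine map_heq (s.ext o.val) (comparison_gen σ o).symm ?_ (comparison_push_heq σ A).symm
    exact (congrArg (TwoNat.app (ph (σ.π o'.k)) o.val).toFunctor.obj (PseudoColim.mk_congr
      (Strict.comp_id (Ix.Hom.r A)).symm)).trans (comparison_obj σ o' _).symm
  exact CategoryTheory.Functor.hext h fun s t f =>
    Sec.hom_heq (G := (Ix.diagram D).comp F) (h s) (h t) fun o =>
      app_heq (Modif.app (ofSecMap f) o.val).toNatTrans (comparison_gen σ o).symm

/-- For `F = L Z` the section map of the image cone is invertible because `σ` is a pseudolimit,
hence so is the action of `comparison σ`. Then `comparison σ` acts invertibly for every `F`, and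
removing the isomorphism `flatten` gives the section map of the image cone. No pseudocone with
vertex `flatPro D` is needed. -/
theorem ran_preserves (F : StrictPseudofunctor C Cat.{v, v}) :
    PreservesCofilteredPseudolimits.{v} (ran F) := by
  intro K _ _ _ D V σ hσ
  have h (Z : Pro C) : CatIso (ranMap (L (Pro.diagram Z)) (comparison σ)) := by
    rw [← secOf_comp_flatten]
    exact (catIso_secOf_of_isPseudolimit σ hσ Z).comp Ix.catIso_flatten
  rw [isPseudolimit_iff_catIso_secOf]
  have h' := catIso_ranMap (comparison σ) h F
  rw [← secOf_comp_flatten] at h'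
  exact h'.of_comp_right Ix.catIso_flatten

end Preservation

variable {C : Type u} [Bicategory.{v, v} C] [Strict C]

/-- Passing to a full sub-2-category does not change the categories of arrows. -/
lemma catIso_mapFunctor_cStar (H K : HomPlus C) : CatIso ((cStar C).mapFunctor H K) := by
  have h : CatIso (InducedBicategory.forget.mapFunctor H K) :=
    ⟨{ obj := fun θ => InducedBicategory.mkHom θ, map := fun ρ => InducedBicategory.mkHom₂ ρ },
      rfl, rfl⟩
  exact h.comp (catIso_mapFunctor_precomp _
    (Subtype.property (p := PreservesCofilteredPseudolimits.{v}) K))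

end TwoPro

theorem mainTheorem2 (C : Type u) [CategoryTheory.Bicategory.{v, v} C]
    [CategoryTheory.Bicategory.Strict C] :
    TwoPro.IsTwoEquivalence (TwoPro.cStar C) :=
  TwoPro.isTwoEquivalence_of_catIso TwoPro.catIso_mapFunctor_cStar
    fun F => ⟨⟨TwoPro.ran F, TwoPro.ran_preserves F⟩, TwoPro.nonempty_comp_ran_iso F⟩
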